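/- Let $d\ge 1$, let $\Omega\subset\mathbb R^d$ be a bounded convex polyhedral domain, and let $A=\Delta$ be the Laplacian on $L^2(\Omega)$ with homogeneous Dirichlet boundary condition, $\mathcal D(A)=H^1_0(\Omega)\cap H^2(\Omega)$. Let $0<\alpha<1$, let $1\le m\le k\le 6$ be integers and let $\mu>-1$. For $T>0$ and $v,q\in L^2(\Omega)$ put $g(t)=t^\mu q$ and $G(t)=J^mg(t)$, where $J^\beta\varphi(t)=\frac1{\Gamma(\beta)}\int_0^t(t-s)^{\beta-1}\varphi(s)\,ds$, and let $V$ be a solution, continuous on $(0,T]$ with values in $L^2(\Omega)$, of $$\partial_t^\alpha V(t)-AV(t)=\partial_t^m\Big(\frac{t^m}{m!}Av+G(t)\Big),\qquad 0<t\le T,$$ with zero initial value, where $\partial_t^\alpha V=\frac{d}{dt}J^{1-\alpha}V$ is the Riemann–Liouville derivative. The zero initial value means that $J^{1-\alpha}V(t)\to0$ as $t\to0^+$ (which is implied by $V(t)\to 0$); here $(t-s)^{-\alpha}V(s)$ is assumed integrable in $s\in(0,t)$ for every $t\in(0,T]$. Let $N\ge1$, $\tau=T/N$, $t_n=n\tau$,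 and let $V^0=0,V^1,\dots,V^N$ be the solution of the ID$m$-BDF$k$ scheme $$\partial^\alpha_{\tau,k}V^n-AV^n=\partial^m_{\tau,k}\Big(\frac{t_n^m}{m!}Av+G(t_n)\Big),\qquad 1\le n\le N,$$ where $\partial^\beta_{\tau,k}\varphi^n=\tau^{-\beta}\sum_{j=0}^n\omega_j^{(\beta,k)}\varphi^{n-j}$ and $\sum_{j\ge0}\omega_j^{(\beta,k)}\xi^j=\big(\sum_{j=1}^k\frac1j(1-\xi)^j\big)^\beta$. Since $v$ is only in $L^2(\Omega)$, the terms with $A$ are combined in both equations: with $b(t)=\partial_t^m(t^m/m!)=1$ and $b^n=\partial^m_{\tau,k}(t_n^m/m!)$ it is required that $V(t)+b(t)v\in\mathcal D(A)$ and $V^n+b^nv\in\mathcal D(A)$, and $AV+b\,Av$ stands for $A(V+bv)$. Then there is a constant $c>0$, independent of $T$, $N$, $n$, $v$, $q$ and of the solutions, such that for all $1\le n\le N$ $$\|V^n-V(t_n)\|\le c\big(\tau^{p}t_n^{-p}+\tau^kt_n^{-k}\big)\|v\|+c\,\tau^{\mu+m+1}t_n^{\alpha-m-1}\|q\|+c\,\tau^kt_n^{\alpha+\mu-k}\|q\|,$$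 where $\|\cdot\|$ is the norm of $L^2(\Omega)$, and $p=m+1$ if $m$ is odd, $p=m+2$ if $m$ is even. Hence $k$th-order convergence is recovered for $m$ large enough: if $p\ge k$ and $\mu+m+1\ge k$ (in particular if $m=k$), then, with $c$ as above, $$\|V^n-V(t_n)\|\le c\,\tau^k\big(t_n^{-k}\|v\|+t_n^{\alpha+\mu-k}\|q\|\big).$$ -/

import Mathlib

open MeasureTheory Filter Topology

noncomputable section

namespace Subdiffusion

/-! ### The Dirichlet Laplacian -/

/-- A (bounded) convex polyhedral domain: the nonempty interior of the convex hull of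
finitely many points. -/
def IsConvexPolyhedralDomain {d : ℕ} (Ω : Set (EuclideanSpace ℝ (Fin d))) : Prop :=
  Ω.Nonempty ∧
    ∃ s : Set (EuclideanSpace ℝ (Fin d)), s.Finite ∧ Ω = interior (convexHull ℝ s)

/-- The space `L²(Ω)` of (classes of) complex-valued functions, with its usual norm. -/
abbrev L2 {d : ℕ} (Ω : Set (EuclideanSpace ℝ (Fin d))) : Type :=
  Lp ℂ 2 (volume.restrict Ω)

/-- Test functions: smooth, with compact support contained in `Ω`. -/
def IsTestFunction {d : ℕ} (Ω : Set (EuclideanSpace ℝ (Fin d)))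
    (φ : EuclideanSpace ℝ (Fin d) → ℂ) : Prop :=
  ContDiff ℝ (⊤ : ℕ∞) φ ∧ HasCompactSupport φ ∧ tsupport φ ⊆ Ω

/-- The classical partial derivative `∂φ/∂xᵢ`. -/
def partialDeriv {d : ℕ} (i : Fin d) (φ : EuclideanSpace ℝ (Fin d) → ℂ)
    (x : EuclideanSpace ℝ (Fin d)) : ℂ :=
  fderiv ℝ φ x (EuclideanSpace.single i 1)

/-- `w ∈ L²(Ω)` is the weak partial derivative `∂u/∂xᵢ` of `u ∈ L²(Ω)`. -/
def HasWeakPartialDeriv {d : ℕ} (Ω : Set (EuclideanSpace ℝ (Fin d))) (i : Fin d)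
    (u w : L2 Ω) : Prop :=
  ∀ φ : EuclideanSpace ℝ (Fin d) → ℂ, IsTestFunction Ω φ →
    ∫ x in Ω, u x * partialDeriv i φ x = -∫ x in Ω, w x * φ x

/-- `u ∈ H¹₀(Ω)`: `u` has weak first derivatives in `L²(Ω)` and is a limit of test functions
in the `H¹(Ω)` norm. -/
def MemH10 {d : ℕ} (Ω : Set (EuclideanSpace ℝ (Fin d))) (u : L2 Ω) : Prop :=
  ∃ w : Fin d → L2 Ω, (∀ i, HasWeakPartialDeriv Ω i u (w i)) ∧
    ∀ ε : ℝ, 0 < ε → ∃ φ : EuclideanSpace ℝ (Fin d) → ℂ, IsTestFunction Ω φ ∧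
      eLpNorm (fun x => u x - φ x) 2 (volume.restrict Ω) < ENNReal.ofReal ε ∧
      ∀ i, eLpNorm (fun x => w i x - partialDeriv i φ x) 2 (volume.restrict Ω) <
        ENNReal.ofReal ε

/-- The graph of the Laplacian `A` with homogeneous Dirichlet boundary condition and domain
`D(A) = H¹₀(Ω) ∩ H²(Ω)`: the statement `u ∈ D(A)` and `A u = f`. The vectors `w i` and `h i j`
are the weak first and second derivatives of `u`, so their existence says `u ∈ H²(Ω)`. -/
def HasDirichletLaplacian {d : ℕ} (Ω : Set (EuclideanSpace ℝ (Fin d))) (u f : L2 Ω) : Prop :=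
  MemH10 Ω u ∧
    ∃ (w : Fin d → L2 Ω) (h : Fin d → Fin d → L2 Ω),
      (∀ i, HasWeakPartialDeriv Ω i u (w i)) ∧
      (∀ i j, HasWeakPartialDeriv Ω j (w i) (h i j)) ∧
      f = ∑ i, h i i

/-! ### Fractional calculus and convolution quadrature -/

/-- The (Riemann–Liouville) integral `J^β φ(t) = Γ(β)⁻¹ ∫₀ᵗ (t - s)^(β-1) φ(s) ds`. For `β = m`
a positive integer this is the `m`-fold integral. -/
def fracIntegral {F : Type*} [NormedAddCommGroup F] [NormedSpace ℝ F]
    (β : ℝ) (φ : ℝ → F) (t : ℝ) : F :=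
  (Real.Gamma β)⁻¹ • ∫ s in (0 : ℝ)..t, (t - s) ^ (β - 1) • φ s

/-- The generating polynomial of BDF`k` for step size one, `∑_{j=1}^k (1 - ξ)^j / j`. -/
def bdfPoly (k : ℕ) (ξ : ℂ) : ℂ :=
  ∑ j ∈ Finset.Icc 1 k, (1 - ξ) ^ j / (j : ℂ)

/-- The weight `ω_j^{(β,k)}`: the coefficient of `ξ^j` in the power series at `0` of
`(∑_{j=1}^k (1 - ξ)^j / j)^β` (principal branch; the base is positive at `ξ = 0`). -/
def bdfWeight (k : ℕ) (β : ℝ) (j : ℕ) : ℂ :=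
  iteratedDeriv j (fun ξ : ℂ => bdfPoly k ξ ^ (β : ℂ)) 0 / (j.factorial : ℂ)

/-- The BDF`k` convolution quadrature with step `τ`,
`∂^β_{τ,k} φⁿ = τ^(-β) ∑_{j=0}^n ω_j^{(β,k)} φ^{n-j}`. -/
def bdfCQ {F : Type*} [AddCommGroup F] [Module ℂ F]
    (τ : ℝ) (k : ℕ) (β : ℝ) (φ : ℕ → F) (n : ℕ) : F :=
  ((τ ^ (-β) : ℝ) : ℂ) • ∑ j ∈ Finset.range (n + 1), bdfWeight k β j • φ (n - j)

/-! ### The subdiffusion problem with source `t^μ q` and the smoothed scheme -/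

/-- The smoothed source `G = J^m g` for `g(t) = t^μ q`. -/
def smoothedSource {d : ℕ} {Ω : Set (EuclideanSpace ℝ (Fin d))} (m : ℕ) (μ : ℝ) (q : L2 Ω)
    (t : ℝ) : L2 Ω :=
  fracIntegral (m : ℝ) (fun s : ℝ => s ^ μ • q) t

/-- `V : (0,T] → L²(Ω)` solves
`∂_t^α V - A V = ∂_t^m (t^m/m! · A v + G)` for `0 < t ≤ T`, with zero initial value, where
`∂_t^α V = d/dt J^(1-α) V` is the Riemann–Liouville derivative.

As `v` is only in `L²(Ω)`, the two terms with `A` are combined: `V(t) + ∂_t^m(t^m/m!) v ∈ D(A)`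
and `A` is applied to this sum (for `v ∈ D(A)` this is the same equation).

The zero initial value is understood as `J^(1-α) V(t) → 0` for `t → 0+`. It holds whenever
`V(t) → 0`, but it also makes sense if `α + μ ≤ 0`, when in general `V(t)` does not tend to `0`. -/
structure IsSolution {d : ℕ} (Ω : Set (EuclideanSpace ℝ (Fin d))) (α T : ℝ) (m : ℕ) (μ : ℝ)
    (v q : L2 Ω) (V : ℝ → L2 Ω) : Prop where
  continuousOn : ContinuousOn V (Set.Ioc 0 T)
  integrable : ∀ t ∈ Set.Ioc 0 T,
    IntervalIntegrable (fun s : ℝ => (t - s) ^ (-α) • V s) volume 0 t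
  initial : Tendsto (fracIntegral (1 - α) V) (𝓝[>] 0) (𝓝 0)
  equation : ∀ t ∈ Set.Ioc 0 T, ∃ f : L2 Ω,
    HasDirichletLaplacian Ω
      (V t + iteratedDeriv m (fun s : ℝ => ((s ^ m / (m.factorial : ℝ) : ℝ) : ℂ)) t • v) f ∧
    HasDerivWithinAt (fracIntegral (1 - α) V)
      (f + iteratedDeriv m (smoothedSource m μ q) t) (Set.Ioc 0 T) t

/-- `V⁰, …, V^N` solve the ID`m`-BDF`k` scheme with step `τ`: `V⁰ = 0` and
`∂^α_{τ,k} Vⁿ - A Vⁿ = ∂^m_{τ,k} (t_n^m/m! · A v + Gⁿ)` for `1 ≤ n ≤ N`, where `t_n = n τ`.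

As above, the two terms with `A` are combined, so that the scheme makes sense for
`v ∈ L²(Ω)`. -/
structure IsDiscreteSolution {d : ℕ} (Ω : Set (EuclideanSpace ℝ (Fin d))) (α τ : ℝ) (N : ℕ)
    (m k : ℕ) (μ : ℝ) (v q : L2 Ω) (V : ℕ → L2 Ω) : Prop where
  initial : V 0 = 0
  equation : ∀ n : ℕ, 1 ≤ n → n ≤ N →
    HasDirichletLaplacian Ω
      (V n + bdfCQ τ k (m : ℝ)
        (fun i : ℕ => ((((i : ℝ) * τ) ^ m / (m.factorial : ℝ) : ℝ) : ℂ)) n • v)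
      (bdfCQ τ k α V n -
        bdfCQ τ k (m : ℝ) (fun i : ℕ => smoothedSource m μ q ((i : ℝ) * τ)) n)

/-- The order `m + 1` (odd `m`) or `m + 2` (even `m`) in the bound for the initial data. -/
def initialOrder (m : ℕ) : ℕ := if Odd m then m + 1 else m + 2

/-- The bound for the contribution of the initial data, without the constant:
`τ^(m+1) t^(-m-1) ‖v‖ + τ^k t^(-k) ‖v‖` for odd `m`, and
`τ^(m+2) t^(-m-2) ‖v‖ + τ^k t^(-k) ‖v‖` for even `m`. -/
def initialBound {d : ℕ} {Ω : Set (EuclideanSpace ℝ (Fin d))} (m k : ℕ) (τ t : ℝ) (v : L2 Ω) :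
    ℝ :=
  τ ^ (initialOrder m : ℝ) * t ^ (-(initialOrder m : ℝ)) * ‖v‖ +
    τ ^ (k : ℝ) * t ^ (-(k : ℝ)) * ‖v‖

end Subdiffusion

end

namespace Subdiffusion

/-! ### The generating polynomials on the unit disc -/

/-! The problem is reduced to a scalar one with a parameter x ≥ 0 and step size one, where all
constants must be uniform in x. Write δ for `bdfPoly k`. For a spectral value -λ of `A` and x = τ^α
λ, the scaled scheme has the generating function δ(ξ)^m / (δ(ξ)^α + x) · Σ n^γ ξ^n / Γ(γ+1), where γ
= m belongs to the initial data (with an additional factor -x) and γ = μ + m to the source. The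
corresponding exact solution is a Mittag-Leffler kernel with Laplace transform s^(m-γ-1) / (s^α +
x).

With ξ = e^(-s), Cauchy's formula makes the n-th coefficient an integral of e^(ns) over a vertical
segment of length 2π. Lipschitz' summation formula (`tsum_pow_mul_exp_eq_latticeSum`) continues the
power series to s^(-γ-1) plus a remainder that is regular at s = 0. The segment can then be deformed
towards a Hankel contour at distance 1/n from the origin, on which the exact kernel is also
represented (`hankel_mlSymbol`). There a difference |s|^ρ of the two symbols costs n^(-ρ-1)
(`exists_contour_comparison`).

The symbols differ for two reasons. First, δ(e^(-s)) is a truncated logarithmic series, so it equals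
s up to a relative error |s|^k; this gives the terms with τ^k. Second, the regular remainder is
multiplied by δ^m, which is of size |s|^m; this gives the terms governed by m. If γ = m is even, the
remainder vanishes at s = 0 by symmetry, whence the additional order for the initial data. Finally x
/ (|s|^α + x) ≤ 1 is used for the initial data, and 1 / (|s|^α + x) ≤ |s|^(-α) for the source.

Uniformity in x rests on |δ^α + x| ≥ c (|s|^α + x) (`norm_cpow_add_ge`, `exists_bdfSymbol_bounds`).
The analyticity and size of δ^α come from the fact that δ avoids the half-line (-∞, 0], i.e. from
the A(0)-stability of the BDF methods of order at most six, proved by Routh's algorithm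
(`bdfPoly_add_ne_zero`).

To return to L²(Ω), the resolvent R = (1 - A)⁻¹ is built as j j* with the embedding j of H¹₀ into
L². It is a positive contraction with dense range, and its continuous functional calculus provides
cut-offs that turn `A` into a bounded operator (`exists_spectral_cutoff`). The truncated solutions
are functions of R applied to the truncated data: by uniqueness for a Volterra equation
(`eq_mlSolution`) and for a recursion (`discrete_representation`). The scalar bounds become operator
bounds, and letting the cut-offs tend strongly to the identity gives the estimate
(`exists_error_bound`). -/

/-- Consecutive members of a Routh sequence at a point of the closed right half plane. -/
def RouthPair (p q : ℂ) : Prop :=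
  0 ≤ (p * (starRingEnd ℂ) q).re ∧ ¬(p = 0 ∧ q = 0)

theorem RouthPair.base {z : ℂ} (hz : 0 ≤ z.re) {a c : ℝ} (ha : 0 < a) (hc : 0 ≤ c) :
    RouthPair (c * z) a := by
  refine ⟨?_, fun h => ?_⟩
  · simp only [Complex.conj_ofReal, Complex.mul_re, Complex.ofReal_re, Complex.ofReal_im]
    simp only [zero_mul, mul_zero, sub_zero]
    positivity
  · exact ha.ne' (by exact_mod_cast h.2)

/-- Formally p/q = (c/a) z + (d/a) r/q, and r/q has nonnegative real part together with q/r. The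
case `c = 0` is needed, because the leading coefficients in the arrays below vanish at x = 0. -/
theorem RouthPair.step {z p q r : ℂ} (hz : 0 ≤ z.re) (h : RouthPair q r) {a c d : ℝ}
    (ha : 0 < a) (hc : 0 ≤ c) (hd : 0 < d) (heq : a * p = c * z * q + d * r) :
    RouthPair p q := by
  refine ⟨?_, fun h0 => ?_⟩
  · have h1 : a * (p * (starRingEnd ℂ) q).re =
        c * z.re * Complex.normSq q + d * (q * (starRingEnd ℂ) r).re := by
      have h2 : (a * (p * (starRingEnd ℂ) q)).re =
          ((c * z * q + d * r) * (starRingEnd ℂ) q).re := by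
        rw [← heq, mul_assoc]
      rw [Complex.re_ofReal_mul] at h2
      rw [h2]
      simp only [Complex.add_re, Complex.mul_re, Complex.mul_im, Complex.conj_re, Complex.conj_im,
        Complex.ofReal_re, Complex.ofReal_im, Complex.normSq_apply, Complex.add_im]
      ring
    have h3 : 0 ≤ c * z.re * Complex.normSq q + d * (q * (starRingEnd ℂ) r).re :=
      add_nonneg (mul_nonneg (mul_nonneg hc hz) (Complex.normSq_nonneg q))
        (mul_nonneg hd.le h.1)
    rw [← h1] at h3
    exact nonneg_of_mul_nonneg_right h3 ha
  · rw [h0.1, h0.2] at heq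
    have hr : r = 0 := by
      have : (d : ℂ) * r = 0 := by linear_combination -heq
      exact (mul_eq_zero.mp this).resolve_left (by exact_mod_cast hd.ne')
    exact h.2 ⟨h0.2, hr⟩

/-- If p = -q, then p q̄ = -|q|², so both vanish. In the application p and q are the even and the
odd part of a polynomial, whose value is therefore nonzero. -/
theorem RouthPair.add_ne_zero {p q : ℂ} (h : RouthPair p q) : p + q ≠ 0 := by
  intro h0
  have hp : p = -q := by linear_combination h0
  have h1 := h.1
  rw [hp, neg_mul, Complex.mul_conj, Complex.neg_re, Complex.ofReal_re] at h1
  have hq : q = 0 := Complex.normSq_eq_zero.mp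
    (le_antisymm (by linarith) (Complex.normSq_nonneg q))
  exact h.2 ⟨by rw [hp, hq, neg_zero], hq⟩

/-- The Cayley transform z = (1 + ξ)/(1 - ξ) maps the disc into the closed right half plane and
turns δ(ξ) + x, multiplied by a power of 1 + z, into a polynomial in z with coefficients depending
on x. Its even and odd parts start a Routh array. For each k ≤ 6 all entries are polynomials in x
with nonnegative coefficients, so stability holds for every x ≥ 0 at once. -/
theorem bdfPoly_add_ne_zero {k : ℕ} (hk1 : 1 ≤ k) (hk6 : k ≤ 6) {ξ : ℂ} (hξ : ‖ξ‖ ≤ 1)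
    (hξ1 : ξ ≠ 1) {x : ℝ} (hx : 0 ≤ x) : bdfPoly k ξ + x ≠ 0 := by
  have hw : (1 - ξ) ≠ 0 := sub_ne_zero.mpr (Ne.symm hξ1)
  set y : ℂ := 2 / (1 - ξ) with hy
  have hy0 : y ≠ 0 := div_ne_zero two_ne_zero hw
  have hwy : 1 - ξ = 2 / y := by rw [hy]; field_simp
  set z : ℂ := y - 1 with hzdef
  have hyz : y = 1 + z := by rw [hzdef]; ring
  have hz : 0 ≤ z.re := by
    have h1 : z = (1 + ξ) / (1 - ξ) := by rw [hzdef, hy]; field_simp; ring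
    have h3 : Complex.normSq ξ ≤ 1 := by
      rw [Complex.normSq_eq_norm_sq]; exact pow_le_one₀ (norm_nonneg _) hξ
    rw [Complex.normSq_apply] at h3
    rw [h1, Complex.div_re, ← add_div]
    apply div_nonneg _ (Complex.normSq_nonneg _)
    simp only [Complex.add_re, Complex.sub_re, Complex.one_re, Complex.add_im, Complex.sub_im,
      Complex.one_im]
    nlinarith
  intro h0
  unfold bdfPoly at h0
  rw [hwy] at h0
  interval_cases k
  · have hR : RouthPair (((x : ℝ) : ℂ) * z) ((2 + x : ℝ) : ℂ) :=
      RouthPair.base hz (by positivity) hx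
    apply hR.add_ne_zero
    have h1 := h0
    norm_num [Finset.sum_Icc_succ_top] at h1
    field_simp at h1
    rw [hyz] at h1
    push_cast at h1 ⊢
    linear_combination h1
  -- The arrays are listed from the bottom upwards. In each step `a`, `c` and `d` come from
  -- polynomial division, with the remainder rescaled to clear denominators; the last pair consists
  -- of the parts of the polynomial that vanishes by `h0`.
  · have R0 : RouthPair (((2 + 2 * x : ℝ) : ℂ) * z) ((1 : ℝ) : ℂ) :=
      RouthPair.base hz (by positivity) (by positivity)
    have R1 : RouthPair (x * z ^ 2 + (4 + x)) (((2 + 2 * x : ℝ) : ℂ) * z) :=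
      R0.step hz (a := 2 + 2 * x) (c := x) (d := 8 + 10 * x + 2 * x ^ 2)
        (by positivity) (by positivity) (by positivity) (by push_cast; ring)
    apply R1.add_ne_zero
    have h1 := h0
    norm_num [Finset.sum_Icc_succ_top] at h1
    field_simp at h1
    rw [hyz] at h1
    push_cast at h1 ⊢
    linear_combination h1
  · have R0 : RouthPair (((1 : ℝ) : ℂ) * z) ((1 : ℝ) : ℂ) :=
      RouthPair.base hz (by positivity) (by positivity)
    have R1 : RouthPair ((6 + 9 * x) * z ^ 2 + (20 + 3 * x)) (((1 : ℝ) : ℂ) * z) :=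
      R0.step hz (a := 1) (c := 6 + 9 * x) (d := 20 + 3 * x)
        (by positivity) (by positivity) (by positivity) (by push_cast; ring)
    have R2 : RouthPair (3 * x * z ^ 3 + (18 + 9 * x) * z)
        ((6 + 9 * x) * z ^ 2 + (20 + 3 * x)) :=
      R1.step hz (a := 6 + 9 * x) (c := 3 * x) (d := 108 + 156 * x + 72 * x ^ 2)
        (by positivity) (by positivity) (by positivity) (by push_cast; ring)
    apply R2.add_ne_zero
    have h1 := h0
    norm_num [Finset.sum_Icc_succ_top] at h1
    field_simp at h1
    rw [hyz] at h1
    linear_combination h1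
  · have R0 : RouthPair (((1 : ℝ) : ℂ) * z) ((1 : ℝ) : ℂ) :=
      RouthPair.base hz (by positivity) (by positivity)
    have R1 : RouthPair ((24 + 47 * x + 30 * x ^ 2) * z ^ 2 + (32 + 67 * x + 6 * x ^ 2))
        (((1 : ℝ) : ℂ) * z) :=
      R0.step hz (a := 1) (c := 24 + 47 * x + 30 * x ^ 2) (d := 32 + 67 * x + 6 * x ^ 2)
        (by positivity) (by positivity) (by positivity) (by push_cast; ring)
    have R2 : RouthPair ((6 + 12 * x) * z ^ 3 + (38 + 12 * x) * z)
        ((24 + 47 * x + 30 * x ^ 2) * z ^ 2 + (32 + 67 * x + 6 * x ^ 2)) :=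
      R1.step hz (a := 24 + 47 * x + 30 * x ^ 2) (c := 6 + 12 * x)
        (d := 720 + 1288 * x + 864 * x ^ 2 + 288 * x ^ 3)
        (by positivity) (by positivity) (by positivity) (by push_cast; ring)
    have R3 : RouthPair (3 * x * z ^ 4 + (24 + 18 * x) * z ^ 2 + (32 + 3 * x))
        ((6 + 12 * x) * z ^ 3 + (38 + 12 * x) * z) :=
      R2.step hz (a := 6 + 12 * x) (c := 3 * x) (d := 6)
        (by positivity) (by positivity) (by positivity) (by push_cast; ring)
    apply R3.add_ne_zero
    have h1 := h0
    norm_num [Finset.sum_Icc_succ_top] at h1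
    field_simp at h1
    rw [hyz] at h1
    linear_combination (1 / 4) * h1
  · have R0 : RouthPair (((1 : ℝ) : ℂ) * z) ((1 : ℝ) : ℂ) :=
      RouthPair.base hz (by positivity) (by positivity)
    have R1 : RouthPair ((3600 + 8629 * x + 8145 * x ^ 2 + 3150 * x ^ 3) * z ^ 2
          + (3840 + 9697 * x + 8235 * x ^ 2 + 450 * x ^ 3)) (((1 : ℝ) : ℂ) * z) :=
      R0.step hz (a := 1) (c := 3600 + 8629 * x + 8145 * x ^ 2 + 3150 * x ^ 3)
        (d := 3840 + 9697 * x + 8235 * x ^ 2 + 450 * x ^ 3)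
        (by positivity) (by positivity) (by positivity) (by push_cast; ring)
    have R2 : RouthPair ((75 + 185 * x + 150 * x ^ 2) * z ^ 3 + (175 + 411 * x + 90 * x ^ 2) * z)
        ((3600 + 8629 * x + 8145 * x ^ 2 + 3150 * x ^ 3) * z ^ 2
          + (3840 + 9697 * x + 8235 * x ^ 2 + 450 * x ^ 3)) :=
      R1.step hz (a := 3600 + 8629 * x + 8145 * x ^ 2 + 3150 * x ^ 3)
        (c := 75 + 185 * x + 150 * x ^ 2)
        (d := 342000 + 1552000 * x + 2308324 * x ^ 2 + 1663680 * x ^ 3 + 709200 * x ^ 4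
          + 216000 * x ^ 5)
        (by positivity) (by positivity) (by positivity) (by push_cast; ring)
    have R3 : RouthPair ((30 + 75 * x) * z ^ 4 + (310 + 150 * x) * z ^ 2 + (256 + 15 * x))
        ((75 + 185 * x + 150 * x ^ 2) * z ^ 3 + (175 + 411 * x + 90 * x ^ 2) * z) :=
      R2.step hz (a := 75 + 185 * x + 150 * x ^ 2) (c := 30 + 75 * x) (d := 5)
        (by positivity) (by positivity) (by positivity) (by push_cast; ring)
    have R4 : RouthPair (15 * x * z ^ 5 + (150 + 150 * x) * z ^ 3 + (350 + 75 * x) * z)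
        ((30 + 75 * x) * z ^ 4 + (310 + 150 * x) * z ^ 2 + (256 + 15 * x)) :=
      R3.step hz (a := 30 + 75 * x) (c := 15 * x) (d := 60)
        (by positivity) (by positivity) (by positivity) (by push_cast; ring)
    apply R4.add_ne_zero
    have h1 := h0
    norm_num [Finset.sum_Icc_succ_top] at h1
    field_simp at h1
    rw [hyz] at h1
    linear_combination (1 / 4) * h1
  · have R0 : RouthPair (((1 : ℝ) : ℂ) * z) ((1 : ℝ) : ℂ) :=
      RouthPair.base hz (by positivity) (by positivity)
    have R1 : RouthPair
        ((604800 + 1726425 * x + 2097657 * x ^ 2 + 1304910 * x ^ 3 + 340200 * x ^ 4) * z ^ 2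
          + (655200 + 1933481 * x + 2272833 * x ^ 2 + 1127790 * x ^ 3 + 37800 * x ^ 4))
        (((1 : ℝ) : ℂ) * z) :=
      R0.step hz (a := 1)
        (c := 604800 + 1726425 * x + 2097657 * x ^ 2 + 1304910 * x ^ 3 + 340200 * x ^ 4)
        (d := 655200 + 1933481 * x + 2272833 * x ^ 2 + 1127790 * x ^ 3 + 37800 * x ^ 4)
        (by positivity) (by positivity) (by positivity) (by push_cast; ring)
    have R2 : RouthPair ((1575 + 4591 * x + 5298 * x ^ 2 + 2520 * x ^ 3) * z ^ 3
          + (2415 + 6627 * x + 6282 * x ^ 2 + 1080 * x ^ 3) * z)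
        ((604800 + 1726425 * x + 2097657 * x ^ 2 + 1304910 * x ^ 3 + 340200 * x ^ 4) * z ^ 2
          + (655200 + 1933481 * x + 2272833 * x ^ 2 + 1127790 * x ^ 3 + 37800 * x ^ 4)) :=
      R1.step hz
        (a := 604800 + 1726425 * x + 2097657 * x ^ 2 + 1304910 * x ^ 3 + 340200 * x ^ 4)
        (c := 1575 + 4591 * x + 5298 * x ^ 2 + 2520 * x ^ 3)
        (d := 428652000 + 2124070200 * x + 4378640884 * x ^ 2 + 4445584548 * x ^ 3
          + 2360181600 * x ^ 4 + 841309200 * x ^ 5 + 504144000 * x ^ 6 + 272160000 * x ^ 7)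
        (by positivity) (by positivity) (by positivity) (by push_cast; ring)
    have R3 : RouthPair ((180 + 535 * x + 525 * x ^ 2) * z ^ 4
          + (660 + 1902 * x + 630 * x ^ 2) * z ^ 2 + (416 + 1263 * x + 45 * x ^ 2))
        ((1575 + 4591 * x + 5298 * x ^ 2 + 2520 * x ^ 3) * z ^ 3
          + (2415 + 6627 * x + 6282 * x ^ 2 + 1080 * x ^ 3) * z) :=
      R2.step hz (a := 1575 + 4591 * x + 5298 * x ^ 2 + 2520 * x ^ 3)
        (c := 180 + 535 * x + 525 * x ^ 2) (d := 1 + 3 * x)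
        (by positivity) (by positivity) (by positivity) (by push_cast; ring)
    have R4 : RouthPair ((30 + 90 * x) * z ^ 5 + (460 + 300 * x) * z ^ 3 + (606 + 90 * x) * z)
        ((180 + 535 * x + 525 * x ^ 2) * z ^ 4
          + (660 + 1902 * x + 630 * x ^ 2) * z ^ 2 + (416 + 1263 * x + 45 * x ^ 2)) :=
      R3.step hz (a := 180 + 535 * x + 525 * x ^ 2) (c := 30 + 90 * x) (d := 40)
        (by positivity) (by positivity) (by positivity) (by push_cast; ring)
    have R5 : RouthPair (15 * x * z ^ 6 + (180 + 225 * x) * z ^ 4 + (660 + 225 * x) * z ^ 2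
          + (416 + 15 * x))
        ((30 + 90 * x) * z ^ 5 + (460 + 300 * x) * z ^ 3 + (606 + 90 * x) * z) :=
      R4.step hz (a := 30 + 90 * x) (c := 15 * x) (d := 30)
        (by positivity) (by positivity) (by positivity) (by push_cast; ring)
    apply R5.add_ne_zero
    have h1 := h0
    norm_num [Finset.sum_Icc_succ_top] at h1
    field_simp at h1
    rw [hyz] at h1
    linear_combination (1 / 24) * h1

/-- The `A(0)`-stability of BDF`k` for `k ≤ 6`. -/
theorem bdfPoly_mem_slitPlane {k : ℕ} (hk1 : 1 ≤ k) (hk6 : k ≤ 6) {ξ : ℂ} (hξ : ‖ξ‖ ≤ 1)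
    (hξ1 : ξ ≠ 1) : bdfPoly k ξ ∈ Complex.slitPlane := by
  by_contra h
  rw [Complex.mem_slitPlane_iff_not_le_zero, not_not] at h
  obtain ⟨h1, h2⟩ := Complex.le_def.mp h
  simp only [Complex.zero_re, Complex.zero_im] at h1 h2
  apply bdfPoly_add_ne_zero hk1 hk6 hξ hξ1 (x := -(bdfPoly k ξ).re) (by linarith)
  apply Complex.ext <;> simp [h2]

end Subdiffusion

/-! ### The symbol of BDF near the origin, and a sectorial lower bound -/

namespace Subdiffusion

/-- The symbol `s ↦ δ(e^{-s})` of BDF`k`, an approximation of `s` for small `s`. -/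
noncomputable def bdfSymbol (k : ℕ) (s : ℂ) : ℂ := bdfPoly k (Complex.exp (-s))

theorem differentiable_bdfPoly (k : ℕ) : Differentiable ℂ (bdfPoly k) := by
  unfold bdfPoly
  fun_prop

theorem differentiable_bdfSymbol (k : ℕ) : Differentiable ℂ (bdfSymbol k) := by
  unfold bdfSymbol
  exact (differentiable_bdfPoly k).comp (by fun_prop)

/-- With w = 1 - e^(-s) the derivative is (1 - w)(1 + w + ⋯ + w^(k-1)), which telescopes. -/
theorem hasDerivAt_bdfSymbol (k : ℕ) (s : ℂ) :
    HasDerivAt (bdfSymbol k) (1 - (1 - Complex.exp (-s)) ^ k) s := by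
  have hw : HasDerivAt (fun s : ℂ => 1 - Complex.exp (-s)) (Complex.exp (-s)) s := by
    have h := ((hasDerivAt_neg s).cexp).const_sub 1
    simpa using h
  induction k with
  | zero =>
    have h0 : bdfSymbol 0 = fun _ => 0 := by funext s; simp [bdfSymbol, bdfPoly]
    rw [h0]
    simpa using hasDerivAt_const s (0 : ℂ)
  | succ k ih =>
    have h0 : bdfSymbol (k + 1) =
        fun s => bdfSymbol k s + (1 - Complex.exp (-s)) ^ (k + 1) / ((k + 1 : ℕ) : ℂ) := by
      funext s
      simp only [bdfSymbol, bdfPoly]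
      rw [Finset.sum_Icc_succ_top (by omega)]
    rw [h0]
    convert! ih.add ((hw.pow (k + 1)).div_const ((k + 1 : ℕ) : ℂ)) using 1
    have : ((k + 1 : ℕ) : ℂ) ≠ 0 := by exact_mod_cast Nat.succ_ne_zero k
    simp only [Nat.add_sub_cancel]
    field_simp
    ring

theorem bdfSymbol_ofReal_im (k : ℕ) (x : ℝ) : (bdfSymbol k x).im = 0 := by
  have h : bdfSymbol k x = ((∑ j ∈ Finset.Icc 1 k, (1 - Real.exp (-x)) ^ j / (j : ℝ) : ℝ) : ℂ) := by
    simp [bdfSymbol, bdfPoly]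
  rw [h, Complex.ofReal_im]

theorem norm_one_sub_exp_neg_le {s : ℂ} (hs : ‖s‖ ≤ 1 / 16) :
    ‖1 - Complex.exp (-s)‖ ≤ 2 * ‖s‖ := by
  have h := Complex.norm_exp_sub_one_le (x := -s) (by rw [norm_neg]; linarith)
  rwa [norm_neg, norm_sub_rev] at h

/-- Since s = -log(1 - w) with w = 1 - e^(-s), the symbol is the k-th Taylor polynomial of the
logarithm at w, and |w| ≤ 2|s| bounds the remainder. -/
theorem norm_bdfSymbol_sub_le (k : ℕ) {s : ℂ} (hs : ‖s‖ ≤ 1 / 16) :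
    ‖bdfSymbol k s - s‖ ≤ 4 * 2 ^ k * ‖s‖ ^ (k + 1) := by
  set w : ℂ := 1 - Complex.exp (-s) with hw
  have hw1 : ‖w‖ ≤ 2 * ‖s‖ := norm_one_sub_exp_neg_le hs
  have him : |s.im| ≤ 1 / 16 := (Complex.abs_im_le_norm s).trans hs
  have hpi := Real.pi_gt_three
  have hlog : Complex.log (1 + -w) = -s := by
    rw [hw]
    have : (1 : ℂ) + -(1 - Complex.exp (-s)) = Complex.exp (-s) := by ring
    rw [this, Complex.log_exp]
    · rw [Complex.neg_im]; linarith [(abs_le.mp him).2]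
    · rw [Complex.neg_im]; linarith [(abs_le.mp him).1]
  -- The term of index 0 in `Complex.logTaylor` is a division by zero, hence 0, so the two sums
  -- differ by an index shift only.
  have hT : Complex.logTaylor (k + 1) (-w) = -bdfSymbol k s := by
    unfold Complex.logTaylor bdfSymbol bdfPoly
    have hI : Finset.Icc 1 k = Finset.Ico (0 + 1) (k + 1) := by
      ext j; simp only [Finset.mem_Icc, Finset.mem_Ico]; omega
    rw [Finset.sum_range_succ', ← Finset.sum_neg_distrib, hI,
      ← Finset.sum_Ico_add' (fun j : ℕ => -((1 - Complex.exp (-s)) ^ j / (j : ℂ))) 0 k 1,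
      ← Finset.range_eq_Ico]
    simp only [Nat.cast_zero, div_zero, add_zero]
    apply Finset.sum_congr rfl
    intro j _
    rw [neg_pow w (j + 1), ← hw]
    have : ((-1 : ℂ)) ^ (j + 1 + 1) * ((-1) ^ (j + 1) * w ^ (j + 1)) = - w ^ (j + 1) := by
      have h1 : ((-1 : ℂ)) ^ (j + 1) * (-1) ^ (j + 1) = 1 := by
        rw [← mul_pow]; norm_num
      rw [pow_succ (-1 : ℂ) (j + 1)]
      linear_combination (-w ^ (j + 1)) * h1
    rw [this, neg_div]
  have h := Complex.norm_log_sub_logTaylor_le k (z := -w) (by rw [norm_neg]; linarith)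
  rw [hlog, hT, norm_neg] at h
  have h1 : -s - -bdfSymbol k s = bdfSymbol k s - s := by ring
  rw [h1] at h
  refine h.trans ?_
  have h2 : (1 - ‖w‖)⁻¹ ≤ 2 := by
    rw [inv_le_comm₀ (by linarith) two_pos]; linarith
  calc ‖w‖ ^ (k + 1) * (1 - ‖w‖)⁻¹ / (k + 1)
      ≤ ‖w‖ ^ (k + 1) * (1 - ‖w‖)⁻¹ := by
        apply div_le_self
        · have : 0 ≤ (1 - ‖w‖)⁻¹ := inv_nonneg.mpr (by linarith)
          positivity
        · linarith [(Nat.cast_nonneg k : (0 : ℝ) ≤ k)]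
    _ ≤ (2 * ‖s‖) ^ (k + 1) * 2 := by
        have : 0 ≤ (1 - ‖w‖)⁻¹ := inv_nonneg.mpr (by linarith)
        gcongr
    _ = 4 * 2 ^ k * ‖s‖ ^ (k + 1) := by rw [mul_pow]; ring

/-- The radius 1/16 is the one for which the worst case k = 1, with the bound 8|s|², is at most
|s|/2. -/
theorem norm_bdfSymbol_sub_le_half {k : ℕ} (hk : 1 ≤ k) {s : ℂ} (hs : ‖s‖ ≤ 1 / 16) :
    ‖bdfSymbol k s - s‖ ≤ ‖s‖ / 2 := by
  refine (norm_bdfSymbol_sub_le k hs).trans ?_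
  have h1 : (2 * ‖s‖) ^ k ≤ (2 * ‖s‖) ^ 1 :=
    pow_le_pow_of_le_one (by positivity) (by linarith) hk
  calc 4 * 2 ^ k * ‖s‖ ^ (k + 1) = 4 * ((2 * ‖s‖) ^ k * ‖s‖) := by rw [mul_pow]; ring
    _ ≤ 4 * ((2 * ‖s‖) ^ 1 * ‖s‖) := by gcongr
    _ ≤ ‖s‖ / 2 := by nlinarith [norm_nonneg s]

/-- The difference of symbol and identity is real on the real axis and has derivative at most 1/2 in
norm; the mean value inequality is applied between Re s and s. A bound by |s|/2 would not suffice
close to the negative axis, where the symbol must stay on the same side of the cut as s. -/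
theorem abs_im_bdfSymbol_sub_le {k : ℕ} (hk : 1 ≤ k) {s : ℂ} (hs : ‖s‖ ≤ 1 / 16) :
    |(bdfSymbol k s).im - s.im| ≤ |s.im| / 2 := by
  have hconv : Convex ℝ (Metric.closedBall (0 : ℂ) (1 / 16)) := convex_closedBall _ _
  have hder : ∀ z ∈ Metric.closedBall (0 : ℂ) (1 / 16),
      HasDerivWithinAt (fun z => bdfSymbol k z - z) (-(1 - Complex.exp (-z)) ^ k)
        (Metric.closedBall (0 : ℂ) (1 / 16)) z := by
    intro z _
    have h := ((hasDerivAt_bdfSymbol k z).sub (hasDerivAt_id z)).hasDerivWithinAt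
      (s := Metric.closedBall (0 : ℂ) (1 / 16))
    convert! h using 1
    ring
  have hbound : ∀ z ∈ Metric.closedBall (0 : ℂ) (1 / 16),
      ‖-(1 - Complex.exp (-z)) ^ k‖ ≤ 1 / 2 := by
    intro z hz
    rw [mem_closedBall_zero_iff] at hz
    rw [norm_neg, norm_pow]
    have h1 := norm_one_sub_exp_neg_le hz
    calc ‖1 - Complex.exp (-z)‖ ^ k ≤ ‖1 - Complex.exp (-z)‖ ^ 1 :=
          pow_le_pow_of_le_one (norm_nonneg _) (by linarith) hk
      _ ≤ 1 / 2 := by rw [pow_one]; linarith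
  have hre : ((s.re : ℝ) : ℂ) ∈ Metric.closedBall (0 : ℂ) (1 / 16) := by
    rw [mem_closedBall_zero_iff, Complex.norm_real]
    exact (Complex.abs_re_le_norm s).trans hs
  have h := hconv.norm_image_sub_le_of_norm_hasDerivWithin_le hder hbound hre
    (mem_closedBall_zero_iff.mpr hs)
  have h1 : (s - (s.re : ℂ)) = s.im * Complex.I := by
    apply Complex.ext <;> simp
  rw [h1, norm_mul, Complex.norm_I, mul_one, Complex.norm_real, Real.norm_eq_abs] at h
  have h2 := (Complex.abs_im_le_norm _).trans h
  simp only [Complex.sub_im, bdfSymbol_ofReal_im, Complex.ofReal_im, sub_zero] at h2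
  linarith

theorem bdfSymbol_mem_slitPlane_of_re_nonneg {k : ℕ} (hk1 : 1 ≤ k) (hk6 : k ≤ 6) {s : ℂ}
    (hs : 0 ≤ s.re) (hs0 : s ≠ 0) (him : |s.im| ≤ Real.pi) :
    bdfSymbol k s ∈ Complex.slitPlane := by
  apply bdfPoly_mem_slitPlane hk1 hk6
  · rw [Complex.norm_exp, Complex.neg_re, Real.exp_le_one_iff]; linarith
  · intro h
    rw [Complex.exp_eq_one_iff] at h
    obtain ⟨n, hn⟩ := h
    have h1 := congrArg Complex.im hn
    have h2 := congrArg Complex.re hn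
    simp at h1 h2
    have hn0 : n = 0 := by
      by_contra hne
      have : (1 : ℝ) ≤ |(n : ℝ)| := by exact_mod_cast Int.one_le_abs hne
      have h3 : |s.im| = |(n : ℝ)| * (2 * Real.pi) := by
        rw [← abs_neg, h1, abs_mul, abs_of_pos Real.two_pi_pos]
      nlinarith [Real.pi_pos]
    apply hs0
    apply Complex.ext
    · simpa using h2
    · simpa [hn0] using h1

/-- The argument θ of z^α satisfies |θ| ≤ απ < π, so z^α stays away from the negative axis. With r =
|z|^α the identity |z^α + x|² = (1 + cos θ)/2 · (r + x)² + (1 - cos θ)/2 · (r - x)² gives a constant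
independent of x. No restriction on z is necessary. -/
theorem norm_cpow_add_ge {α : ℝ} (hα0 : 0 < α) (hα1 : α < 1) :
    ∃ c : ℝ, 0 < c ∧ ∀ z : ℂ, ∀ x : ℝ, 0 ≤ x →
      c * (‖z‖ ^ α + x) ≤ ‖z ^ (α : ℂ) + x‖ := by
  have hcos : -1 < Real.cos (α * Real.pi) := by
    rw [← Real.cos_pi]
    apply Real.cos_lt_cos_of_nonneg_of_le_pi
    · have := Real.pi_pos; positivity
    · exact le_rfl
    · nlinarith [Real.pi_pos]
  refine ⟨√((1 + Real.cos (α * Real.pi)) / 2), Real.sqrt_pos.mpr (by linarith), ?_⟩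
  intro z x hx
  rcases eq_or_ne z 0 with rfl | hz
  · rw [Complex.zero_cpow (by exact_mod_cast hα0.ne'), norm_zero, Real.zero_rpow hα0.ne',
      zero_add, zero_add, Complex.norm_real, Real.norm_of_nonneg hx]
    apply mul_le_of_le_one_left hx
    refine Real.sqrt_le_iff.mpr ⟨zero_le_one, ?_⟩
    linarith [Real.cos_le_one (α * Real.pi)]
  set r := ‖z‖ ^ α with hr
  have hr0 : 0 ≤ r := by positivity
  set θ := α * Complex.arg z with hθ
  have hzα : z ^ (α : ℂ) = r * Real.cos θ + r * Real.sin θ * Complex.I := by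
    rw [Complex.cpow_ofReal]
    push_cast
    rw [hr, hθ]
    push_cast
    rw [mul_comm (α : ℂ) (Complex.arg z : ℂ)]
    ring
  have hcosθ : Real.cos (α * Real.pi) ≤ Real.cos θ := by
    rw [← Real.cos_abs θ]
    apply Real.cos_le_cos_of_nonneg_of_le_pi (abs_nonneg _)
    · nlinarith [Real.pi_pos]
    · rw [hθ, abs_mul, abs_of_pos hα0]
      exact mul_le_mul_of_nonneg_left (Complex.abs_arg_le_pi z) hα0.le
  have hsq : ‖z ^ (α : ℂ) + x‖ ^ 2 = r ^ 2 + 2 * r * x * Real.cos θ + x ^ 2 := by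
    rw [← Complex.normSq_eq_norm_sq, hzα, Complex.normSq_apply]
    have hsc := Real.sin_sq_add_cos_sq θ
    generalize Real.cos θ = u at *
    generalize Real.sin θ = w at *
    simp only [Complex.add_re, Complex.mul_re, Complex.add_im, Complex.mul_im, Complex.ofReal_re,
      Complex.ofReal_im, Complex.I_re, Complex.I_im]
    linear_combination r ^ 2 * hsc
  apply le_of_sq_le_sq _ (norm_nonneg _)
  rw [hsq, mul_pow, Real.sq_sqrt (by linarith)]
  have h1 := Real.cos_le_one θ
  have h2 : (1 + Real.cos (α * Real.pi)) / 2 * (r + x) ^ 2 ≤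
      (1 + Real.cos θ) / 2 * (r + x) ^ 2 := by gcongr
  nlinarith [mul_nonneg (sub_nonneg.mpr h1) (sq_nonneg (r - x))]

end Subdiffusion

/-! ### Bounds for the symbol and its fractional power on the contour region -/

namespace Subdiffusion

/-- The principal power is differentiable along the whole segment from s to its symbol, and its
derivative is controlled by |s| there. This is what a mean value estimate for δ^α - s^α requires. -/
theorem bdfSymbol_segment {k : ℕ} (hk1 : 1 ≤ k) {s : ℂ} (hs : ‖s‖ ≤ 1 / 16)
    (hslit : s ∈ Complex.slitPlane) {z : ℂ} (hz : z ∈ segment ℝ s (bdfSymbol k s)) :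
    z ∈ Complex.slitPlane ∧ ‖s‖ / 2 ≤ ‖z‖ := by
  rw [segment_eq_image'] at hz
  obtain ⟨t, ⟨ht0, ht1⟩, rfl⟩ := hz
  have h1 := norm_bdfSymbol_sub_le_half hk1 hs
  have h2 := abs_im_bdfSymbol_sub_le hk1 hs
  have h3 : ‖t • (bdfSymbol k s - s)‖ ≤ ‖s‖ / 2 := by
    rw [norm_smul, Real.norm_of_nonneg ht0]
    exact (mul_le_of_le_one_left (norm_nonneg _) ht1).trans h1
  have h4 : |(t • (bdfSymbol k s - s)).im| ≤ |s.im| / 2 := by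
    rw [Complex.smul_im, smul_eq_mul, abs_mul, abs_of_nonneg ht0, Complex.sub_im]
    exact (mul_le_of_le_one_left (abs_nonneg _) ht1).trans h2
  beta_reduce
  generalize t • (bdfSymbol k s - s) = u at h3 h4 ⊢
  refine ⟨?_, ?_⟩
  · rw [Complex.mem_slitPlane_iff]
    by_cases him : s.im = 0
    · left
      have hre : 0 < s.re := by
        rcases Complex.mem_slitPlane_iff.mp hslit with h | h
        · exact h
        · exact absurd him h
      have hn : ‖s‖ = s.re := by
        have : s = (s.re : ℂ) := by apply Complex.ext <;> simp [him]
        rw [this, Complex.norm_real, Real.norm_of_nonneg (by simpa using hre.le)]; simp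
      have h5 := (abs_le.mp ((Complex.abs_re_le_norm u).trans h3)).1
      rw [Complex.add_re]
      rw [hn] at h5
      linarith
    · right
      intro h0
      rw [Complex.add_im] at h0
      have h5 : u.im = -s.im := by linarith
      rw [h5, abs_neg] at h4
      have := abs_pos.mpr him
      linarith
  · have h5 := norm_sub_le_norm_add s u
    linarith

/-- Mean value inequality on the segment: a derivative of size |s|^(α-1) times a displacement of
size |s|^(k+1). -/
theorem norm_bdfSymbol_cpow_sub_le {k : ℕ} (hk1 : 1 ≤ k) {α : ℝ} (hα0 : 0 < α) (hα1 : α < 1)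
    {s : ℂ} (hs : ‖s‖ ≤ 1 / 16) (hslit : s ∈ Complex.slitPlane) :
    ‖bdfSymbol k s ^ (α : ℂ) - s ^ (α : ℂ)‖ ≤
      α * (1 / 2 : ℝ) ^ (α - 1) * (4 * 2 ^ k) * ‖s‖ ^ (α + k) := by
  have hs0 : 0 < ‖s‖ := norm_pos_iff.mpr (Complex.slitPlane_ne_zero hslit)
  have hder : ∀ z ∈ segment ℝ s (bdfSymbol k s),
      HasDerivWithinAt (fun z : ℂ => z ^ (α : ℂ)) ((α : ℂ) * z ^ ((α : ℂ) - 1))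
        (segment ℝ s (bdfSymbol k s)) z := by
    intro z hz
    have h := (hasDerivAt_id z).cpow_const (c := (α : ℂ)) (bdfSymbol_segment hk1 hs hslit hz).1
    simpa using h.hasDerivWithinAt
  have hbound : ∀ z ∈ segment ℝ s (bdfSymbol k s),
      ‖(α : ℂ) * z ^ ((α : ℂ) - 1)‖ ≤ α * (‖s‖ / 2) ^ (α - 1) := by
    intro z hz
    have h1 : ((α : ℂ) - 1) = ((α - 1 : ℝ) : ℂ) := by push_cast; ring
    rw [norm_mul, h1, Complex.norm_cpow_real, Complex.norm_real, Real.norm_of_nonneg hα0.le]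
    exact mul_le_mul_of_nonneg_left (Real.rpow_le_rpow_of_nonpos (by positivity)
      (bdfSymbol_segment hk1 hs hslit hz).2 (by linarith)) hα0.le
  have h := (convex_segment s (bdfSymbol k s)).norm_image_sub_le_of_norm_hasDerivWithin_le hder
    hbound (left_mem_segment ℝ _ _) (right_mem_segment ℝ _ _)
  refine h.trans ?_
  calc α * (‖s‖ / 2) ^ (α - 1) * ‖bdfSymbol k s - s‖
      ≤ α * (‖s‖ / 2) ^ (α - 1) * (4 * 2 ^ k * ‖s‖ ^ (k + 1)) := by
        gcongr
        exact norm_bdfSymbol_sub_le k hs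
    _ = α * (1 / 2 : ℝ) ^ (α - 1) * (4 * 2 ^ k) * ‖s‖ ^ (α + k) := by
        have h1 : (‖s‖ / 2) ^ (α - 1) = (1 / 2 : ℝ) ^ (α - 1) * ‖s‖ ^ (α - 1) := by
          rw [← Real.mul_rpow (by norm_num) hs0.le]; congr 1; ring
        have h2 : ‖s‖ ^ (α + k) = ‖s‖ ^ (α - 1) * ‖s‖ ^ (k + 1) := by
          rw [← Real.rpow_natCast, ← Real.rpow_add hs0]; congr 1; push_cast; ring
        rw [h1, h2]; ring

/-- Away from the origin only compactness is used. On the imaginary axis the symbol lies in the open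
slit plane by A(0)-stability, hence also on a thickening to the left of that axis. -/
theorem bdfSymbol_far {k : ℕ} (hk1 : 1 ≤ k) (hk6 : k ≤ 6) :
    ∃ ε c M : ℝ, 0 < ε ∧ ε < 1 ∧ 0 < c ∧ 0 < M ∧ ∀ s : ℂ, -ε ≤ s.re → s.re ≤ 1 →
      |s.im| ≤ Real.pi → 1 / 16 ≤ ‖s‖ →
        bdfSymbol k s ∈ Complex.slitPlane ∧ c ≤ ‖bdfSymbol k s‖ ∧ ‖bdfSymbol k s‖ ≤ M := by
  have hcont : Continuous (bdfSymbol k) := (differentiable_bdfSymbol k).continuous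
  set O : Set ℂ := bdfSymbol k ⁻¹' Complex.slitPlane with hO
  have hOo : IsOpen O := Complex.isOpen_slitPlane.preimage hcont
  -- The bound 1/32 matches `ε ≤ 1/32`: if |s| ≥ 1/16 and |Re s| ≤ 1/32, then |Im s| ≥ 1/32, so the
  -- projection of s to the imaginary axis lies in `K₀`.
  set K₀ : Set ℂ := {s | s.re = 0 ∧ 1 / 32 ≤ |s.im| ∧ |s.im| ≤ Real.pi} with hK₀
  have hK₀c : IsCompact K₀ := by
    apply Metric.isCompact_of_isClosed_isBounded
    · apply (isClosed_eq Complex.continuous_re continuous_const).inter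
      exact (isClosed_le continuous_const (Complex.continuous_im.abs)).inter
        (isClosed_le (Complex.continuous_im.abs) continuous_const)
    · apply (Metric.isBounded_closedBall (x := (0 : ℂ)) (r := Real.pi)).subset
      intro s hs
      rw [mem_closedBall_zero_iff]
      refine (Complex.norm_le_abs_re_add_abs_im s).trans ?_
      rw [hs.1, abs_zero, zero_add]
      exact hs.2.2
  have hK₀O : K₀ ⊆ O := by
    intro s hs
    apply bdfSymbol_mem_slitPlane_of_re_nonneg hk1 hk6 hs.1.ge _ hs.2.2
    rintro rfl
    have := hs.2.1
    norm_num at this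
  obtain ⟨η, hη, hηO⟩ := hK₀c.exists_cthickening_subset_open hOo hK₀O
  set ε : ℝ := min η (1 / 32) with hε
  have hε0 : 0 < ε := lt_min hη (by norm_num)
  have hε1 : ε ≤ 1 / 32 := min_le_right _ _
  set K : Set ℂ := {s | (-ε ≤ s.re ∧ s.re ≤ 1) ∧ |s.im| ≤ Real.pi ∧ 1 / 16 ≤ ‖s‖} with hK
  have hKc : IsCompact K := by
    apply Metric.isCompact_of_isClosed_isBounded
    · apply ((isClosed_le continuous_const Complex.continuous_re).inter
        (isClosed_le Complex.continuous_re continuous_const)).inter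
      exact (isClosed_le (Complex.continuous_im.abs) continuous_const).inter
        (isClosed_le continuous_const continuous_norm)
    · apply (Metric.isBounded_closedBall (x := (0 : ℂ)) (r := 1 + Real.pi)).subset
      intro s hs
      rw [mem_closedBall_zero_iff]
      refine (Complex.norm_le_abs_re_add_abs_im s).trans ?_
      have : |s.re| ≤ 1 := abs_le.mpr ⟨by linarith [hs.1.1], hs.1.2⟩
      linarith [hs.2.1]
  have hKO : ∀ s ∈ K, bdfSymbol k s ∈ Complex.slitPlane := by
    intro s hs
    rcases le_or_gt 0 s.re with h | h
    · apply bdfSymbol_mem_slitPlane_of_re_nonneg hk1 hk6 h _ hs.2.1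
      rintro rfl
      have := hs.2.2
      norm_num at this
    · apply hηO
      have h1 : |s.re| ≤ ε := by rw [abs_of_neg h]; linarith [hs.1.1]
      have h2 := Complex.norm_le_abs_re_add_abs_im s
      have h3 : (s.im : ℂ) * Complex.I ∈ K₀ := by
        refine ⟨by simp, ?_, ?_⟩
        · simp only [Complex.mul_im, Complex.ofReal_re, Complex.I_im, Complex.ofReal_im,
            Complex.I_re]
          rw [mul_one, mul_zero, add_zero]
          linarith [hs.2.2]
        · simpa using hs.2.1
      apply Metric.mem_cthickening_of_dist_le s _ η K₀ h3
      have h4 : s - s.im * Complex.I = s.re := by apply Complex.ext <;> simp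
      rw [dist_eq_norm, h4, Complex.norm_real, Real.norm_eq_abs]
      exact h1.trans (min_le_left _ _)
  obtain ⟨c, hc, hcK⟩ := hKc.exists_forall_le' (f := fun s => ‖bdfSymbol k s‖) (a := 0)
    hcont.norm.continuousOn
    (fun s hs => norm_pos_iff.mpr (Complex.slitPlane_ne_zero (hKO s hs)))
  obtain ⟨M, hM⟩ := hKc.exists_bound_of_continuousOn hcont.continuousOn
  refine ⟨ε, c, max M 1, hε0, by linarith, hc, by positivity, fun s h1 h2 h3 h4 => ?_⟩
  have hs : s ∈ K := ⟨⟨h1, h2⟩, h3, h4⟩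
  exact ⟨hKO s hs, hcK s hs, (hM s hs).trans (le_max_left _ _)⟩

/-- The part of the slit plane on which the contours run. -/
def contourRegion (ε : ℝ) : Set ℂ :=
  {s | -ε ≤ s.re ∧ s.re ≤ 1 ∧ |s.im| ≤ Real.pi ∧ s ∈ Complex.slitPlane}

theorem norm_le_five_of_mem_contourRegion {ε : ℝ} (hε : ε < 1) {s : ℂ}
    (hs : s ∈ contourRegion ε) : ‖s‖ ≤ 5 := by
  have h1 : |s.re| ≤ 1 := abs_le.mpr ⟨by linarith [hs.1], hs.2.1⟩
  linarith [Complex.norm_le_abs_re_add_abs_im s, hs.2.2.1, Real.pi_lt_four]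

/-- `δ(e^{-s})` is a sectorial approximation of order `k` of `s`. -/
theorem exists_bdfSymbol_bounds {k : ℕ} (hk1 : 1 ≤ k) (hk6 : k ≤ 6) {α : ℝ} (hα0 : 0 < α)
    (hα1 : α < 1) :
    ∃ ε c C : ℝ, 0 < ε ∧ ε < 1 ∧ 0 < c ∧ 0 < C ∧ ∀ s ∈ contourRegion ε,
      bdfSymbol k s ∈ Complex.slitPlane ∧ c * ‖s‖ ≤ ‖bdfSymbol k s‖ ∧
      ‖bdfSymbol k s‖ ≤ C * ‖s‖ ∧ ‖bdfSymbol k s - s‖ ≤ C * ‖s‖ ^ (k + 1) ∧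
      ‖bdfSymbol k s ^ (α : ℂ) - s ^ (α : ℂ)‖ ≤ C * ‖s‖ ^ (α + k) := by
  obtain ⟨ε, c, M, hε0, hε1, hc, hM, hfar⟩ := bdfSymbol_far hk1 hk6
  set C₁ : ℝ := α * (1 / 2 : ℝ) ^ (α - 1) * (4 * 2 ^ k) with hC₁
  set C₂ : ℝ := (M + 5) * 16 ^ (k + 1) with hC₂
  set C₃ : ℝ := (M ^ α + 5 ^ α) * 16 ^ (α + k) with hC₃
  have hC₁0 : 0 ≤ C₁ := by positivity
  have hC₂0 : 0 ≤ C₂ := by positivity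
  have hC₃0 : 0 ≤ C₃ := by positivity
  have hk0 : (0 : ℝ) ≤ 4 * 2 ^ k := by positivity
  refine ⟨ε, min (c / 5) (1 / 2), 2 + 16 * M + 4 * 2 ^ k + C₁ + C₂ + C₃, hε0, hε1, by positivity,
    by positivity, fun s hs => ?_⟩
  have hs0 : 0 < ‖s‖ := norm_pos_iff.mpr (Complex.slitPlane_ne_zero hs.2.2.2)
  have hs5 : ‖s‖ ≤ 5 := norm_le_five_of_mem_contourRegion hε1 hs
  -- For large s all quantities are merely bounded, and the factors (16|s|)^ρ ≥ 1 bring the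
  -- constants into the required homogeneous form.
  rcases le_total ‖s‖ (1 / 16) with h | h
  · have h1 := norm_bdfSymbol_sub_le_half hk1 h
    have h2 := norm_sub_norm_le s (bdfSymbol k s)
    have h3 := norm_sub_norm_le (bdfSymbol k s) s
    rw [norm_sub_rev] at h2
    refine ⟨(bdfSymbol_segment hk1 h hs.2.2.2 (right_mem_segment ℝ _ _)).1, ?_, ?_, ?_, ?_⟩
    · calc min (c / 5) (1 / 2) * ‖s‖ ≤ 1 / 2 * ‖s‖ := by gcongr; exact min_le_right _ _
        _ ≤ _ := by linarith
    · calc ‖bdfSymbol k s‖ ≤ 2 * ‖s‖ := by linarith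
        _ ≤ _ := by gcongr; linarith
    · refine (norm_bdfSymbol_sub_le k h).trans ?_
      gcongr
      linarith
    · refine (norm_bdfSymbol_cpow_sub_le hk1 hα0 hα1 h hs.2.2.2).trans ?_
      gcongr
      linarith
  · obtain ⟨h1, h2, h3⟩ := hfar s hs.1 hs.2.1 hs.2.2.1 h
    have h16 : 1 ≤ 16 * ‖s‖ := by linarith
    refine ⟨h1, ?_, ?_, ?_, ?_⟩
    · calc min (c / 5) (1 / 2) * ‖s‖ ≤ c / 5 * 5 := by gcongr; exact min_le_left _ _
        _ ≤ _ := by linarith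
    · calc ‖bdfSymbol k s‖ ≤ M * 1 := by linarith
        _ ≤ M * (16 * ‖s‖) := by gcongr
        _ = (16 * M) * ‖s‖ := by ring
        _ ≤ _ := by gcongr; linarith
    · calc ‖bdfSymbol k s - s‖ ≤ M + 5 := (norm_sub_le _ _).trans (add_le_add h3 hs5)
        _ ≤ (M + 5) * (16 * ‖s‖) ^ (k + 1) := le_mul_of_one_le_right (by positivity)
            (one_le_pow₀ h16)
        _ = C₂ * ‖s‖ ^ (k + 1) := by rw [mul_pow, hC₂]; ring
        _ ≤ _ := by gcongr; linarith
    · calc ‖bdfSymbol k s ^ (α : ℂ) - s ^ (α : ℂ)‖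
          ≤ ‖bdfSymbol k s‖ ^ α + ‖s‖ ^ α := by
            refine (norm_sub_le _ _).trans ?_
            rw [Complex.norm_cpow_real, Complex.norm_cpow_real]
        _ ≤ M ^ α + 5 ^ α := by gcongr
        _ ≤ (M ^ α + 5 ^ α) * (16 * ‖s‖) ^ (α + k) := le_mul_of_one_le_right (by positivity)
            (Real.one_le_rpow h16 (by positivity))
        _ = C₃ * ‖s‖ ^ (α + k) := by
            rw [Real.mul_rpow (by norm_num) hs0.le, hC₃]; ring
        _ ≤ _ := by gcongr; linarith

end Subdiffusion

/-! ### Laplace and Fourier transforms of powers -/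

namespace Subdiffusion

theorem integrableOn_rpow_mul_exp_neg {γ r : ℝ} (hγ : -1 < γ) (hr : 0 < r) :
    IntegrableOn (fun x : ℝ => x ^ γ * Real.exp (-(r * x))) (Set.Ioi 0) := by
  have h := integrableOn_rpow_mul_exp_neg_mul_rpow (s := γ) (p := 1) hγ zero_lt_one hr
  refine h.congr_fun (fun x _ => ?_) measurableSet_Ioi
  simp only [Real.rpow_one, neg_mul]

theorem norm_ofReal_mul_cexp_neg (a x : ℝ) (z : ℂ) :
    ‖(a : ℂ) * Complex.exp (-(z * x))‖ = |a| * Real.exp (-(z.re * x)) := by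
  rw [norm_mul, Complex.norm_real, Complex.norm_exp, Real.norm_eq_abs]
  simp

theorem aestronglyMeasurable_rpow_mul_cexp (γ : ℝ) (z : ℂ) :
    AEStronglyMeasurable (fun x : ℝ => ((x ^ γ : ℝ) : ℂ) * Complex.exp (-(z * x)))
      (volume.restrict (Set.Ioi 0)) := by
  apply Measurable.aestronglyMeasurable
  fun_prop

theorem integrableOn_rpow_mul_cexp {γ : ℝ} (hγ : -1 < γ) {z : ℂ} (hz : 0 < z.re) :
    IntegrableOn (fun x : ℝ => ((x ^ γ : ℝ) : ℂ) * Complex.exp (-(z * x))) (Set.Ioi 0) := by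
  refine (integrableOn_rpow_mul_exp_neg hγ hz).mono' (aestronglyMeasurable_rpow_mul_cexp γ z) ?_
  refine (ae_restrict_mem measurableSet_Ioi).mono fun x hx => ?_
  rw [norm_ofReal_mul_cexp_neg, abs_of_nonneg (Real.rpow_nonneg (le_of_lt hx) _)]

theorem differentiableOn_laplace_rpow {γ : ℝ} (hγ : -1 < γ) :
    DifferentiableOn ℂ
      (fun z : ℂ => ∫ x in Set.Ioi (0 : ℝ), ((x ^ γ : ℝ) : ℂ) * Complex.exp (-(z * x)))
      {z | 0 < z.re} := by
  intro z₀ hz₀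
  have hz₀' : 0 < z₀.re := hz₀
  apply DifferentiableAt.differentiableWithinAt
  have hball : ∀ z ∈ Metric.ball z₀ (z₀.re / 2), z₀.re / 2 ≤ z.re := by
    intro z hz
    rw [mem_ball_iff_norm] at hz
    have := (abs_le.mp ((Complex.abs_re_le_norm (z - z₀)).trans hz.le)).1
    rw [Complex.sub_re] at this
    linarith
  refine (hasDerivAt_integral_of_dominated_loc_of_deriv_le (μ := volume.restrict (Set.Ioi 0))
    (F := fun z x => ((x ^ γ : ℝ) : ℂ) * Complex.exp (-(z * x)))
    (F' := fun z x => ((x ^ γ : ℝ) : ℂ) * (Complex.exp (-(z * x)) * (-(x : ℂ))))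
    (bound := fun x => x ^ (γ + 1) * Real.exp (-(z₀.re / 2 * x)))
    (Metric.ball_mem_nhds z₀ (by linarith : 0 < z₀.re / 2)) ?_ ?_ ?_ ?_ ?_ ?_).2.differentiableAt
  · exact Eventually.of_forall fun z => aestronglyMeasurable_rpow_mul_cexp γ z
  · exact integrableOn_rpow_mul_cexp hγ hz₀
  · apply Measurable.aestronglyMeasurable
    fun_prop
  · refine (ae_restrict_mem measurableSet_Ioi).mono fun x (hx : 0 < x) z hz => ?_
    rw [← mul_assoc, norm_mul, norm_ofReal_mul_cexp_neg, abs_of_nonneg (Real.rpow_nonneg hx.le _),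
      norm_neg, Complex.norm_real, Real.norm_of_nonneg hx.le, Real.rpow_add_one hx.ne']
    have h1 := hball z hz
    calc x ^ γ * Real.exp (-(z.re * x)) * x = x ^ γ * x * Real.exp (-(z.re * x)) := by ring
      _ ≤ x ^ γ * x * Real.exp (-(z₀.re / 2 * x)) := by gcongr
  · exact integrableOn_rpow_mul_exp_neg (by linarith) (by linarith)
  · refine Eventually.of_forall fun x z _ => ?_
    have h1 : HasDerivAt (fun z : ℂ => -(z * x)) (-(x : ℂ)) z := by
      simpa using ((hasDerivAt_id z).mul_const (x : ℂ)).fun_neg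
    exact h1.cexp.const_mul _

theorem isPreconnected_re_pos : IsPreconnected {z : ℂ | 0 < z.re} :=
  (convex_halfSpace_re_gt 0).isPreconnected

/-- Both sides are analytic in the right half plane and agree for positive reals by the Gamma
integral, so the identity theorem applies. -/
theorem laplace_rpow {γ : ℝ} (hγ : -1 < γ) {z : ℂ} (hz : 0 < z.re) :
    ∫ x in Set.Ioi (0 : ℝ), ((x ^ γ : ℝ) : ℂ) * Complex.exp (-(z * x)) =
      Real.Gamma (γ + 1) * z ^ ((-(γ + 1) : ℝ) : ℂ) := by
  have hopen : IsOpen {z : ℂ | 0 < z.re} := isOpen_lt continuous_const Complex.continuous_re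
  have hf := (differentiableOn_laplace_rpow hγ).analyticOnNhd hopen
  have hg : AnalyticOnNhd ℂ (fun z : ℂ => (Real.Gamma (γ + 1) : ℂ) * z ^ ((-(γ + 1) : ℝ) : ℂ))
      {z : ℂ | 0 < z.re} := by
    apply DifferentiableOn.analyticOnNhd _ hopen
    intro w hw
    apply DifferentiableAt.differentiableWithinAt
    exact (differentiableAt_id.cpow_const (Or.inl hw)).const_mul _
  refine hf.eqOn_of_preconnected_of_frequently_eq hg isPreconnected_re_pos
    (z₀ := 1) (by simp) ?_ hz
  have hreal : ∀ r : ℝ, 0 < r →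
      (∫ x in Set.Ioi (0 : ℝ), ((x ^ γ : ℝ) : ℂ) * Complex.exp (-((r : ℂ) * x))) =
        (Real.Gamma (γ + 1) : ℂ) * (r : ℂ) ^ ((-(γ + 1) : ℝ) : ℂ) := by
    intro r hr
    have h1 := Real.integral_rpow_mul_exp_neg_mul_Ioi (a := γ + 1) (by linarith) hr
    have h2 : (∫ x in Set.Ioi (0 : ℝ), ((x ^ γ : ℝ) : ℂ) * Complex.exp (-((r : ℂ) * x))) =
        ((∫ x in Set.Ioi (0 : ℝ), x ^ (γ + 1 - 1) * Real.exp (-(r * x)) : ℝ) : ℂ) := by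
      rw [← integral_complex_ofReal]
      congr 1
      funext x
      push_cast
      rw [add_sub_cancel_right]
    rw [h2, h1, ← Complex.ofReal_cpow hr.le, ← Complex.ofReal_mul, one_div,
      Real.inv_rpow hr.le, ← Real.rpow_neg hr.le, mul_comm]
  -- A sequence of real points accumulating at 1, as needed for the identity theorem.
  have htend : Tendsto (fun n : ℕ => ((1 + 1 / ((n : ℝ) + 1) : ℝ) : ℂ)) atTop (𝓝[≠] 1) := by
    rw [tendsto_nhdsWithin_iff]
    constructor
    · have h := (tendsto_one_div_add_atTop_nhds_zero_nat (𝕜 := ℝ)).const_add 1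
      rw [add_zero] at h
      exact_mod_cast (Complex.continuous_ofReal.tendsto 1).comp h
    · refine Eventually.of_forall fun n => ?_
      have : (0 : ℝ) < 1 / ((n : ℝ) + 1) := by positivity
      rw [Set.mem_compl_singleton_iff]
      exact_mod_cast (by linarith : (1 : ℝ) < 1 + 1 / ((n : ℝ) + 1)).ne'
  apply htend.frequently
  apply Frequently.of_forall
  intro n
  exact hreal _ (by positivity)

/-- The function `x ↦ x^γ e^{-zx}` for `x > 0`, extended by zero. -/
noncomputable def powerExp (γ : ℝ) (z : ℂ) (x : ℝ) : ℂ :=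
  (((max x 0) ^ γ : ℝ) : ℂ) * Complex.exp (-(z * x))

theorem powerExp_of_nonpos {γ : ℝ} (hγ : 0 < γ) (z : ℂ) {x : ℝ} (hx : x ≤ 0) :
    powerExp γ z x = 0 := by
  rw [powerExp, max_eq_right hx, Real.zero_rpow hγ.ne', Complex.ofReal_zero, zero_mul]

theorem powerExp_of_nonneg (γ : ℝ) (z : ℂ) {x : ℝ} (hx : 0 ≤ x) :
    powerExp γ z x = ((x ^ γ : ℝ) : ℂ) * Complex.exp (-(z * x)) := by
  rw [powerExp, max_eq_left hx]

theorem continuous_powerExp {γ : ℝ} (hγ : 0 < γ) (z : ℂ) : Continuous (powerExp γ z) := by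
  unfold powerExp
  apply Continuous.mul
  · exact Complex.continuous_ofReal.comp
      ((continuous_id.max continuous_const).rpow_const fun x => Or.inr hγ.le)
  · fun_prop

theorem integral_powerExp_eq {γ : ℝ} (hγ : 0 < γ) (z : ℂ) (h : ℝ → ℂ) :
    ∫ x, h x * powerExp γ z x =
      ∫ x in Set.Ioi (0 : ℝ), h x * (((x ^ γ : ℝ) : ℂ) * Complex.exp (-(z * x))) := by
  rw [← setIntegral_eq_integral_of_forall_compl_eq_zero (s := Set.Ioi (0 : ℝ))]
  · apply setIntegral_congr_fun measurableSet_Ioi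
    intro x hx
    simp only [powerExp_of_nonneg γ z (le_of_lt hx)]
  · intro x hx
    rw [powerExp_of_nonpos hγ z (not_lt.mp hx), mul_zero]

/-- The Fourier kernel shifts z by 2πiw in the Laplace transform. -/
theorem fourier_powerExp {γ : ℝ} (hγ : 0 < γ) {z : ℂ} (hz : 0 < z.re) (w : ℝ) :
    FourierTransform.fourier (powerExp γ z) w =
      Real.Gamma (γ + 1) * (z + 2 * Real.pi * w * Complex.I) ^ ((-(γ + 1) : ℝ) : ℂ) := by
  rw [Real.fourier_real_eq_integral_exp_smul]
  simp only [smul_eq_mul]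
  rw [integral_powerExp_eq hγ, ← laplace_rpow (by linarith : -1 < γ)
    (z := z + 2 * Real.pi * w * Complex.I) (by simpa using hz)]
  congr 1
  funext x
  rw [mul_left_comm, ← Complex.exp_add]
  congr 2
  push_cast
  ring

theorem integrable_powerExp {γ : ℝ} (hγ : 0 < γ) {z : ℂ} (hz : 0 < z.re) :
    Integrable (powerExp γ z) := by
  have h : IntegrableOn (powerExp γ z) (Set.Ioi 0) :=
    (integrableOn_rpow_mul_cexp (by linarith : -1 < γ) hz).congr_fun
      (fun x hx => (powerExp_of_nonneg γ z (le_of_lt hx)).symm) measurableSet_Ioi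
  rw [← integrableOn_univ, ← Set.Iic_union_Ioi (a := (0 : ℝ))]
  apply IntegrableOn.union _ h
  apply (integrableOn_zero (μ := volume) (s := Set.Iic (0 : ℝ))).congr_fun _ measurableSet_Iic
  intro x hx
  exact (powerExp_of_nonpos hγ z hx).symm

theorem exists_norm_add_mul_I_ge {σ : ℝ} (hσ : 0 < σ) :
    ∃ c : ℝ, 0 < c ∧ ∀ y : ℝ, c * (1 + |y|) ≤ ‖(σ : ℂ) + y * Complex.I‖ := by
  refine ⟨min σ 1 / 2, by positivity, fun y => ?_⟩
  have h1 := Complex.abs_re_le_norm ((σ : ℂ) + y * Complex.I)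
  have h2 := Complex.abs_im_le_norm ((σ : ℂ) + y * Complex.I)
  simp only [Complex.add_re, Complex.ofReal_re, Complex.mul_re, Complex.I_re, mul_zero,
    Complex.ofReal_im, Complex.I_im, mul_one, sub_self, add_zero, Complex.add_im, Complex.mul_im,
    zero_add] at h1 h2
  rw [abs_of_pos hσ] at h1
  have h3 : min σ 1 ≤ σ := min_le_left _ _
  have h4 : min σ 1 * |y| ≤ 1 * |y| := by gcongr; exact min_le_right _ _
  nlinarith

theorem integrable_cpow_vertical {β : ℝ} (hβ : 1 < β) {σ : ℝ} (hσ : 0 < σ) :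
    Integrable (fun y : ℝ => ((σ : ℂ) + y * Complex.I) ^ ((-β : ℝ) : ℂ)) := by
  obtain ⟨c, hc, hcy⟩ := exists_norm_add_mul_I_ge hσ
  have h1 : Integrable (fun y : ℝ => c ^ (-β) * (1 + ‖y‖) ^ (-β)) :=
    (integrable_one_add_norm (μ := (volume : Measure ℝ)) (by simpa using hβ)).const_mul _
  refine h1.mono' ?_ (Eventually.of_forall fun y => ?_)
  · apply Measurable.aestronglyMeasurable
    fun_prop
  · rw [Complex.norm_cpow_real, ← Real.mul_rpow hc.le (by positivity)]
    exact Real.rpow_le_rpow_of_nonpos (by positivity) (hcy y) (by linarith)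

/-- Fourier inversion for t^γ e^(-σt). The condition γ > 0 makes the function continuous at 0 and
its transform integrable; smaller exponents are reached later on Hankel contours. -/
theorem integral_cpow_mul_exp_vertical {γ : ℝ} (hγ : 0 < γ) {σ t : ℝ} (hσ : 0 < σ) (ht : 0 < t) :
    ∫ y : ℝ, ((σ : ℂ) + y * Complex.I) ^ ((-(γ + 1) : ℝ) : ℂ) *
      Complex.exp (((σ : ℂ) + y * Complex.I) * t) =
        2 * Real.pi * ((t ^ γ / Real.Gamma (γ + 1) : ℝ) : ℂ) := by
  have hΓ : (Real.Gamma (γ + 1) : ℂ) ≠ 0 := by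
    exact_mod_cast (Real.Gamma_pos_of_pos (by linarith)).ne'
  have hF : FourierTransform.fourier (powerExp γ σ) = fun w : ℝ => (Real.Gamma (γ + 1) : ℂ) *
      ((σ : ℂ) + ((2 * Real.pi * w : ℝ) : ℂ) * Complex.I) ^ ((-(γ + 1) : ℝ) : ℂ) := by
    funext w
    rw [fourier_powerExp hγ (by simpa using hσ)]
    push_cast
    rfl
  have hint : Integrable (FourierTransform.fourier (powerExp γ σ)) := by
    rw [hF]
    exact ((integrable_cpow_vertical (by linarith : 1 < γ + 1) hσ).comp_mul_left'
      Real.two_pi_pos.ne').const_mul _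
  have h := (integrable_powerExp hγ (by simpa using hσ)).fourierInv_fourier_eq hint
    (continuous_powerExp hγ σ).continuousAt (v := t)
  rw [Real.fourierInv_eq', hF, powerExp_of_nonneg γ _ ht.le] at h
  set G : ℝ → ℂ := fun y => ((σ : ℂ) + y * Complex.I) ^ ((-(γ + 1) : ℝ) : ℂ) *
      Complex.exp (((σ : ℂ) + y * Complex.I) * t) with hG
  have h2 : ∀ w : ℝ, G (2 * Real.pi * w) = Complex.exp (σ * t) / Real.Gamma (γ + 1) *
      (Complex.exp (((2 * Real.pi * inner ℝ w t : ℝ) : ℂ) * Complex.I) •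
        ((Real.Gamma (γ + 1) : ℂ) * ((σ : ℂ) + ((2 * Real.pi * w : ℝ) : ℂ) * Complex.I) ^
          ((-(γ + 1) : ℝ) : ℂ))) := by
    intro w
    simp only [hG, smul_eq_mul]
    rw [add_mul, Complex.exp_add]
    have h3 : ((2 * Real.pi * inner ℝ w t : ℝ) : ℂ) * Complex.I =
        ((2 * Real.pi * w : ℝ) : ℂ) * Complex.I * t := by
      simp
      ring
    rw [h3]
    field_simp
  have h4 := Measure.integral_comp_mul_left G (2 * Real.pi)
  simp only [h2] at h4
  rw [integral_const_mul, h] at h4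
  rw [abs_of_pos (inv_pos.mpr Real.two_pi_pos), Complex.real_smul] at h4
  have h5 : (∫ y, G y) = 2 * Real.pi * (Complex.exp (σ * t) / Real.Gamma (γ + 1) *
      (((t ^ γ : ℝ) : ℂ) * Complex.exp (-(σ * t)))) := by
    rw [h4]
    push_cast
    have : (Real.pi : ℂ) ≠ 0 := by exact_mod_cast Real.pi_ne_zero
    field_simp
  rw [h5, Complex.exp_neg]
  have := Complex.exp_ne_zero (σ * t)
  push_cast
  field_simp

end Subdiffusion

/-! ### The lattice sum and Lipschitz' formula -/

namespace Subdiffusion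

/-- The terms of the lattice sum of `s^{-γ-1}`. -/
noncomputable def latticeTerm (γ : ℝ) (s : ℂ) (k : ℤ) : ℂ :=
  (s + 2 * Real.pi * k * Complex.I) ^ ((-(γ + 1) : ℝ) : ℂ)

/-- The lattice sum `∑ₖ (s + 2πik)^{-γ-1}`, the continuation of `∑ₙ n^γ e^{-ns} / Γ(γ+1)`. -/
noncomputable def latticeSum (γ : ℝ) (s : ℂ) : ℂ := ∑' k : ℤ, latticeTerm γ s k

/-- The terms of the lattice sum that are regular at the origin. -/
noncomputable def latticeTailTerm (γ : ℝ) (s : ℂ) (k : ℤ) : ℂ :=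
  if k = 0 then 0 else latticeTerm γ s k

/-- The part of the lattice sum that is regular at the origin. -/
noncomputable def latticeTail (γ : ℝ) (s : ℂ) : ℂ := ∑' k : ℤ, latticeTailTerm γ s k

/-- A strip on which the regular part of the lattice sum is analytic. -/
def latticeStrip : Set ℂ := {s | |s.im| < 3 / 2 * Real.pi}

theorem isOpen_latticeStrip : IsOpen latticeStrip :=
  isOpen_lt (Complex.continuous_im.abs) continuous_const

/-- For k ≠ 0 one has 2π|k| - 3π/2 ≥ |k|. The half-width 3π/2 of the strip leaves room around the
lines |Im s| = π, which belong to the contours. -/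
theorem abs_le_norm_add_lattice {s : ℂ} (hs : s ∈ latticeStrip) {k : ℤ} (hk : k ≠ 0) :
    |(k : ℝ)| ≤ |(s + 2 * Real.pi * k * Complex.I).im| := by
  have h1 : (1 : ℝ) ≤ |(k : ℝ)| := by exact_mod_cast Int.one_le_abs hk
  have h2 : (s + 2 * Real.pi * k * Complex.I).im = s.im + 2 * Real.pi * k := by simp
  have h3 : |s.im| < 3 / 2 * Real.pi := hs
  have h4 := abs_sub_abs_le_abs_sub (2 * Real.pi * k) (-s.im)
  rw [abs_neg, sub_neg_eq_add, add_comm _ s.im, ← h2, abs_mul, abs_of_pos Real.two_pi_pos] at h4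
  nlinarith [Real.pi_gt_three]

theorem norm_latticeTailTerm_le {γ : ℝ} (hγ : 0 < γ) {s : ℂ} (hs : s ∈ latticeStrip) (k : ℤ) :
    ‖latticeTailTerm γ s k‖ ≤ |(k : ℝ)| ^ (-(γ + 1)) := by
  unfold latticeTailTerm
  split_ifs with hk
  · rw [norm_zero]; positivity
  · rw [latticeTerm, Complex.norm_cpow_real]
    apply Real.rpow_le_rpow_of_nonpos
    · exact abs_pos.mpr (by exact_mod_cast hk)
    · exact (abs_le_norm_add_lattice hs hk).trans (Complex.abs_im_le_norm _)
    · linarith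

theorem summable_abs_int_rpow_gamma {γ : ℝ} (hγ : 0 < γ) :
    Summable fun k : ℤ => |(k : ℝ)| ^ (-(γ + 1)) :=
  Real.summable_abs_int_rpow (by linarith)

theorem differentiableOn_latticeTail {γ : ℝ} (hγ : 0 < γ) :
    DifferentiableOn ℂ (latticeTail γ) latticeStrip := by
  apply Complex.differentiableOn_tsum_of_summable_norm (F := fun k s => latticeTailTerm γ s k)
    (summable_abs_int_rpow_gamma hγ) _ isOpen_latticeStrip
    (fun k s hs => norm_latticeTailTerm_le hγ hs k)
  intro k s hs
  apply DifferentiableAt.differentiableWithinAt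
  unfold latticeTailTerm
  by_cases hk : k = 0
  · simp only [hk, if_true]
    exact differentiableAt_const _
  · simp only [hk, if_false, latticeTerm]
    have hmem : s + 2 * Real.pi * k * Complex.I ∈ Complex.slitPlane := by
      right
      intro h0
      have h1 := abs_le_norm_add_lattice hs hk
      rw [h0, abs_zero] at h1
      have h2 : 0 < |(k : ℝ)| := abs_pos.mpr (by exact_mod_cast hk)
      linarith
    exact (differentiableAt_id.add_const _).cpow_const hmem

theorem norm_latticeTail_le {γ : ℝ} (hγ : 0 < γ) {s : ℂ} (hs : s ∈ latticeStrip) :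
    ‖latticeTail γ s‖ ≤ ∑' k : ℤ, |(k : ℝ)| ^ (-(γ + 1)) :=
  tsum_of_norm_bounded (summable_abs_int_rpow_gamma hγ).hasSum
    (fun k => norm_latticeTailTerm_le hγ hs k)

theorem summable_latticeTailTerm {γ : ℝ} (hγ : 0 < γ) {s : ℂ} (hs : s ∈ latticeStrip) :
    Summable (latticeTailTerm γ s) :=
  Summable.of_norm_bounded (summable_abs_int_rpow_gamma hγ)
    (fun k => norm_latticeTailTerm_le hγ hs k)

theorem latticeTerm_eq (γ : ℝ) (s : ℂ) :
    latticeTerm γ s = fun k => latticeTailTerm γ s k +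
      (if k = 0 then s ^ ((-(γ + 1) : ℝ) : ℂ) else 0) := by
  funext k
  unfold latticeTailTerm
  split_ifs with hk
  · simp [hk, latticeTerm]
  · rw [add_zero]

theorem hasSum_ite_zero (a : ℂ) : HasSum (fun k : ℤ => if k = 0 then a else 0) a := by
  simpa using hasSum_ite_eq (0 : ℤ) a

theorem summable_latticeTerm {γ : ℝ} (hγ : 0 < γ) {s : ℂ} (hs : s ∈ latticeStrip) :
    Summable (latticeTerm γ s) := by
  rw [latticeTerm_eq]
  exact (summable_latticeTailTerm hγ hs).add (hasSum_ite_zero _).summable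

theorem latticeSum_eq {γ : ℝ} (hγ : 0 < γ) {s : ℂ} (hs : s ∈ latticeStrip) :
    latticeSum γ s = s ^ ((-(γ + 1) : ℝ) : ℂ) + latticeTail γ s := by
  rw [latticeSum, latticeTerm_eq, (summable_latticeTailTerm hγ hs).tsum_add
    (hasSum_ite_zero _).summable, (hasSum_ite_zero _).tsum_eq, add_comm]
  rfl

theorem latticeSum_add_two_pi (γ : ℝ) (s : ℂ) :
    latticeSum γ (s + 2 * Real.pi * Complex.I) = latticeSum γ s := by
  unfold latticeSum
  rw [← (Equiv.addRight (1 : ℤ)).tsum_eq (latticeTerm γ s)]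
  congr 1
  funext k
  simp only [latticeTerm, Equiv.coe_addRight]
  congr 1
  push_cast
  ring

theorem differentiableOn_latticeSum {γ : ℝ} (hγ : 0 < γ) :
    DifferentiableOn ℂ (latticeSum γ) (latticeStrip ∩ Complex.slitPlane) := by
  have h : DifferentiableOn ℂ (fun s => s ^ ((-(γ + 1) : ℝ) : ℂ) + latticeTail γ s)
      (latticeStrip ∩ Complex.slitPlane) := by
    apply DifferentiableOn.add
    · intro s hs
      exact (differentiableAt_id.cpow_const hs.2).differentiableWithinAt
    · exact (differentiableOn_latticeTail hγ).mono Set.inter_subset_left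
  exact h.congr fun s hs => latticeSum_eq hγ hs.1

/-- The exponent m + 1 is odd, so at s = 0 the terms of index k and -k cancel. This is the source of
the additional order for even m. -/
theorem latticeTail_zero_of_even {m : ℕ} (hm : Even m) : latticeTail m 0 = 0 := by
  have h : latticeTail m 0 = -latticeTail m 0 := by
    unfold latticeTail
    rw [← tsum_neg, ← (Equiv.neg ℤ).tsum_eq (latticeTailTerm m 0)]
    congr 1
    funext k
    unfold latticeTailTerm latticeTerm
    simp only [Equiv.neg_apply, neg_eq_zero, zero_add]
    split_ifs with hk
    · rw [neg_zero]
    · have hexp : ((-((m : ℝ) + 1) : ℝ) : ℂ) = -((m + 1 : ℕ) : ℂ) := by push_cast; ring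
      rw [hexp, Complex.cpow_neg, Complex.cpow_neg, Complex.cpow_natCast, Complex.cpow_natCast]
      have h1 : (2 * Real.pi * ((-k : ℤ) : ℂ) * Complex.I) ^ (m + 1) =
          -(2 * Real.pi * (k : ℂ) * Complex.I) ^ (m + 1) := by
        rw [← (hm.add_one).neg_pow]
        congr 1
        push_cast
        ring
      rw [h1, inv_neg]
  exact self_eq_neg.mp h

/-- Mean value inequality on a compact convex rectangle in the strip, starting from the zero at the
origin. -/
theorem norm_latticeTail_le_mul_of_even {m : ℕ} (hm1 : 1 ≤ m) (hm : Even m) :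
    ∃ C : ℝ, 0 < C ∧ ∀ s : ℂ, |s.re| ≤ 1 → |s.im| ≤ Real.pi → ‖latticeTail m s‖ ≤ C * ‖s‖ := by
  have hm0 : (0 : ℝ) < m := by exact_mod_cast hm1
  set K : Set ℂ := Set.Icc (-1) 1 ×ℂ Set.Icc (-Real.pi) Real.pi with hK
  have hKc : IsCompact K := isCompact_Icc.reProdIm isCompact_Icc
  have hKconv : Convex ℝ K :=
    ((convex_Icc (-1 : ℝ) 1).linear_preimage Complex.reLm).inter
      ((convex_Icc (-Real.pi) Real.pi).linear_preimage Complex.imLm)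
  have hKS : K ⊆ latticeStrip := by
    intro s hs
    have := abs_le.mpr (Complex.mem_reProdIm.mp hs).2
    change |s.im| < _
    linarith [Real.pi_pos]
  have hd := differentiableOn_latticeTail hm0
  obtain ⟨C, hC⟩ := hKc.exists_bound_of_continuousOn
    ((hd.deriv isOpen_latticeStrip).continuousOn.mono hKS)
  refine ⟨max C 1, by positivity, fun s h1 h2 => ?_⟩
  have hs : s ∈ K := Complex.mem_reProdIm.mpr ⟨abs_le.mp h1, abs_le.mp h2⟩
  have h0 : (0 : ℂ) ∈ K := by
    refine Complex.mem_reProdIm.mpr ⟨?_, ?_⟩ <;> simp [Real.pi_pos.le]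
  have h := hKconv.norm_image_sub_le_of_norm_deriv_le (f := latticeTail m) (C := max C 1)
    (fun x hx => (hd x (hKS hx)).differentiableAt (isOpen_latticeStrip.mem_nhds (hKS hx)))
    (fun x hx => (hC x hx).trans (le_max_left _ _)) h0 hs
  rwa [latticeTail_zero_of_even hm, sub_zero, sub_zero] at h

/-- The decay condition under which Poisson summation is available; the exponential beats every
power. -/
theorem powerExp_isBigO {γ : ℝ} (hγ : 0 < γ) {s : ℂ} (hs : 0 < s.re) :
    powerExp γ s =O[cocompact ℝ] (fun x : ℝ => |x| ^ (-(γ + 1))) := by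
  rw [cocompact_eq_atBot_atTop, Asymptotics.isBigO_sup]
  constructor
  · have h : powerExp γ s =ᶠ[atBot] fun _ => 0 :=
      (eventually_le_atBot 0).mono fun x hx => powerExp_of_nonpos hγ s hx
    exact h.trans_isBigO (Asymptotics.isBigO_zero _ _)
  · have h1 := (isLittleO_exp_neg_mul_rpow_atTop hs (-(2 * γ + 1))).isBigO
    have h2 : (fun x : ℝ => x ^ γ) =O[atTop] (fun x : ℝ => x ^ γ) := Asymptotics.isBigO_refl _ _
    have h3 := h2.mul h1
    have h4 : (fun x : ℝ => x ^ γ * x ^ (-(2 * γ + 1))) =ᶠ[atTop]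
        fun x : ℝ => |x| ^ (-(γ + 1)) := by
      filter_upwards [eventually_gt_atTop 0] with x hx
      rw [← Real.rpow_add hx, abs_of_pos hx]
      congr 1
      ring
    refine (Asymptotics.isBigO_of_le' (c := 1) _ fun x => ?_).trans (h3.trans_eventuallyEq h4)
    rw [powerExp, norm_ofReal_mul_cexp_neg, one_mul, norm_mul]
    rcases le_or_gt x 0 with hx | hx
    · rw [max_eq_right hx, Real.zero_rpow hγ.ne', abs_zero, zero_mul]
      positivity
    · rw [max_eq_left hx.le, Real.norm_eq_abs, Real.norm_eq_abs (Real.exp _),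
        abs_of_pos (Real.exp_pos _), neg_mul]

/-- Lipschitz' summation formula. -/
theorem tsum_pow_mul_exp_eq_latticeSum {γ : ℝ} (hγ : 0 < γ) {s : ℂ} (hs : 0 < s.re)
    (hstrip : s ∈ latticeStrip) :
    ∑' n : ℕ, (((n : ℝ) ^ γ / Real.Gamma (γ + 1) : ℝ) : ℂ) * Complex.exp (-s) ^ n =
      latticeSum γ s := by
  have hΓ : (Real.Gamma (γ + 1) : ℂ) ≠ 0 := by
    exact_mod_cast (Real.Gamma_pos_of_pos (by linarith)).ne'
  have hF : ∀ k : ℤ, FourierTransform.fourier (powerExp γ s) (k : ℝ) =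
      Real.Gamma (γ + 1) * latticeTerm γ s k := by
    intro k
    rw [fourier_powerExp hγ hs]
    simp [latticeTerm]
  -- Poisson summation for x^γ e^(-sx), extended by zero. The Fourier coefficients are the lattice
  -- terms, and the negative integers contribute nothing to the other side.
  have h := Real.tsum_eq_tsum_fourier_of_rpow_decay_of_summable (continuous_powerExp hγ s)
    (by linarith : 1 < γ + 1) (powerExp_isBigO hγ hs)
    (by simp only [hF]; exact (summable_latticeTerm hγ hstrip).mul_left _) 0
  have h0 : (((0 : ℝ)) : UnitAddCircle) = 0 := rfl
  simp only [zero_add, hF, h0, fourier_eval_zero, mul_one, tsum_mul_left] at h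
  have h2 : ∑' n : ℤ, powerExp γ s n = ∑' n : ℕ, powerExp γ s (n : ℝ) := by
    rw [← (Nat.cast_injective (R := ℤ)).tsum_eq]
    · simp
    · intro n hn
      by_contra hne
      apply hn
      apply powerExp_of_nonpos hγ
      have : n < 0 := by
        by_contra hge
        exact hne ⟨n.toNat, Int.toNat_of_nonneg (not_lt.mp hge)⟩
      exact_mod_cast this.le
  rw [h2] at h
  have h3 : latticeSum γ s = (∑' n : ℕ, powerExp γ s (n : ℝ)) / Real.Gamma (γ + 1) := by
    rw [h, latticeSum]
    field_simp
  rw [h3, ← tsum_div_const]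
  congr 1
  funext n
  rw [powerExp_of_nonneg γ s (Nat.cast_nonneg n), ← Complex.exp_nat_mul]
  push_cast
  rw [mul_comm (n : ℂ) (-s), neg_mul]
  ring

end Subdiffusion

/-! ### Taylor coefficients and the generating function of the scalar scheme -/

namespace Subdiffusion

/-- The Taylor coefficients at the origin. -/
noncomputable def taylorCoeff (f : ℂ → ℂ) (n : ℕ) : ℂ := iteratedDeriv n f 0 / (n.factorial : ℂ)

theorem taylorCoeff_mul {f g : ℂ → ℂ} (hf : AnalyticAt ℂ f 0) (hg : AnalyticAt ℂ g 0) (n : ℕ) :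
    taylorCoeff (f * g) n =
      ∑ j ∈ Finset.range (n + 1), taylorCoeff f j * taylorCoeff g (n - j) := by
  unfold taylorCoeff
  rw [iteratedDeriv_mul hf.contDiffAt hg.contDiffAt, Finset.sum_div]
  apply Finset.sum_congr rfl
  intro j hj
  have hjn : j ≤ n := Nat.lt_succ_iff.mp (Finset.mem_range.mp hj)
  rw [Nat.cast_choose ℂ hjn]
  have h1 : (n.factorial : ℂ) ≠ 0 := by exact_mod_cast n.factorial_ne_zero
  field_simp

theorem taylorCoeff_add {f g : ℂ → ℂ} (hf : AnalyticAt ℂ f 0) (hg : AnalyticAt ℂ g 0) (n : ℕ) :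
    taylorCoeff (f + g) n = taylorCoeff f n + taylorCoeff g n := by
  unfold taylorCoeff
  rw [iteratedDeriv_add hf.contDiffAt hg.contDiffAt, add_div]

theorem taylorCoeff_const_mul (c : ℂ) (f : ℂ → ℂ) (n : ℕ) :
    taylorCoeff (fun z => c * f z) n = c * taylorCoeff f n := by
  unfold taylorCoeff
  rw [iteratedDeriv_const_mul_field, mul_div_assoc]

theorem taylorCoeff_congr {f g : ℂ → ℂ} (h : f =ᶠ[𝓝 0] g) (n : ℕ) :
    taylorCoeff f n = taylorCoeff g n := by
  unfold taylorCoeff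
  rw [h.iteratedDeriv_eq]

theorem taylorCoeff_of_hasSum {f : ℂ → ℂ} {c : ℕ → ℂ}
    (h : ∀ z ∈ Metric.ball (0 : ℂ) 1, HasSum (fun n => c n * z ^ n) (f z)) (n : ℕ) :
    taylorCoeff f n = c n := by
  have h1 : HasFPowerSeriesAt f (FormalMultilinearSeries.ofScalars ℂ c) 0 := by
    rw [hasFPowerSeriesAt_iff]
    filter_upwards [Metric.ball_mem_nhds (0 : ℂ) one_pos] with z hz
    rw [zero_add]
    simp only [FormalMultilinearSeries.coeff_ofScalars, smul_eq_mul]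
    simpa only [mul_comm] using h z hz
  have h2 := h1.analyticAt.hasFPowerSeriesAt
  have h3 := congrArg (fun p => FormalMultilinearSeries.coeff p n)
    (h2.eq_formalMultilinearSeries h1)
  simpa only [FormalMultilinearSeries.coeff_ofScalars, taylorCoeff] using h3

/-- Cauchy's formula on the circle of radius e^(-a), parametrised by ξ = e^(-(a+iy)). -/
theorem taylorCoeff_eq_integral {f : ℂ → ℂ} (hf : DifferentiableOn ℂ f (Metric.ball 0 1))
    {a : ℝ} (ha : 0 < a) (n : ℕ) :
    2 * Real.pi * taylorCoeff f n = ∫ y in (-Real.pi)..Real.pi,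
      f (Complex.exp (-((a : ℂ) + y * Complex.I))) *
        Complex.exp (((a : ℂ) + y * Complex.I) * n) := by
  have hρ : Real.exp (-a) < 1 := by rw [Real.exp_lt_one_iff]; linarith
  have hsub : Metric.closedBall (0 : ℂ) (Real.exp (-a)) ⊆ Metric.ball 0 1 :=
    Metric.closedBall_subset_ball hρ
  have h := Complex.circleIntegral_one_div_sub_center_pow_smul_of_differentiable_on_off_countable
    (f := f) (c := 0) (Real.exp_pos (-a)) n Set.countable_empty (hf.continuousOn.mono hsub)
    (fun z hz => hf.differentiableAt
      (Metric.isOpen_ball.mem_nhds (hsub (Metric.ball_subset_closedBall hz.1))))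
  set g : ℝ → ℂ := fun y => f (Complex.exp (-((a : ℂ) + y * Complex.I))) *
        Complex.exp (((a : ℂ) + y * Complex.I) * n) with hg
  have hper : Function.Periodic g (2 * Real.pi) := by
    intro y
    have h1 : -((a : ℂ) + ((y + 2 * Real.pi : ℝ) : ℂ) * Complex.I) =
        -((a : ℂ) + y * Complex.I) - 2 * Real.pi * Complex.I := by push_cast; ring
    have h2 : ((a : ℂ) + ((y + 2 * Real.pi : ℝ) : ℂ) * Complex.I) * n =
        ((a : ℂ) + y * Complex.I) * n + n * (2 * Real.pi * Complex.I) := by push_cast; ring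
    simp only [hg]
    rw [h1, h2, Complex.exp_periodic.sub_eq, Complex.exp_add, Complex.exp_nat_mul_two_pi_mul_I,
      mul_one]
  -- The parameter y runs through the circle clockwise, hence θ = -y; periodicity moves the
  -- interval.
  have h1 : ∫ y in (-Real.pi)..Real.pi, g y = ∫ θ in (0 : ℝ)..2 * Real.pi, g (-θ) := by
    rw [intervalIntegral.integral_comp_neg, neg_zero]
    have := hper.intervalIntegral_add_eq (-Real.pi) (-(2 * Real.pi))
    convert! this using 2 <;> ring
  have h2 : (∮ z in C(0, Real.exp (-a)), (1 / (z - 0) ^ (n + 1)) • f z) =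
      Complex.I * ∫ θ in (0 : ℝ)..2 * Real.pi, g (-θ) := by
    rw [circleIntegral, ← intervalIntegral.integral_const_mul]
    congr 1
    funext θ
    have hz : circleMap 0 (Real.exp (-a)) θ = Complex.exp (-((a : ℂ) + ((-θ : ℝ) : ℂ) * Complex.I))
      := by
      rw [circleMap_zero, Complex.ofReal_exp, ← Complex.exp_add]
      congr 1
      push_cast
      ring
    rw [deriv_circleMap, sub_zero, smul_eq_mul, smul_eq_mul, hz]
    simp only [hg]
    have hE := Complex.exp_ne_zero (-((a : ℂ) + ((-θ : ℝ) : ℂ) * Complex.I))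
    have h3 : Complex.exp (((a : ℂ) + ((-θ : ℝ) : ℂ) * Complex.I) * n) =
        (Complex.exp (-((a : ℂ) + ((-θ : ℝ) : ℂ) * Complex.I)) ^ n)⁻¹ := by
      rw [← Complex.exp_nat_mul, ← Complex.exp_neg]
      congr 1
      ring
    rw [h3]
    field_simp
    ring
  rw [h2, smul_eq_mul] at h
  rw [h1]
  unfold taylorCoeff
  have hI := Complex.I_ne_zero
  apply mul_left_cancel₀ hI
  rw [h]
  ring

/-- The generating function of the sequence `n^γ / Γ(γ+1)`. -/
noncomputable def powerSeq (γ : ℝ) (ξ : ℂ) : ℂ :=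
  ∑' n : ℕ, (((n : ℝ) ^ γ / Real.Gamma (γ + 1) : ℝ) : ℂ) * ξ ^ n

theorem norm_powerSeq_term_le {γ : ℝ} (hγ : 0 < γ) {r : ℝ} {ξ : ℂ} (hξ : ‖ξ‖ ≤ r) (n : ℕ) :
    ‖(((n : ℝ) ^ γ / Real.Gamma (γ + 1) : ℝ) : ℂ) * ξ ^ n‖ ≤
      (Real.Gamma (γ + 1))⁻¹ * ((n : ℝ) ^ ⌈γ⌉₊ * r ^ n) := by
  have hΓ : 0 < Real.Gamma (γ + 1) := Real.Gamma_pos_of_pos (by linarith)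
  have h1 : (n : ℝ) ^ γ ≤ (n : ℝ) ^ ⌈γ⌉₊ := by
    rcases Nat.eq_zero_or_pos n with rfl | hn
    · rw [Nat.cast_zero, Real.zero_rpow hγ.ne']
      positivity
    · rw [← Real.rpow_natCast]
      exact Real.rpow_le_rpow_of_exponent_le (by exact_mod_cast hn) (Nat.le_ceil γ)
  rw [norm_mul, norm_pow, Complex.norm_real, Real.norm_of_nonneg (by positivity), div_eq_inv_mul,
    mul_assoc]
  gcongr

theorem summable_powerSeq_bound (γ : ℝ) {r : ℝ} (hr0 : 0 ≤ r) (hr1 : r < 1) :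
    Summable fun n : ℕ => (Real.Gamma (γ + 1))⁻¹ * ((n : ℝ) ^ ⌈γ⌉₊ * r ^ n) :=
  (summable_pow_mul_geometric_of_norm_lt_one (R := ℝ) ⌈γ⌉₊
    (by rwa [Real.norm_of_nonneg hr0])).mul_left _

theorem hasSum_powerSeq {γ : ℝ} (hγ : 0 < γ) {ξ : ℂ} (hξ : ξ ∈ Metric.ball (0 : ℂ) 1) :
    HasSum (fun n : ℕ => (((n : ℝ) ^ γ / Real.Gamma (γ + 1) : ℝ) : ℂ) * ξ ^ n) (powerSeq γ ξ) := by
  rw [mem_ball_zero_iff] at hξ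
  exact (Summable.of_norm_bounded (summable_powerSeq_bound γ (norm_nonneg ξ) hξ)
    (fun n => norm_powerSeq_term_le hγ le_rfl n)).hasSum

theorem differentiableOn_powerSeq {γ : ℝ} (hγ : 0 < γ) :
    DifferentiableOn ℂ (powerSeq γ) (Metric.ball 0 1) := by
  intro ξ hξ
  rw [mem_ball_zero_iff] at hξ
  obtain ⟨r, hr1, hr2⟩ := exists_between hξ
  have h : DifferentiableOn ℂ (powerSeq γ) (Metric.ball 0 r) :=
    Complex.differentiableOn_tsum_of_summable_norm
      (F := fun (n : ℕ) ξ => (((n : ℝ) ^ γ / Real.Gamma (γ + 1) : ℝ) : ℂ) * ξ ^ n)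
      (summable_powerSeq_bound γ ((norm_nonneg ξ).trans hr1.le) hr2)
      (fun n => by fun_prop) Metric.isOpen_ball
      (fun n w hw => norm_powerSeq_term_le hγ (mem_ball_zero_iff.mp hw).le n)
  exact (h.differentiableAt (Metric.isOpen_ball.mem_nhds
    (mem_ball_zero_iff.mpr hr1))).differentiableWithinAt

/-- The generating function of the scheme with step size one, for the eigenvalue `-x` of `A` and
the source with `m`-fold integral `t^γ / Γ(γ+1)`. -/
noncomputable def schemeFun (k m : ℕ) (α γ x : ℝ) (ξ : ℂ) : ℂ :=
  bdfPoly k ξ ^ ((m : ℝ) : ℂ) / (bdfPoly k ξ ^ (α : ℂ) + x) * powerSeq γ ξ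

/-- The solution of the scalar scheme with step size one. -/
noncomputable def schemeCoeff (k m : ℕ) (α γ x : ℝ) (n : ℕ) : ℂ :=
  taylorCoeff (schemeFun k m α γ x) n

/-- The right hand side of the scalar scheme with step size one. -/
noncomputable def schemeRhs (k m : ℕ) (γ : ℝ) (n : ℕ) : ℂ :=
  ∑ j ∈ Finset.range (n + 1),
    bdfWeight k m j * ((((n - j : ℕ) : ℝ) ^ γ / Real.Gamma (γ + 1) : ℝ) : ℂ)

theorem cpow_add_ofReal_ne_zero {α : ℝ} (hα0 : 0 < α) (hα1 : α < 1) {x : ℝ} (hx : 0 ≤ x)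
    {s : ℂ} (hs : s ≠ 0) : s ^ (α : ℂ) + x ≠ 0 := by
  obtain ⟨c, hc, h⟩ := norm_cpow_add_ge hα0 hα1
  have hp : 0 < ‖s‖ ^ α := Real.rpow_pos_of_pos (norm_pos_iff.mpr hs) _
  have := h s x hx
  rw [← norm_pos_iff]
  refine lt_of_lt_of_le (by positivity) this

section

variable {k m : ℕ} {α γ x : ℝ}

theorem bdfPoly_mem_slitPlane_of_mem_ball (hk1 : 1 ≤ k) (hk6 : k ≤ 6) {ξ : ℂ}
    (hξ : ξ ∈ Metric.ball (0 : ℂ) 1) : bdfPoly k ξ ∈ Complex.slitPlane := by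
  rw [mem_ball_zero_iff] at hξ
  apply bdfPoly_mem_slitPlane hk1 hk6 hξ.le
  rintro rfl
  simp at hξ

theorem differentiableOn_bdfPoly_cpow (hk1 : 1 ≤ k) (hk6 : k ≤ 6) (β : ℝ) :
    DifferentiableOn ℂ (fun ξ => bdfPoly k ξ ^ (β : ℂ)) (Metric.ball 0 1) := fun ξ hξ =>
  (((differentiable_bdfPoly k) ξ).cpow_const
    (bdfPoly_mem_slitPlane_of_mem_ball hk1 hk6 hξ)).differentiableWithinAt

theorem differentiableOn_schemeFun (hk1 : 1 ≤ k) (hk6 : k ≤ 6) (hα0 : 0 < α) (hα1 : α < 1)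
    (hγ : 0 < γ) (hx : 0 ≤ x) :
    DifferentiableOn ℂ (schemeFun k m α γ x) (Metric.ball 0 1) := by
  apply DifferentiableOn.mul _ (differentiableOn_powerSeq hγ)
  apply DifferentiableOn.div (differentiableOn_bdfPoly_cpow hk1 hk6 m)
  · exact (differentiableOn_bdfPoly_cpow hk1 hk6 α).add_const _
  · intro ξ hξ
    exact cpow_add_ofReal_ne_zero hα0 hα1 hx
      (Complex.slitPlane_ne_zero (bdfPoly_mem_slitPlane_of_mem_ball hk1 hk6 hξ))

theorem analyticAt_zero_of_differentiableOn_ball {f : ℂ → ℂ}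
    (hf : DifferentiableOn ℂ f (Metric.ball 0 1)) : AnalyticAt ℂ f 0 :=
  hf.analyticAt (Metric.ball_mem_nhds 0 one_pos)

/-- Multiplying the generating function by δ^α + x removes the denominator; the Cauchy product of
Taylor coefficients then reads as the scheme. -/
theorem schemeCoeff_recursion (hk1 : 1 ≤ k) (hk6 : k ≤ 6) (hα0 : 0 < α) (hα1 : α < 1)
    (hγ : 0 < γ) (hx : 0 ≤ x) (n : ℕ) :
    ∑ j ∈ Finset.range (n + 1), bdfWeight k α j * schemeCoeff k m α γ x (n - j) +
      x * schemeCoeff k m α γ x n = schemeRhs k m γ n := by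
  have hα := analyticAt_zero_of_differentiableOn_ball (differentiableOn_bdfPoly_cpow hk1 hk6 α)
  have hm := analyticAt_zero_of_differentiableOn_ball
    (differentiableOn_bdfPoly_cpow hk1 hk6 (m : ℝ))
  have hS := analyticAt_zero_of_differentiableOn_ball
    (differentiableOn_schemeFun (m := m) hk1 hk6 hα0 hα1 hγ hx)
  have hP := analyticAt_zero_of_differentiableOn_ball (differentiableOn_powerSeq hγ)
  have h1 : ((fun ξ => bdfPoly k ξ ^ (α : ℂ)) * schemeFun k m α γ x +
      fun ξ => (x : ℂ) * schemeFun k m α γ x ξ) =ᶠ[𝓝 0]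
        (fun ξ => bdfPoly k ξ ^ ((m : ℝ) : ℂ)) * powerSeq γ := by
    filter_upwards [Metric.ball_mem_nhds (0 : ℂ) one_pos] with ξ hξ
    have h0 := cpow_add_ofReal_ne_zero hα0 hα1 hx
      (Complex.slitPlane_ne_zero (bdfPoly_mem_slitPlane_of_mem_ball hk1 hk6 hξ))
    simp only [Pi.add_apply, Pi.mul_apply, schemeFun]
    field_simp
  have h2 := taylorCoeff_congr h1 n
  have hxS : AnalyticAt ℂ (fun ξ => (x : ℂ) * schemeFun k m α γ x ξ) 0 :=
    analyticAt_const.mul hS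
  rw [taylorCoeff_add (hα.mul hS) hxS, taylorCoeff_mul hα hS,
    taylorCoeff_mul hm hP, taylorCoeff_const_mul] at h2
  rw [schemeRhs]
  convert! h2 using 1
  apply Finset.sum_congr rfl
  intro j _
  rw [taylorCoeff_of_hasSum (fun z hz => hasSum_powerSeq hγ hz)]
  rfl

/-- The continuation of the generating function of the scheme, in the variable `s` with
`ξ = e^{-s}`. -/
noncomputable def schemeSymbol (k m : ℕ) (α γ x : ℝ) (s : ℂ) : ℂ :=
  bdfSymbol k s ^ m / (bdfSymbol k s ^ (α : ℂ) + x) * latticeSum γ s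

theorem schemeSymbol_add_two_pi (k m : ℕ) (α γ x : ℝ) (s : ℂ) :
    schemeSymbol k m α γ x (s + 2 * Real.pi * Complex.I) = schemeSymbol k m α γ x s := by
  have h : bdfSymbol k (s + 2 * Real.pi * Complex.I) = bdfSymbol k s := by
    unfold bdfSymbol
    rw [neg_add, ← sub_eq_add_neg, Complex.exp_periodic.sub_eq]
  unfold schemeSymbol
  rw [latticeSum_add_two_pi, h]

/-- On the line Re s = a > 0 the power series converges and Lipschitz' formula replaces it by the
lattice sum, which continues to the left of the imaginary axis. -/
theorem schemeCoeff_eq_integral (hk1 : 1 ≤ k) (hk6 : k ≤ 6) (hα0 : 0 < α) (hα1 : α < 1)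
    (hγ : 0 < γ) (hx : 0 ≤ x) {a : ℝ} (ha : 0 < a) (n : ℕ) :
    2 * Real.pi * schemeCoeff k m α γ x n = ∫ y in (-Real.pi)..Real.pi,
      schemeSymbol k m α γ x ((a : ℂ) + y * Complex.I) *
        Complex.exp (((a : ℂ) + y * Complex.I) * n) := by
  rw [schemeCoeff, taylorCoeff_eq_integral
    (differentiableOn_schemeFun hk1 hk6 hα0 hα1 hγ hx) ha]
  apply intervalIntegral.integral_congr
  intro y hy
  rw [Set.uIcc_of_le (by linarith [Real.pi_pos])] at hy
  have hstrip : (a : ℂ) + y * Complex.I ∈ latticeStrip := by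
    change |((a : ℂ) + y * Complex.I).im| < _
    have := abs_le.mpr hy
    simp
    linarith [Real.pi_pos]
  simp only [schemeFun, schemeSymbol, bdfSymbol, Complex.ofReal_natCast, Complex.cpow_natCast]
  rw [← tsum_pow_mul_exp_eq_latticeSum hγ (by simpa using ha) hstrip]
  rfl

end

end Subdiffusion

namespace Subdiffusion

/-! ### Mittag-Leffler functions -/

/-- Only the part of Euler's integral over (c, ∞) is kept, where the power is at least c^(y-1). As c
is arbitrary, Γ grows faster than any geometric sequence. -/
theorem rpow_mul_exp_neg_le_Gamma {c y : ℝ} (hc : 0 < c) (hy : 1 ≤ y) :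
    c ^ (y - 1) * Real.exp (-c) ≤ Real.Gamma y := by
  rw [Real.Gamma_eq_integral (by linarith), ← integral_exp_neg_Ioi c, ← integral_const_mul]
  have hint := Real.GammaIntegral_convergent (by linarith : 0 < y)
  have hsub : Set.Ioi c ⊆ Set.Ioi 0 := Set.Ioi_subset_Ioi hc.le
  calc ∫ x in Set.Ioi c, c ^ (y - 1) * Real.exp (-x)
      ≤ ∫ x in Set.Ioi c, Real.exp (-x) * x ^ (y - 1) := by
        apply setIntegral_mono_on
        · exact (integrableOn_exp_neg_Ioi c).const_mul _
        · exact hint.mono_set hsub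
        · exact measurableSet_Ioi
        · intro x hx
          rw [mul_comm]
          exact mul_le_mul_of_nonneg_left
            (Real.rpow_le_rpow hc.le (le_of_lt hx) (by linarith)) (Real.exp_pos _).le
    _ ≤ ∫ x in Set.Ioi 0, Real.exp (-x) * x ^ (y - 1) := by
        apply setIntegral_mono_set hint
        · refine (ae_restrict_mem measurableSet_Ioi).mono fun x (hx : 0 < x) => ?_
          change 0 ≤ Real.exp (-x) * x ^ (y - 1)
          positivity
        · exact hsub.eventuallyLE

theorem summable_inv_Gamma_mul_pow {α β : ℝ} (hα : 0 < α) (hβ : 0 < β) {r : ℝ} (hr : 0 ≤ r) :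
    Summable fun j : ℕ => (Real.Gamma (α * j + β))⁻¹ * r ^ j := by
  -- Chosen such that c^α = 2r + 1; the series is then dominated by a geometric one of ratio
  -- r/(2r+1) < 1.
  set c : ℝ := (2 * r + 1) ^ (α⁻¹) with hc
  have hc0 : 0 < c := by positivity
  have hcα : c ^ α = 2 * r + 1 := by
    rw [hc, ← Real.rpow_mul (by positivity), inv_mul_cancel₀ hα.ne', Real.rpow_one]
  obtain ⟨N, hN⟩ := exists_nat_gt (1 / α)
  have hq : r / (2 * r + 1) < 1 := by rw [div_lt_one (by linarith)]; linarith
  have hgeo : Summable fun j : ℕ => (c ^ (1 - β) * Real.exp c) * (r / (2 * r + 1)) ^ j :=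
    (summable_geometric_of_lt_one (by positivity) hq).mul_left _
  rw [← summable_nat_add_iff N]
  refine Summable.of_nonneg_of_le (fun j => ?_) (fun j => ?_) ((summable_nat_add_iff N).mpr hgeo)
  · have : 0 < Real.Gamma (α * ((j + N : ℕ) : ℝ) + β) :=
      Real.Gamma_pos_of_pos (by positivity)
    positivity
  · have h1 : 1 ≤ α * ((j + N : ℕ) : ℝ) + β := by
      have : 1 < α * N := by rwa [div_lt_iff₀' hα] at hN
      push_cast
      have : 0 ≤ α * j := by positivity
      linarith
    generalize j + N = i at h1 ⊢
    have h2 := rpow_mul_exp_neg_le_Gamma hc0 h1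
    have h3 : (Real.Gamma (α * i + β))⁻¹ ≤ (c ^ (α * i + β - 1) * Real.exp (-c))⁻¹ :=
      inv_anti₀ (by positivity) h2
    have h4 : (c ^ (α * i + β - 1) * Real.exp (-c))⁻¹ =
        c ^ (1 - β) * Real.exp c * ((2 * r + 1) ^ i)⁻¹ := by
      rw [mul_inv, Real.exp_neg, inv_inv, ← Real.rpow_neg hc0.le]
      have : -(α * i + β - 1) = (1 - β) + -(α * i) := by ring
      rw [this, Real.rpow_add hc0, Real.rpow_neg hc0.le, Real.rpow_mul hc0.le, hcα,
        Real.rpow_natCast]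
      ring
    calc (Real.Gamma (α * i + β))⁻¹ * r ^ i
        ≤ (c ^ (α * i + β - 1) * Real.exp (-c))⁻¹ * r ^ i := by gcongr
      _ = c ^ (1 - β) * Real.exp c * (r / (2 * r + 1)) ^ i := by
        rw [h4, div_pow]; ring

theorem integral_sub_rpow_mul_rpow {γ y t : ℝ} (hγ : 0 < γ) (hy : 0 < y) (ht : 0 < t) :
    ∫ s in (0 : ℝ)..t, (t - s) ^ (γ - 1) * s ^ (y - 1) =
      Real.Gamma γ * Real.Gamma y / Real.Gamma (y + γ) * t ^ (y + γ - 1) := by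
  have h := Complex.betaIntegral_scaled y γ ht
  have hB := Complex.Gamma_mul_Gamma_eq_betaIntegral (s := y) (t := γ) (by simpa using hy)
    (by simpa using hγ)
  have hΓ : Real.Gamma (y + γ) ≠ 0 := (Real.Gamma_pos_of_pos (by linarith)).ne'
  have h1 : (∫ x in (0 : ℝ)..t, (x : ℂ) ^ ((y : ℂ) - 1) * ((t : ℂ) - x) ^ ((γ : ℂ) - 1)) =
      ((∫ s in (0 : ℝ)..t, (t - s) ^ (γ - 1) * s ^ (y - 1) : ℝ) : ℂ) := by
    rw [← intervalIntegral.integral_ofReal]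
    apply intervalIntegral.integral_congr
    intro x hx
    rw [Set.uIcc_of_le ht.le] at hx
    simp only
    rw [Complex.ofReal_mul, Complex.ofReal_cpow (by linarith [hx.2]), Complex.ofReal_cpow hx.1]
    push_cast
    ring
  rw [h1] at h
  have h2 : (t : ℂ) ^ ((y : ℂ) + γ - 1) = ((t ^ (y + γ - 1) : ℝ) : ℂ) := by
    rw [Complex.ofReal_cpow ht.le]
    push_cast
    ring
  rw [h2] at h
  have h3 : Complex.betaIntegral y γ =
      ((Real.Gamma γ * Real.Gamma y / Real.Gamma (y + γ) : ℝ) : ℂ) := by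
    have hΓ' : ((Real.Gamma (y + γ) : ℝ) : ℂ) ≠ 0 := by exact_mod_cast hΓ
    rw [Complex.Gamma_ofReal, Complex.Gamma_ofReal, ← Complex.ofReal_add, Complex.Gamma_ofReal]
      at hB
    push_cast
    rw [eq_div_iff hΓ', mul_comm (Real.Gamma γ : ℂ), hB]
    ring
  rw [h3, ← Complex.ofReal_mul] at h
  rw [Complex.ofReal_injective h]
  ring

theorem intervalIntegrable_sub_rpow_mul_rpow {γ y t : ℝ} (hγ : 0 < γ) (hy : 0 < y) (ht : 0 < t) :
    IntervalIntegrable (fun s => (t - s) ^ (γ - 1) * s ^ (y - 1)) volume 0 t := by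
  apply intervalIntegral.intervalIntegrable_of_integral_ne_zero
  rw [integral_sub_rpow_mul_rpow hγ hy ht]
  have h1 := Real.Gamma_pos_of_pos hγ
  have h2 := Real.Gamma_pos_of_pos hy
  have h3 : 0 < Real.Gamma (y + γ) := Real.Gamma_pos_of_pos (by linarith)
  positivity

/-- The norm of 1 is not assumed to be 1; the additional factor takes care of j = 0. -/
theorem norm_pow_le_const_mul {𝔸 : Type*} [NormedRing 𝔸] (b : 𝔸) (j : ℕ) :
    ‖b ^ j‖ ≤ (‖(1 : 𝔸)‖ + 1) * ‖b‖ ^ j := by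
  rcases Nat.eq_zero_or_pos j with rfl | hj
  · simp
  · refine (norm_pow_le' b hj).trans ?_
    apply le_mul_of_one_le_left (by positivity)
    linarith [norm_nonneg (1 : 𝔸)]

section

variable {𝔸 : Type*} [NormedRing 𝔸] [NormedAlgebra ℝ 𝔸]

/-- The function `∑ⱼ bʲ / Γ(αj+β)`. -/
noncomputable def mlFun (α β : ℝ) (b : 𝔸) : 𝔸 :=
  ∑' j : ℕ, (Real.Gamma (α * j + β))⁻¹ • b ^ j

/-- The function `∑ⱼ t^{αj+β-1} bʲ / Γ(αj+β)`. -/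
noncomputable def mlKernel (α β t : ℝ) (b : 𝔸) : 𝔸 := t ^ (β - 1) • mlFun α β (t ^ α • b)

theorem norm_mlFun_term_le {α β : ℝ} (hα : 0 < α) (hβ : 0 < β) {r : ℝ} {b : 𝔸} (hb : ‖b‖ ≤ r)
    (j : ℕ) : ‖(Real.Gamma (α * j + β))⁻¹ • b ^ j‖ ≤
      (‖(1 : 𝔸)‖ + 1) * ((Real.Gamma (α * j + β))⁻¹ * r ^ j) := by
  have hΓ : 0 < Real.Gamma (α * j + β) := Real.Gamma_pos_of_pos (by positivity)
  rw [norm_smul, Real.norm_of_nonneg (by positivity)]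
  calc (Real.Gamma (α * j + β))⁻¹ * ‖b ^ j‖
      ≤ (Real.Gamma (α * j + β))⁻¹ * ((‖(1 : 𝔸)‖ + 1) * ‖b‖ ^ j) := by
        gcongr; exact norm_pow_le_const_mul b j
    _ ≤ (Real.Gamma (α * j + β))⁻¹ * ((‖(1 : 𝔸)‖ + 1) * r ^ j) := by gcongr
    _ = _ := by ring

/-- Homogeneity: time t τ with the generator b corresponds to time t with τ^α b, which is the
scaling to step size one. -/
theorem mlKernel_mul {α β : ℝ} {τ t : ℝ} (hτ : 0 ≤ τ) (ht : 0 ≤ t) (b : 𝔸) :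
    mlKernel α β (t * τ) b = τ ^ (β - 1) • mlKernel α β t (τ ^ α • b) := by
  unfold mlKernel
  rw [Real.mul_rpow ht hτ, Real.mul_rpow ht hτ, smul_smul, smul_smul, mul_comm (τ ^ (β - 1))]

variable [CompleteSpace 𝔸]

theorem hasSum_mlFun {α β : ℝ} (hα : 0 < α) (hβ : 0 < β) (b : 𝔸) :
    HasSum (fun j : ℕ => (Real.Gamma (α * j + β))⁻¹ • b ^ j) (mlFun α β b) :=
  (Summable.of_norm_bounded ((summable_inv_Gamma_mul_pow hα hβ (norm_nonneg b)).mul_left _)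
    (fun j => norm_mlFun_term_le hα hβ le_rfl j)).hasSum

theorem continuous_mlFun {α β : ℝ} (hα : 0 < α) (hβ : 0 < β) :
    Continuous (mlFun α β : 𝔸 → 𝔸) := by
  rw [continuous_iff_continuousAt]
  intro b
  have h : ContinuousOn (mlFun α β : 𝔸 → 𝔸) (Metric.ball 0 (‖b‖ + 1)) :=
    continuousOn_tsum (fun j => by fun_prop)
      ((summable_inv_Gamma_mul_pow hα hβ (by positivity : 0 ≤ ‖b‖ + 1)).mul_left _)
      (fun j x hx => norm_mlFun_term_le hα hβ (mem_ball_zero_iff.mp hx).le j)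
  exact h.continuousAt (Metric.isOpen_ball.mem_nhds (mem_ball_zero_iff.mpr (by linarith)))

theorem continuousOn_mlKernel {α β : ℝ} (hα : 0 < α) (hβ : 0 < β) (b : 𝔸) :
    ContinuousOn (fun t => mlKernel α β t b) (Set.Ioi 0) := by
  apply ContinuousOn.smul
  · intro t ht
    exact (Real.continuousAt_rpow_const t _ (Or.inl (ne_of_gt ht))).continuousWithinAt
  · exact ((continuous_mlFun hα hβ).comp
      ((continuous_id.rpow_const fun x => Or.inr hα.le).smul continuous_const)).continuousOn

theorem hasSum_mlKernel {α β t : ℝ} (hα : 0 < α) (hβ : 0 < β) (ht : 0 < t) (b : 𝔸) :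
    HasSum (fun j : ℕ => (t ^ (α * j + β - 1) / Real.Gamma (α * j + β)) • b ^ j)
      (mlKernel α β t b) := by
  have h := (hasSum_mlFun hα hβ (t ^ α • b)).const_smul (t ^ (β - 1))
  have h1 : (fun j : ℕ => t ^ (β - 1) • (Real.Gamma (α * j + β))⁻¹ • (t ^ α • b) ^ j) =
      fun j : ℕ => (t ^ (α * j + β - 1) / Real.Gamma (α * j + β)) • b ^ j := by
    funext j
    rw [smul_pow, smul_smul, smul_smul, ← Real.rpow_natCast (t ^ α), ← Real.rpow_mul ht.le]
    congr 1
    have : α * j + β - 1 = (β - 1) + α * j := by ring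
    rw [this, Real.rpow_add ht]
    ring
  rw [h1] at h
  exact h

/-- Splitting off the first term of the series. Together with the action of fractional integrals on
β this is the integrated fractional equation. -/
theorem mlKernel_eq_add {α β t : ℝ} (hα : 0 < α) (hβ : 0 < β) (ht : 0 < t) (b : 𝔸) :
    mlKernel α β t b = (t ^ (β - 1) / Real.Gamma β) • 1 + b * mlKernel α (β + α) t b := by
  have h1 := hasSum_mlKernel hα hβ ht b
  have h2 := (hasSum_mlKernel hα (by linarith : 0 < β + α) ht b).mul_left b
  have h3 : HasSum (fun j : ℕ => (t ^ (α * ((j + 1 : ℕ) : ℝ) + β - 1) /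
      Real.Gamma (α * ((j + 1 : ℕ) : ℝ) + β)) • b ^ (j + 1)) (b * mlKernel α (β + α) t b) := by
    have h3 : ∀ j : ℕ, b * (t ^ (α * (j : ℝ) + (β + α) - 1) /
        Real.Gamma (α * (j : ℝ) + (β + α))) • b ^ j =
          (t ^ (α * ((j + 1 : ℕ) : ℝ) + β - 1) /
            Real.Gamma (α * ((j + 1 : ℕ) : ℝ) + β)) • b ^ (j + 1) := by
      intro j
      have : α * (j : ℝ) + (β + α) = α * ((j + 1 : ℕ) : ℝ) + β := by push_cast; ring
      rw [mul_smul_comm, ← pow_succ', this]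
    simpa only [h3] using h2
  have h4 := (hasSum_nat_add_iff' 1).mpr h1
  have h5 := h3.unique h4
  rw [h5]
  simp

/-- Termwise Beta integrals raise β by γ; the sum of the integrals of the norms is again a
Mittag-Leffler series, which justifies the interchange. -/
theorem fracIntegral_mlKernel {α β γ t : ℝ} (hα : 0 < α) (hβ : 0 < β) (hγ : 0 < γ) (ht : 0 < t)
    (b : 𝔸) :
    IntervalIntegrable (fun s => (t - s) ^ (γ - 1) • mlKernel α β s b) volume 0 t ∧
      fracIntegral γ (fun s => mlKernel α β s b) t = mlKernel α (β + γ) t b := by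
  have hcont : ContinuousOn (fun s : ℝ => mlFun α β (s ^ α • b)) (Set.uIcc 0 t) :=
    ((continuous_mlFun hα hβ).comp
      ((continuous_id.rpow_const fun x => Or.inr hα.le).smul continuous_const)).continuousOn
  have hint : IntervalIntegrable (fun s => (t - s) ^ (γ - 1) • mlKernel α β s b) volume 0 t := by
    have h := (intervalIntegrable_sub_rpow_mul_rpow hγ hβ ht).smul_continuousOn hcont
    simpa only [mlKernel, smul_smul] using h
  refine ⟨hint, ?_⟩
  set F : ℕ → ℝ → 𝔸 := fun j s =>
    ((t - s) ^ (γ - 1) * s ^ (α * j + β - 1) * (Real.Gamma (α * j + β))⁻¹) • b ^ j with hF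
  have hy : ∀ j : ℕ, 0 < α * j + β := fun j => by positivity
  have hΓ : ∀ j : ℕ, 0 < Real.Gamma (α * j + β) := fun j => Real.Gamma_pos_of_pos (hy j)
  have hI : ∀ j : ℕ, IntegrableOn (fun s => (t - s) ^ (γ - 1) * s ^ (α * j + β - 1))
      (Set.Ioc 0 t) := fun j =>
    (intervalIntegrable_iff_integrableOn_Ioc_of_le ht.le).mp
      (intervalIntegrable_sub_rpow_mul_rpow hγ (hy j) ht)
  have hval : ∀ j : ℕ, ∫ s in Set.Ioc 0 t, (t - s) ^ (γ - 1) * s ^ (α * j + β - 1) *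
      (Real.Gamma (α * j + β))⁻¹ =
        Real.Gamma γ * (t ^ (α * j + (β + γ) - 1) / Real.Gamma (α * j + (β + γ))) := by
    intro j
    rw [integral_mul_const, ← intervalIntegral.integral_of_le ht.le,
      integral_sub_rpow_mul_rpow hγ (hy j) ht, ← add_assoc]
    field_simp [(hΓ j).ne']
  have hFint : ∀ j, Integrable (F j) (volume.restrict (Set.Ioc 0 t)) := fun j =>
    ((hI j).mul_const _).smul_const _
  have hsum : Summable fun j => ∫ s in Set.Ioc 0 t, ‖F j s‖ := by
    have h1 : ∀ j, ∫ s in Set.Ioc 0 t, ‖F j s‖ =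
        Real.Gamma γ * (t ^ (α * j + (β + γ) - 1) / Real.Gamma (α * j + (β + γ))) * ‖b ^ j‖ := by
      intro j
      rw [← hval j, ← integral_mul_const]
      apply setIntegral_congr_fun measurableSet_Ioc
      intro s hs
      have h0 := (hΓ j).le
      simp only [hF]
      rw [norm_smul, Real.norm_of_nonneg]
      have h2 : 0 ≤ t - s := by linarith [hs.2]
      have h3 : 0 ≤ s := hs.1.le
      positivity
    simp only [h1]
    refine Summable.of_nonneg_of_le (fun j => ?_) (fun j => ?_)
      ((summable_inv_Gamma_mul_pow hα (by linarith : 0 < β + γ)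
        (by positivity : 0 ≤ t ^ α * ‖b‖)).mul_left
          (Real.Gamma γ * t ^ (β + γ - 1) * (‖(1 : 𝔸)‖ + 1)))
    · have h0 : 0 < Real.Gamma (α * j + (β + γ)) := Real.Gamma_pos_of_pos (by positivity)
      have := Real.Gamma_pos_of_pos hγ
      positivity
    · have h0 : 0 < Real.Gamma (α * j + (β + γ)) := Real.Gamma_pos_of_pos (by positivity)
      have h2 := Real.Gamma_pos_of_pos hγ
      have h3 : α * j + (β + γ) - 1 = (β + γ - 1) + α * j := by ring
      rw [h3, Real.rpow_add ht, Real.rpow_mul ht.le, Real.rpow_natCast, mul_pow]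
      calc Real.Gamma γ * (t ^ (β + γ - 1) * (t ^ α) ^ j / Real.Gamma (α * j + (β + γ))) * ‖b ^ j‖
          ≤ Real.Gamma γ * (t ^ (β + γ - 1) * (t ^ α) ^ j / Real.Gamma (α * j + (β + γ))) *
            ((‖(1 : 𝔸)‖ + 1) * ‖b‖ ^ j) := by
              gcongr
              exact norm_pow_le_const_mul b j
        _ = _ := by ring
  have h := hasSum_integral_of_summable_integral_norm hFint hsum
  have h1 : ∀ j, ∫ s in Set.Ioc 0 t, F j s = Real.Gamma γ •
      ((t ^ (α * j + (β + γ) - 1) / Real.Gamma (α * j + (β + γ))) • b ^ j) := by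
    intro j
    simp only [hF]
    rw [integral_smul_const, hval j, smul_smul]
  simp only [h1] at h
  have h2 := (hasSum_mlKernel hα (by linarith : 0 < β + γ) ht b).const_smul (Real.Gamma γ)
  have h3 := h.unique h2
  have h4 : ∫ s in Set.Ioc 0 t, (t - s) ^ (γ - 1) • mlKernel α β s b =
      ∫ s in Set.Ioc 0 t, ∑' j, F j s := by
    apply setIntegral_congr_fun measurableSet_Ioc
    intro s hs
    have h5 := (hasSum_mlKernel hα hβ hs.1 b).const_smul ((t - s) ^ (γ - 1))
    simp only
    rw [← h5.tsum_eq]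
    congr 1
    funext j
    simp only [hF]
    rw [smul_smul, mul_assoc, div_eq_mul_inv]
  rw [fracIntegral, intervalIntegral.integral_of_le ht.le, h4, h3, smul_smul,
    inv_mul_cancel₀ (Real.Gamma_pos_of_pos hγ).ne', one_smul]

end

end Subdiffusion

namespace Subdiffusion

/-! ### Hankel contours -/

theorem rect_integral_eq_zero {f : ℂ → ℂ} {x₀ x₁ y₀ y₁ : ℝ} (hx : x₀ ≤ x₁) (hy : y₀ ≤ y₁)
    (hf : ∀ s : ℂ, x₀ ≤ s.re → s.re ≤ x₁ → y₀ ≤ s.im → s.im ≤ y₁ → DifferentiableAt ℂ f s) :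
    (∫ x : ℝ in x₀..x₁, f (x + y₀ * Complex.I)) - (∫ x : ℝ in x₀..x₁, f (x + y₁ * Complex.I)) +
      Complex.I * (∫ y : ℝ in y₀..y₁, f (x₁ + y * Complex.I)) -
      Complex.I * (∫ y : ℝ in y₀..y₁, f (x₀ + y * Complex.I)) = 0 := by
  have h := Complex.integral_boundary_rect_eq_zero_of_differentiableOn f ⟨x₀, y₀⟩ ⟨x₁, y₁⟩ ?_
  · simpa only [smul_eq_mul] using h
  · intro s hs
    rw [Set.uIcc_of_le hx, Set.uIcc_of_le hy, Complex.mem_reProdIm] at hs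
    exact (hf s hs.1.1 hs.1.2 hs.2.1 hs.2.2).differentiableWithinAt

/-- The integral along the contour that runs from `-∞ - ia` to `a - ia`, to `a + ia` and to
`-∞ + ia`. -/
noncomputable def hankel (a : ℝ) (f : ℂ → ℂ) : ℂ :=
  Complex.I * (∫ y : ℝ in (-a)..a, f (a + y * Complex.I)) +
    ∫ x : ℝ in Set.Iic a, (f (x + ((-a : ℝ) : ℂ) * Complex.I) - f (x + (a : ℂ) * Complex.I))

theorem ofReal_add_mul_I_re (x y : ℝ) : ((x : ℂ) + y * Complex.I).re = x := by simp

theorem ofReal_add_mul_I_im (x y : ℝ) : ((x : ℂ) + y * Complex.I).im = y := by simp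

theorem abs_le_norm_ofReal_add_mul_I (x y : ℝ) : |y| ≤ ‖(x : ℂ) + y * Complex.I‖ := by
  simpa using Complex.abs_im_le_norm ((x : ℂ) + y * Complex.I)

theorem abs_le_norm_ofReal_add_mul_I' (x y : ℝ) : |x| ≤ ‖(x : ℂ) + y * Complex.I‖ := by
  simpa using Complex.abs_re_le_norm ((x : ℂ) + y * Complex.I)

theorem mem_slitPlane_of_im {x y : ℝ} (hy : y ≠ 0) : (x : ℂ) + y * Complex.I ∈ Complex.slitPlane :=
  Or.inr (by simpa using hy)

theorem mem_slitPlane_of_re {x y : ℝ} (hx : 0 < x) : (x : ℂ) + y * Complex.I ∈ Complex.slitPlane :=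
  Or.inl (by simpa using hx)

theorem norm_cexp_mul_ofReal (s : ℂ) (t : ℝ) : ‖Complex.exp (s * t)‖ = Real.exp (s.re * t) := by
  rw [Complex.norm_exp]; simp

theorem integrableOn_horizontal {g : ℂ → ℂ} (hg : ContinuousOn g Complex.slitPlane) {a b K t : ℝ}
    (hb : b ≠ 0) (hK : ∀ x : ℝ, ‖g (x + b * Complex.I)‖ ≤ K) (ht : 0 < t) :
    IntegrableOn (fun x : ℝ => g (x + b * Complex.I) * Complex.exp ((x + b * Complex.I) * t))
      (Set.Iic a) := by
  have hcont : Continuous (fun x : ℝ => g (x + b * Complex.I)) :=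
    hg.comp_continuous (by fun_prop) (fun x => mem_slitPlane_of_im hb)
  refine ((integrableOn_exp_mul_Iic ht a).const_mul K).mono' ?_ (Eventually.of_forall fun x => ?_)
  · exact (hcont.mul (by fun_prop)).aestronglyMeasurable
  · rw [norm_mul, norm_cexp_mul_ofReal, ofReal_add_mul_I_re, mul_comm x t]
    gcongr
    exact hK x

theorem hankel_congr {a : ℝ} (ha : 0 < a) {f h : ℂ → ℂ}
    (hfh : ∀ s ∈ Complex.slitPlane, f s = h s) : hankel a f = hankel a h := by
  unfold hankel
  congr 2
  · apply intervalIntegral.integral_congr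
    intro y _
    exact hfh _ (mem_slitPlane_of_re ha)
  · funext x
    rw [hfh _ (mem_slitPlane_of_im (neg_ne_zero.mpr ha.ne')), hfh _ (mem_slitPlane_of_im ha.ne')]

/-- The integrability needed for the additivity of `hankel`. -/
def HankelIntegrable (a : ℝ) (f : ℂ → ℂ) : Prop :=
  IntervalIntegrable (fun y : ℝ => f (a + y * Complex.I)) volume (-a) a ∧
    IntegrableOn (fun x : ℝ => f (x + ((-a : ℝ) : ℂ) * Complex.I)) (Set.Iic a) ∧
    IntegrableOn (fun x : ℝ => f (x + (a : ℂ) * Complex.I)) (Set.Iic a)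

theorem hankel_add_const_mul {a : ℝ} {f h : ℂ → ℂ} (hf : HankelIntegrable a f)
    (hh : HankelIntegrable a h) (c d : ℂ) :
    hankel a (fun s => c * f s + d * h s) = c * hankel a f + d * hankel a h := by
  unfold hankel
  rw [intervalIntegral.integral_add (hf.1.const_mul c) (hh.1.const_mul d),
    intervalIntegral.integral_const_mul, intervalIntegral.integral_const_mul]
  have h1 : (∫ x in Set.Iic a, (c * f (x + ((-a : ℝ) : ℂ) * Complex.I) +
      d * h (x + ((-a : ℝ) : ℂ) * Complex.I) -
      (c * f (x + (a : ℂ) * Complex.I) + d * h (x + (a : ℂ) * Complex.I)))) =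
      c * (∫ x in Set.Iic a, (f (x + ((-a : ℝ) : ℂ) * Complex.I) - f (x + (a : ℂ) * Complex.I))) +
      d * (∫ x in Set.Iic a, (h (x + ((-a : ℝ) : ℂ) * Complex.I) -
        h (x + (a : ℂ) * Complex.I))) := by
    rw [← integral_const_mul, ← integral_const_mul, ← integral_add]
    · congr 1
      funext x
      ring
    · exact (hf.2.1.sub hf.2.2).const_mul c
    · exact (hh.2.1.sub hh.2.2).const_mul d
  rw [h1]
  ring

theorem hankelIntegrable_mul_exp {g : ℂ → ℂ} (hg : ContinuousOn g Complex.slitPlane) {a K t : ℝ}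
    (ha : 0 < a) (hK : ∀ s ∈ Complex.slitPlane, a ≤ ‖s‖ → ‖g s‖ ≤ K) (ht : 0 < t) :
    HankelIntegrable a (fun s => g s * Complex.exp (s * t)) := by
  refine ⟨?_, ?_, ?_⟩
  · apply Continuous.intervalIntegrable
    apply Continuous.mul _ (by fun_prop)
    exact hg.comp_continuous (by fun_prop) (fun y => mem_slitPlane_of_re ha)
  · refine integrableOn_horizontal hg (neg_ne_zero.mpr ha.ne') (fun x => hK _ ?_ ?_) ht
    · exact mem_slitPlane_of_im (neg_ne_zero.mpr ha.ne')
    · have := abs_le_norm_ofReal_add_mul_I x (-a)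
      rwa [abs_neg, abs_of_pos ha] at this
  · refine integrableOn_horizontal hg ha.ne' (fun x => hK _ ?_ ?_) ht
    · exact mem_slitPlane_of_im ha.ne'
    · have := abs_le_norm_ofReal_add_mul_I x a
      rwa [abs_of_pos ha] at this

/-- Deformation of a vertical line into a Hankel contour. -/
theorem integral_vertical_eq_hankel {g : ℂ → ℂ} (hg : DifferentiableOn ℂ g Complex.slitPlane)
    {a σ η C t : ℝ} (ha : 0 < a) (haσ : a ≤ σ) (hη : 1 < η) (ht : 0 < t)
    (hC : ∀ s ∈ Complex.slitPlane, a ≤ ‖s‖ → ‖g s‖ ≤ C * ‖s‖ ^ (-η)) :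
    Complex.I * ∫ y : ℝ, g (σ + y * Complex.I) * Complex.exp ((σ + y * Complex.I) * t) =
      hankel a (fun s => g s * Complex.exp (s * t)) := by
  set f : ℂ → ℂ := fun s => g s * Complex.exp (s * t) with hf
  have hσ : 0 < σ := ha.trans_le haσ
  have hC0 : 0 ≤ C := by
    have h := hC (a : ℂ) (by simpa using ha) (by simp [abs_of_pos ha])
    have h1 := (norm_nonneg _).trans h
    have h2 : 0 < ‖(a : ℂ)‖ ^ (-η) := by
      apply Real.rpow_pos_of_pos
      simpa using ha.ne'
    exact nonneg_of_mul_nonneg_left h1 h2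
  have hfd : ∀ s ∈ Complex.slitPlane, DifferentiableAt ℂ f s := by
    intro s hs
    exact (hg.differentiableAt (Complex.isOpen_slitPlane.mem_nhds hs)).mul (by fun_prop)
  have hfb : ∀ Y : ℝ, a ≤ Y → ∀ s ∈ Complex.slitPlane, s.re ≤ σ → Y ≤ ‖s‖ →
      ‖f s‖ ≤ C * Y ^ (-η) * Real.exp (σ * t) := by
    intro Y hY s hs hre hn
    have hY0 : 0 < Y := ha.trans_le hY
    simp only [hf]
    rw [norm_mul, norm_cexp_mul_ofReal]
    have h1 : ‖s‖ ^ (-η) ≤ Y ^ (-η) := Real.rpow_le_rpow_of_nonpos hY0 hn (by linarith)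
    have h2 := hC s hs (hY.trans hn)
    have h3 : C * ‖s‖ ^ (-η) ≤ C * Y ^ (-η) := by gcongr
    have h4 := h2.trans h3
    gcongr
  have hvert : Integrable (fun y : ℝ => f (σ + y * Complex.I)) := by
    refine (((integrable_cpow_vertical hη hσ).norm.const_mul (C * Real.exp (σ * t)))).mono' ?_
      (Eventually.of_forall fun y => ?_)
    · apply Continuous.aestronglyMeasurable
      apply Continuous.mul _ (by fun_prop)
      exact hg.continuousOn.comp_continuous (by fun_prop) (fun y => mem_slitPlane_of_re hσ)
    · simp only [hf]
      rw [norm_mul, norm_cexp_mul_ofReal, ofReal_add_mul_I_re, Complex.norm_cpow_real]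
      have h1 := abs_le_norm_ofReal_add_mul_I' σ y
      rw [abs_of_pos hσ] at h1
      have h2 := hC _ (mem_slitPlane_of_re (y := y) hσ) (haσ.trans h1)
      calc _ ≤ C * ‖(σ : ℂ) + y * Complex.I‖ ^ (-η) * Real.exp (σ * t) := by gcongr
        _ = _ := by ring
  have hH : HankelIntegrable a f := by
    apply hankelIntegrable_mul_exp hg.continuousOn ha (K := C * a ^ (-η)) _ ht
    intro s hs hn
    refine (hC s hs hn).trans ?_
    have : ‖s‖ ^ (-η) ≤ a ^ (-η) := Real.rpow_le_rpow_of_nonpos ha hn (by linarith)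
    gcongr
  have hT1 : Tendsto (fun Y : ℝ => Complex.I * ∫ y in (-Y)..Y, f (σ + y * Complex.I)) atTop
      (𝓝 (Complex.I * ∫ y : ℝ, f (σ + y * Complex.I))) :=
    (intervalIntegral_tendsto_integral hvert tendsto_neg_atTop_atBot tendsto_id).const_mul _
  have hT2 : Tendsto (fun Y : ℝ => Complex.I * (∫ y in (-a)..a, f (a + y * Complex.I)) +
      ∫ x in (-Y)..a, (f (x + ((-a : ℝ) : ℂ) * Complex.I) - f (x + (a : ℂ) * Complex.I))) atTop
      (𝓝 (hankel a f)) :=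
    (intervalIntegral_tendsto_integral_Iic a (hH.2.1.sub hH.2.2)
      tendsto_neg_atTop_atBot).const_add _
  have hdiff : ∀ Y : ℝ, σ ≤ Y →
      ‖(Complex.I * ∫ y in (-Y)..Y, f (σ + y * Complex.I)) -
        (Complex.I * (∫ y in (-a)..a, f (a + y * Complex.I)) +
      ∫ x in (-Y)..a, (f (x + ((-a : ℝ) : ℂ) * Complex.I) - f (x + (a : ℂ) * Complex.I)))‖ ≤
        12 * C * Real.exp (σ * t) * Y ^ (1 - η) := by
    intro Y hY
    have haY : a ≤ Y := haσ.trans hY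
    have hY0 : 0 < Y := ha.trans_le haY
    -- Three rectangles fill the box [-Y, σ] × [-Y, Y] outside [-Y, a] × [-a, a], which contains the
    -- cut. After cancellation six outer edges remain, each contributing at most M · 2Y =
    -- O(Y^(1-η)); hence the factor 12.
    have R1 := rect_integral_eq_zero (f := f) (x₀ := a) (x₁ := σ) (y₀ := -Y) (y₁ := Y) haσ
      (by linarith) (fun s h1 _ _ _ => hfd s (Or.inl (by linarith)))
    have R2 := rect_integral_eq_zero (f := f) (x₀ := -Y) (x₁ := a) (y₀ := a) (y₁ := Y)
      (by linarith) haY (fun s _ _ h1 _ => hfd s (Or.inr (by linarith [ha])))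
    have R3 := rect_integral_eq_zero (f := f) (x₀ := -Y) (x₁ := a) (y₀ := -Y) (y₁ := -a)
      (by linarith) (by linarith) (fun s _ _ _ h1 => hfd s (Or.inr (by linarith [ha])))
    have hva : Continuous (fun y : ℝ => f (a + y * Complex.I)) := by
      apply Continuous.mul _ (by fun_prop)
      exact hg.continuousOn.comp_continuous (by fun_prop) (fun y => mem_slitPlane_of_re ha)
    have hsplit : (∫ y in (-Y)..Y, f (a + y * Complex.I)) =
        (∫ y in (-Y)..(-a), f (a + y * Complex.I)) + (∫ y in (-a)..a, f (a + y * Complex.I)) +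
          ∫ y in a..Y, f (a + y * Complex.I) := by
      rw [intervalIntegral.integral_add_adjacent_intervals (hva.intervalIntegrable _ _)
        (hva.intervalIntegrable _ _), intervalIntegral.integral_add_adjacent_intervals
        (hva.intervalIntegrable _ _) (hva.intervalIntegrable _ _)]
    have hsub : (∫ x in (-Y)..a, (f (x + ((-a : ℝ) : ℂ) * Complex.I) -
        f (x + (a : ℂ) * Complex.I))) = (∫ x in (-Y)..a, f (x + ((-a : ℝ) : ℂ) * Complex.I)) -
          ∫ x in (-Y)..a, f (x + (a : ℂ) * Complex.I) := by
      apply intervalIntegral.integral_sub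
      · exact (intervalIntegrable_iff_integrableOn_Ioc_of_le (by linarith)).mpr
          (hH.2.1.mono_set Set.Ioc_subset_Iic_self)
      · exact (intervalIntegrable_iff_integrableOn_Ioc_of_le (by linarith)).mpr
          (hH.2.2.mono_set Set.Ioc_subset_Iic_self)
    set M : ℝ := C * Y ^ (-η) * Real.exp (σ * t) with hM
    have hM0 : 0 ≤ M := by positivity
    have hhor : ∀ p q b : ℝ, |b| = Y → p ≤ q → q ≤ σ → -Y ≤ p →
        ‖∫ x in p..q, f (x + b * Complex.I)‖ ≤ M * (2 * Y) := by
      intro p q b hb hpq hqσ hYp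
      refine (intervalIntegral.norm_integral_le_of_norm_le_const fun x hx => ?_).trans
        (b := M * |q - p|) ?_
      · rw [Set.uIoc_of_le hpq] at hx
        apply hfb Y haY _ (mem_slitPlane_of_im fun h0 => by
          rw [h0, abs_zero] at hb; linarith)
        · rw [ofReal_add_mul_I_re]; linarith [hx.2]
        · rw [← hb]; exact abs_le_norm_ofReal_add_mul_I x b
      · rw [abs_of_nonneg (by linarith)]
        gcongr
        linarith
    have hver : ∀ p q : ℝ, p ≤ q → q ≤ Y → -Y ≤ p → (0 < p ∨ q < 0) →
        ‖∫ y in p..q, f (((-Y : ℝ) : ℂ) + y * Complex.I)‖ ≤ M * (2 * Y) := by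
      intro p q hpq hqY hYp hpq0
      refine (intervalIntegral.norm_integral_le_of_norm_le_const fun y hy => ?_).trans
        (b := M * |q - p|) ?_
      · rw [Set.uIoc_of_le hpq] at hy
        apply hfb Y haY _ (mem_slitPlane_of_im fun h0 => by
          rcases hpq0 with h | h <;> linarith [hy.1, hy.2])
        · rw [ofReal_add_mul_I_re]; linarith
        · have := abs_le_norm_ofReal_add_mul_I' (-Y) y
          rwa [abs_neg, abs_of_pos hY0] at this
      · rw [abs_of_nonneg (by linarith)]
        gcongr
        linarith
    have e1 := hhor a σ (-Y) (by rw [abs_neg, abs_of_pos hY0]) haσ le_rfl (by linarith)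
    have e2 := hhor a σ Y (abs_of_pos hY0) haσ le_rfl (by linarith)
    have e3 := hhor (-Y) a Y (abs_of_pos hY0) (by linarith) haσ le_rfl
    have e4 := hhor (-Y) a (-Y) (by rw [abs_neg, abs_of_pos hY0]) (by linarith) haσ le_rfl
    have e5 := hver a Y haY le_rfl (by linarith) (Or.inl ha)
    have e6 := hver (-Y) (-a) (by linarith) (by linarith) le_rfl (Or.inr (by linarith))
    rw [hsub]
    rw [hsplit] at R1
    have hMY : M * (2 * Y) = 2 * C * Real.exp (σ * t) * Y ^ (1 - η) := by
      rw [hM, sub_eq_add_neg, Real.rpow_add hY0, Real.rpow_one]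
      ring
    rw [hMY] at e1 e2 e3 e4 e5 e6
    generalize (∫ x in a..σ, f (x + ((-Y : ℝ) : ℂ) * Complex.I)) = E1 at *
    generalize (∫ x in a..σ, f (x + (Y : ℂ) * Complex.I)) = E2 at *
    generalize (∫ x in (-Y)..a, f (x + (Y : ℂ) * Complex.I)) = E3 at *
    generalize (∫ x in (-Y)..a, f (x + ((-Y : ℝ) : ℂ) * Complex.I)) = E4 at *
    generalize (∫ y in a..Y, f (((-Y : ℝ) : ℂ) + y * Complex.I)) = E5 at *
    generalize (∫ y in (-Y)..(-a), f (((-Y : ℝ) : ℂ) + y * Complex.I)) = E6 at *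
    calc _ = ‖-E1 + E2 + E3 - E4 + Complex.I * E5 + Complex.I * E6‖ := by
          congr 1
          linear_combination R1 + R2 + R3
      _ ≤ ‖E1‖ + ‖E2‖ + ‖E3‖ + ‖E4‖ + ‖E5‖ + ‖E6‖ := by
          refine (norm_add_le _ _).trans (add_le_add ((norm_add_le _ _).trans (add_le_add
            ((norm_sub_le _ _).trans (add_le_add ((norm_add_le _ _).trans (add_le_add
              ((norm_add_le _ _).trans (add_le_add ?_ le_rfl)) le_rfl)) le_rfl)) ?_)) ?_)
          · rw [norm_neg]
          · rw [norm_mul, Complex.norm_I, one_mul]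
          · rw [norm_mul, Complex.norm_I, one_mul]
      _ ≤ _ := by linarith
  have hzero : Tendsto (fun Y : ℝ => 12 * C * Real.exp (σ * t) * Y ^ (1 - η)) atTop (𝓝 0) := by
    have h := (tendsto_rpow_neg_atTop (by linarith : 0 < η - 1)).const_mul
      (12 * C * Real.exp (σ * t))
    rw [mul_zero] at h
    simpa only [neg_sub] using h
  have hlim := hT1.sub hT2
  have hlim0 := squeeze_zero_norm' ((eventually_ge_atTop σ).mono hdiff) hzero
  exact sub_eq_zero.mp (tendsto_nhds_unique hlim hlim0)

end Subdiffusion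

namespace Subdiffusion

/-! ### Contour representation of the Mittag-Leffler kernels -/

/-- The Laplace transform of `mlKernel α β · (-x)`. -/
noncomputable def mlSymbol (α β x : ℝ) (s : ℂ) : ℂ :=
  s ^ ((α - β : ℝ) : ℂ) / (s ^ (α : ℂ) + x)

/-- Fundamental theorem of calculus along the contour: the corner values cancel and the primitive
vanishes at both ends. -/
theorem hankel_eq_zero_of_hasDerivAt {a : ℝ} (ha : 0 < a) {F F' : ℂ → ℂ}
    (hF : ∀ s ∈ Complex.slitPlane, HasDerivAt F (F' s) s) (hF' : HankelIntegrable a F')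
    (h1 : Tendsto (fun x : ℝ => F (x + ((-a : ℝ) : ℂ) * Complex.I)) atBot (𝓝 0))
    (h2 : Tendsto (fun x : ℝ => F (x + (a : ℂ) * Complex.I)) atBot (𝓝 0)) :
    hankel a F' = 0 := by
  have hh : ∀ b x : ℝ, b ≠ 0 →
      HasDerivAt (fun x : ℝ => F (x + (b : ℂ) * Complex.I)) (F' (x + (b : ℂ) * Complex.I)) x := by
    intro b x hb
    have h3 : HasDerivAt (fun x : ℝ => (x : ℂ) + b * Complex.I) 1 x :=
      ((hasDerivAt_id x).ofReal_comp.add_const _).congr_deriv (by simp)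
    exact ((hF _ (mem_slitPlane_of_im (x := x) hb)).scomp x h3).congr_deriv (by simp)
  have e1 : Complex.I * (∫ y : ℝ in (-a)..a, F' (a + y * Complex.I)) =
      F (a + (a : ℂ) * Complex.I) - F (a + ((-a : ℝ) : ℂ) * Complex.I) := by
    rw [← intervalIntegral.integral_const_mul]
    apply intervalIntegral.integral_eq_sub_of_hasDerivAt
      (f := fun y : ℝ => F (a + y * Complex.I))
    · intro y _
      have h := hF _ (mem_slitPlane_of_re (y := y) ha)
      have h3 : HasDerivAt (fun y : ℝ => (a : ℂ) + y * Complex.I) Complex.I y := by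
        simpa using (((hasDerivAt_id y).ofReal_comp.mul_const Complex.I).const_add (a : ℂ))
      exact (h.scomp y h3).congr_deriv (by simp)
    · exact hF'.1.const_mul _
  unfold hankel
  rw [e1, integral_sub hF'.2.1 hF'.2.2,
    integral_Iic_of_hasDerivAt_of_tendsto' (fun x _ => hh _ x (neg_ne_zero.mpr ha.ne')) hF'.2.1 h1,
    integral_Iic_of_hasDerivAt_of_tendsto' (fun x _ => hh _ x ha.ne') hF'.2.2 h2]
  ring

theorem differentiableOn_cpow_slitPlane (c : ℂ) :
    DifferentiableOn ℂ (fun s : ℂ => s ^ c) Complex.slitPlane := fun s hs =>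
  ((hasDerivAt_id s).cpow_const hs).differentiableAt.differentiableWithinAt

theorem norm_cpow_neg_le {β a : ℝ} (hβ : 0 ≤ β) (ha : 0 < a) {s : ℂ} (hs : a ≤ ‖s‖) :
    ‖s ^ ((-β : ℝ) : ℂ)‖ ≤ a ^ (-β) := by
  rw [Complex.norm_cpow_real]
  exact Real.rpow_le_rpow_of_nonpos ha hs (by linarith)

theorem tendsto_cpow_mul_exp_horizontal {β b t : ℝ} (hβ : 0 ≤ β) (hb : b ≠ 0) (ht : 0 < t) :
    Tendsto (fun x : ℝ => ((x : ℂ) + b * Complex.I) ^ ((-β : ℝ) : ℂ) *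
      Complex.exp ((x + b * Complex.I) * t)) atBot (𝓝 0) := by
  have h1 : Tendsto (fun x : ℝ => |b| ^ (-β) * Real.exp (x * t)) atBot (𝓝 0) := by
    have := (Real.tendsto_exp_atBot.comp (tendsto_id.atBot_mul_const ht)).const_mul (|b| ^ (-β))
    simpa using this
  refine squeeze_zero_norm (fun x => ?_) h1
  rw [norm_mul, norm_cexp_mul_ofReal, ofReal_add_mul_I_re]
  gcongr
  exact norm_cpow_neg_le hβ (abs_pos.mpr hb) (abs_le_norm_ofReal_add_mul_I x b)

theorem hankelIntegrable_cpow_mul_exp {β a t : ℝ} (hβ : 0 ≤ β) (ha : 0 < a) (ht : 0 < t) :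
    HankelIntegrable a (fun s => s ^ ((-β : ℝ) : ℂ) * Complex.exp (s * t)) :=
  hankelIntegrable_mul_exp (differentiableOn_cpow_slitPlane _).continuousOn ha
    (fun _ _ hs => norm_cpow_neg_le hβ ha hs) ht

/-- Hankel's formula for the reciprocal Gamma function. -/
theorem hankel_cpow_mul_exp {β a t : ℝ} (hβ : 0 < β) (ha : 0 < a) (ht : 0 < t) :
    hankel a (fun s => s ^ ((-β : ℝ) : ℂ) * Complex.exp (s * t)) =
      2 * Real.pi * Complex.I * ((t ^ (β - 1) / Real.Gamma β : ℝ) : ℂ) := by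
  have h1 : hankel a (fun s => s ^ ((-(β + 1) : ℝ) : ℂ) * Complex.exp (s * t)) =
      2 * Real.pi * Complex.I * ((t ^ β / Real.Gamma (β + 1) : ℝ) : ℂ) := by
    rw [← integral_vertical_eq_hankel (differentiableOn_cpow_slitPlane _) (η := β + 1) (C := 1)
      ha le_rfl (by linarith) ht, integral_cpow_mul_exp_vertical hβ ha ht]
    · ring
    · intro s _ _
      rw [Complex.norm_cpow_real, one_mul]
  -- Integration of the derivative of s^(-β) e^(st) links the exponent β to β + 1, for which the
  -- vertical line converges absolutely.
  have h2 : hankel a (fun s => (-β : ℂ) * (s ^ ((-(β + 1) : ℝ) : ℂ) * Complex.exp (s * t)) +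
      (t : ℂ) * (s ^ ((-β : ℝ) : ℂ) * Complex.exp (s * t))) = 0 := by
    apply hankel_eq_zero_of_hasDerivAt ha
      (F := fun s => s ^ ((-β : ℝ) : ℂ) * Complex.exp (s * t))
    · intro s hs
      have h3 := (((hasDerivAt_id s).cpow_const (c := ((-β : ℝ) : ℂ)) hs).mul
        (((hasDerivAt_id s).mul_const (t : ℂ)).cexp))
      refine h3.congr_deriv ?_
      have : ((-β : ℝ) : ℂ) - 1 = ((-(β + 1) : ℝ) : ℂ) := by push_cast; ring
      rw [this]
      simp only [id]
      push_cast
      ring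
    · have i1 := hankelIntegrable_cpow_mul_exp (β := β + 1) (by linarith) ha ht
      have i2 := hankelIntegrable_cpow_mul_exp hβ.le ha ht
      exact ⟨(i1.1.const_mul _).add (i2.1.const_mul _),
        (i1.2.1.const_mul _).add (i2.2.1.const_mul _),
        (i1.2.2.const_mul _).add (i2.2.2.const_mul _)⟩
    · exact tendsto_cpow_mul_exp_horizontal hβ.le (neg_ne_zero.mpr ha.ne') ht
    · exact tendsto_cpow_mul_exp_horizontal hβ.le ha.ne' ht
  rw [hankel_add_const_mul (hankelIntegrable_cpow_mul_exp (by linarith) ha ht)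
    (hankelIntegrable_cpow_mul_exp hβ.le ha ht), h1] at h2
  have ht0 : (t : ℂ) ≠ 0 := by exact_mod_cast ht.ne'
  apply mul_left_cancel₀ ht0
  have h5 : t * (t ^ (β - 1) / Real.Gamma β) = β * (t ^ β / Real.Gamma (β + 1)) := by
    rw [Real.Gamma_add_one hβ.ne', Real.rpow_sub_one ht.ne']
    have := (Real.Gamma_pos_of_pos hβ).ne'
    field_simp
  have h6 : (t : ℂ) * ((t ^ (β - 1) / Real.Gamma β : ℝ) : ℂ) =
      β * ((t ^ β / Real.Gamma (β + 1) : ℝ) : ℂ) := by exact_mod_cast h5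
  linear_combination h2 - (2 * Real.pi * Complex.I) * h6

theorem exists_norm_inv_cpow_add_le {α : ℝ} (hα0 : 0 < α) (hα1 : α < 1) : ∃ K : ℝ, 0 < K ∧
    ∀ x : ℝ, 0 ≤ x → ∀ s : ℂ, s ≠ 0 → ‖(s ^ (α : ℂ) + x)⁻¹‖ ≤ K * ‖s‖ ^ (-α) := by
  obtain ⟨c, hc, h⟩ := norm_cpow_add_ge hα0 hα1
  refine ⟨c⁻¹, inv_pos.mpr hc, fun x hx s hs => ?_⟩
  have hs' : 0 < ‖s‖ := norm_pos_iff.mpr hs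
  have hp : 0 < ‖s‖ ^ α := Real.rpow_pos_of_pos hs' _
  rw [norm_inv, Real.rpow_neg hs'.le, ← mul_inv]
  apply inv_anti₀ (by positivity)
  refine le_trans ?_ (h s x hx)
  gcongr
  linarith

theorem differentiableOn_mlSymbol {α : ℝ} (hα0 : 0 < α) (hα1 : α < 1) (β : ℝ) {x : ℝ}
    (hx : 0 ≤ x) : DifferentiableOn ℂ (mlSymbol α β x) Complex.slitPlane :=
  (differentiableOn_cpow_slitPlane _).div ((differentiableOn_cpow_slitPlane _).add_const _)
    (fun _ hs => cpow_add_ofReal_ne_zero hα0 hα1 hx (Complex.slitPlane_ne_zero hs))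

theorem exists_norm_mlSymbol_le {α : ℝ} (hα0 : 0 < α) (hα1 : α < 1) (β : ℝ) : ∃ K : ℝ, 0 < K ∧
    ∀ x : ℝ, 0 ≤ x → ∀ s : ℂ, s ≠ 0 → ‖mlSymbol α β x s‖ ≤ K * ‖s‖ ^ (-β) := by
  obtain ⟨K, hK, h⟩ := exists_norm_inv_cpow_add_le hα0 hα1
  refine ⟨K, hK, fun x hx s hs => ?_⟩
  have hs' : 0 < ‖s‖ := norm_pos_iff.mpr hs
  unfold mlSymbol
  rw [div_eq_mul_inv, norm_mul, Complex.norm_cpow_real]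
  calc _ ≤ ‖s‖ ^ (α - β) * (K * ‖s‖ ^ (-α)) := by gcongr; exact h x hx s hs
    _ = K * (‖s‖ ^ (α - β) * ‖s‖ ^ (-α)) := by ring
    _ = _ := by rw [← Real.rpow_add hs']; congr 2; ring

theorem hankelIntegrable_mlSymbol {α : ℝ} (hα0 : 0 < α) (hα1 : α < 1) {β x a t : ℝ} (hβ : 0 ≤ β)
    (hx : 0 ≤ x) (ha : 0 < a) (ht : 0 < t) :
    HankelIntegrable a (fun s => mlSymbol α β x s * Complex.exp (s * t)) := by
  obtain ⟨K, hK, h⟩ := exists_norm_mlSymbol_le hα0 hα1 β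
  refine hankelIntegrable_mul_exp (differentiableOn_mlSymbol hα0 hα1 β hx).continuousOn ha
    (K := K * a ^ (-β)) (fun s hs hn => (h x hx s (Complex.slitPlane_ne_zero hs)).trans ?_) ht
  have := Real.rpow_le_rpow_of_nonpos ha hn (by linarith : -β ≤ 0)
  gcongr

/-- The Laplace side of `mlKernel_eq_add`; it serves to raise β by α. -/
theorem cpow_neg_eq_mlSymbol_add {α : ℝ} (hα0 : 0 < α) (hα1 : α < 1) {β x : ℝ} (hx : 0 ≤ x)
    {s : ℂ} (hs : s ≠ 0) :
    mlSymbol α β x s = s ^ ((-β : ℝ) : ℂ) - x * mlSymbol α (β + α) x s := by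
  have h0 := cpow_add_ofReal_ne_zero hα0 hα1 hx hs
  have h1 : s ^ ((α - β : ℝ) : ℂ) = s ^ (α : ℂ) * s ^ ((-β : ℝ) : ℂ) := by
    rw [← Complex.cpow_add _ _ hs]; congr 1; push_cast; ring
  unfold mlSymbol
  rw [h1, show α - (β + α) = -β by ring]
  field_simp
  ring

/-- On a line with σ^α > x the symbol is a geometric series in -x s^(-α), and its terms invert to
those of the Mittag-Leffler series. -/
theorem integral_mlSymbol_vertical {α : ℝ} (hα0 : 0 < α) (hα1 : α < 1) {β x σ t : ℝ} (hβ : 1 < β)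
    (hx : 0 ≤ x) (hσ : 0 < σ) (hxσ : x < σ ^ α) (ht : 0 < t) :
    ∫ y : ℝ, mlSymbol α β x (σ + y * Complex.I) * Complex.exp ((σ + y * Complex.I) * t) =
      2 * Real.pi * mlKernel α β t (-(x : ℂ)) := by
  have hσα : 0 < σ ^ α := Real.rpow_pos_of_pos hσ _
  set F : ℕ → ℝ → ℂ := fun j y => (-(x : ℂ)) ^ j *
    (((σ : ℂ) + y * Complex.I) ^ ((-(α * j + β) : ℝ) : ℂ) *
      Complex.exp ((σ + y * Complex.I) * t)) with hF
  have hne : ∀ y : ℝ, (σ : ℂ) + y * Complex.I ≠ 0 := fun y =>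
    Complex.slitPlane_ne_zero (mem_slitPlane_of_re hσ)
  have hσn : ∀ y : ℝ, σ ≤ ‖(σ : ℂ) + y * Complex.I‖ := fun y => by
    have := abs_le_norm_ofReal_add_mul_I' σ y
    rwa [abs_of_pos hσ] at this
  have hcpow : ∀ (j : ℕ) (y : ℝ), (-(x : ℂ)) ^ j *
      ((σ : ℂ) + y * Complex.I) ^ ((-(α * j + β) : ℝ) : ℂ) =
      ((σ : ℂ) + y * Complex.I) ^ ((-β : ℝ) : ℂ) *
        (-(x : ℂ) * (((σ : ℂ) + y * Complex.I) ^ (α : ℂ))⁻¹) ^ j := by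
    intro j y
    rw [show ((-(α * j + β) : ℝ) : ℂ) = ((-β : ℝ) : ℂ) + (j : ℂ) * (-(α : ℂ)) by push_cast; ring,
      Complex.cpow_add _ _ (hne y), Complex.cpow_nat_mul, Complex.cpow_neg, mul_pow]
    ring
  have hr : ∀ y : ℝ, ‖-(x : ℂ) * (((σ : ℂ) + y * Complex.I) ^ (α : ℂ))⁻¹‖ ≤ x / σ ^ α := by
    intro y
    rw [norm_mul, norm_neg, norm_inv, Complex.norm_cpow_real, Complex.norm_real,
      Real.norm_of_nonneg hx, div_eq_mul_inv]
    have := Real.rpow_le_rpow hσ.le (hσn y) hα0.le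
    gcongr
  have hr0 : 0 ≤ x / σ ^ α := by positivity
  have hr1 : x / σ ^ α < 1 := (div_lt_one hσα).mpr hxσ
  have hint0 := integrable_cpow_vertical hβ hσ
  have hcont : ∀ c : ℝ, Continuous fun y : ℝ => ((σ : ℂ) + y * Complex.I) ^ (c : ℂ) := fun c =>
    (differentiableOn_cpow_slitPlane (c : ℂ)).continuousOn.comp_continuous (by fun_prop)
      (fun y => mem_slitPlane_of_re hσ)
  have hbound : ∀ j y, ‖F j y‖ ≤ (x / σ ^ α) ^ j *
      (Real.exp (σ * t) * ‖((σ : ℂ) + y * Complex.I) ^ ((-β : ℝ) : ℂ)‖) := by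
    intro j y
    simp only [hF]
    rw [← mul_assoc, hcpow, norm_mul, norm_mul, norm_cexp_mul_ofReal, ofReal_add_mul_I_re,
      norm_pow]
    have := pow_le_pow_left₀ (norm_nonneg _) (hr y) j
    calc _ ≤ ‖((σ : ℂ) + y * Complex.I) ^ ((-β : ℝ) : ℂ)‖ * (x / σ ^ α) ^ j *
          Real.exp (σ * t) := by gcongr
      _ = _ := by ring
  have hFint : ∀ j, Integrable (F j) := fun j =>
    (((hint0.norm.const_mul (Real.exp (σ * t))).const_mul ((x / σ ^ α) ^ j)).mono'
      ((continuous_const.mul ((hcont _).mul (by fun_prop))).aestronglyMeasurable)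
      (Eventually.of_forall (hbound j)))
  have hsum : Summable fun j => ∫ y, ‖F j y‖ := by
    refine Summable.of_nonneg_of_le (fun j => integral_nonneg fun y => norm_nonneg _)
      (fun j => integral_mono (hFint j).norm
        ((hint0.norm.const_mul (Real.exp (σ * t))).const_mul ((x / σ ^ α) ^ j)) (hbound j)) ?_
    simp only [integral_const_mul]
    exact (summable_geometric_of_lt_one hr0 hr1).mul_right _
  have hS := hasSum_integral_of_summable_integral_norm hFint hsum
  have hpt : ∀ y : ℝ, ∑' j, F j y =
      mlSymbol α β x (σ + y * Complex.I) * Complex.exp ((σ + y * Complex.I) * t) := by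
    intro y
    have h1 : ∀ j, F j y = (-(x : ℂ) * (((σ : ℂ) + y * Complex.I) ^ (α : ℂ))⁻¹) ^ j *
        (((σ : ℂ) + y * Complex.I) ^ ((-β : ℝ) : ℂ) *
          Complex.exp ((σ + y * Complex.I) * t)) := by
      intro j
      simp only [hF]
      rw [← mul_assoc, hcpow]
      ring
    simp only [h1]
    rw [tsum_mul_right, tsum_geometric_of_norm_lt_one ((hr y).trans_lt hr1)]
    unfold mlSymbol
    have h2 : ((σ : ℂ) + y * Complex.I) ^ ((α - β : ℝ) : ℂ) =
        ((σ : ℂ) + y * Complex.I) ^ (α : ℂ) * ((σ : ℂ) + y * Complex.I) ^ ((-β : ℝ) : ℂ) := by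
      rw [← Complex.cpow_add _ _ (hne y)]; congr 1; push_cast; ring
    have h3 := cpow_add_ofReal_ne_zero hα0 hα1 hx (hne y)
    have h4 : ((σ : ℂ) + y * Complex.I) ^ (α : ℂ) ≠ 0 := by
      rw [Ne, Complex.cpow_eq_zero_iff]; exact fun h => hne y h.1
    rw [h2]
    have h5 : 1 - -(x : ℂ) * (((σ : ℂ) + y * Complex.I) ^ (α : ℂ))⁻¹ =
        (((σ : ℂ) + y * Complex.I) ^ (α : ℂ) + x) * (((σ : ℂ) + y * Complex.I) ^ (α : ℂ))⁻¹ := by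
      field_simp
      ring
    rw [h5, mul_inv, inv_inv]
    ring
  simp only [hpt] at hS
  have hv : ∀ j, ∫ y, F j y = 2 * Real.pi *
      ((t ^ (α * j + β - 1) / Real.Gamma (α * j + β)) • (-(x : ℂ)) ^ j) := by
    intro j
    have hj : 0 ≤ α * j := by positivity
    simp only [hF]
    rw [integral_const_mul]
    have h := integral_cpow_mul_exp_vertical (γ := α * j + β - 1) (by linarith) hσ ht
    rw [show α * j + β - 1 + 1 = α * j + β by ring] at h
    rw [h, Complex.real_smul]
    ring
  simp only [hv] at hS
  exact hS.unique ((hasSum_mlKernel hα0 (by linarith) ht (-(x : ℂ))).mul_left _)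

theorem hankel_mlSymbol_of_one_lt {α : ℝ} (hα0 : 0 < α) (hα1 : α < 1) {β x a t : ℝ} (hβ : 1 < β)
    (hx : 0 ≤ x) (ha : 0 < a) (ht : 0 < t) :
    hankel a (fun s => mlSymbol α β x s * Complex.exp (s * t)) =
      2 * Real.pi * Complex.I * mlKernel α β t (-(x : ℂ)) := by
  obtain ⟨K, hK, h⟩ := exists_norm_mlSymbol_le hα0 hα1 β
  obtain ⟨σ, hσ1, hσ2⟩ := (((tendsto_rpow_atTop hα0).eventually_gt_atTop x).and
    (eventually_ge_atTop a)).exists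
  rw [← integral_vertical_eq_hankel (differentiableOn_mlSymbol hα0 hα1 β hx) ha hσ2 hβ ht
    (fun s hs _ => h x hx s (Complex.slitPlane_ne_zero hs)),
    integral_mlSymbol_vertical hα0 hα1 hβ hx (ha.trans_le hσ2) hσ1 ht]
  ring

/-- The Mittag-Leffler kernels as contour integrals. -/
theorem hankel_mlSymbol {α : ℝ} (hα0 : 0 < α) (hα1 : α < 1) {β x a t : ℝ} (hβ : 0 < β)
    (hx : 0 ≤ x) (ha : 0 < a) (ht : 0 < t) :
    hankel a (fun s => mlSymbol α β x s * Complex.exp (s * t)) =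
      2 * Real.pi * Complex.I * mlKernel α β t (-(x : ℂ)) := by
  -- The number of steps β ↦ β + α after which β exceeds 1 and the vertical line is available.
  obtain ⟨N, hN⟩ := exists_nat_gt (1 / α)
  have hN' : 1 < β + N * α := by
    rw [div_lt_iff₀ hα0] at hN
    linarith
  clear hN
  induction N generalizing β with
  | zero => exact hankel_mlSymbol_of_one_lt hα0 hα1 (by simpa using hN') hx ha ht
  | succ N ih =>
    have h1 := ih (β := β + α) (by linarith) (by push_cast at hN'; linarith)
    have h2 : hankel a (fun s => mlSymbol α β x s * Complex.exp (s * t)) =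
        hankel a (fun s => 1 * (s ^ ((-β : ℝ) : ℂ) * Complex.exp (s * t)) +
          (-(x : ℂ)) * (mlSymbol α (β + α) x s * Complex.exp (s * t))) := by
      apply hankel_congr ha
      intro s hs
      rw [cpow_neg_eq_mlSymbol_add hα0 hα1 hx (Complex.slitPlane_ne_zero hs)]
      ring
    rw [h2, hankel_add_const_mul (hankelIntegrable_cpow_mul_exp hβ.le ha ht)
      (hankelIntegrable_mlSymbol hα0 hα1 (by linarith) hx ha ht), h1,
      hankel_cpow_mul_exp hβ ha ht, mlKernel_eq_add hα0 hβ ht (-(x : ℂ)), Complex.real_smul]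
    ring

end Subdiffusion

namespace Subdiffusion

/-! ### Comparison of the discrete and the continuous contour integral -/

/-- On the contour |s| is comparable to a = 1/n up to the factor 1 + |u| with u = n Re s. Half of
the exponential absorbs the resulting power of 1 + |u|, and the other half remains for integration.
-/
theorem exists_rpow_mul_exp_le (ρ : ℝ) : ∃ K : ℝ, 0 < K ∧ ∀ a r u : ℝ, 0 < a → a ≤ r →
    r ≤ a * (1 + |u|) → u ≤ 1 → r ^ ρ * Real.exp u ≤ K * a ^ ρ * Real.exp (u / 2) := by
  set p : ℝ := |ρ| + 1 with hp
  have hρ0 := abs_nonneg ρ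
  have hp1 : 1 ≤ p := by linarith
  refine ⟨(2 * p) ^ p * Real.exp 1, by positivity, fun a r u ha har hr hu => ?_⟩
  have hu0 := abs_nonneg u
  set w : ℝ := r / a with hw
  have hw1 : 1 ≤ w := (one_le_div ha).mpr har
  have hw2 : w ≤ 1 + |u| := by rw [hw, div_le_iff₀ ha]; linarith
  have hrw : r = a * w := by rw [hw]; field_simp
  have h1 : w ^ ρ ≤ w ^ p := Real.rpow_le_rpow_of_exponent_le hw1 (by linarith [le_abs_self ρ])
  have h2 : 1 + |u| ≤ 2 * p * Real.exp (|u| / (2 * p)) := by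
    have h3 := Real.add_one_le_exp (|u| / (2 * p))
    have h4 : 2 * p * (|u| / (2 * p) + 1) = |u| + 2 * p := by field_simp
    nlinarith
  have h3 : w ^ p ≤ (2 * p) ^ p * Real.exp (|u| / 2) := by
    calc w ^ p ≤ (2 * p * Real.exp (|u| / (2 * p))) ^ p :=
          Real.rpow_le_rpow (by linarith) (hw2.trans h2) (by linarith)
      _ = _ := by
          rw [Real.mul_rpow (by linarith) (Real.exp_pos _).le, ← Real.exp_mul]
          congr 2
          field_simp
  have h5 : |u| / 2 + u ≤ 1 + u / 2 := by
    rcases abs_cases u with h | h <;> linarith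
  have h6 : Real.exp (|u| / 2) * Real.exp u ≤ Real.exp 1 * Real.exp (u / 2) := by
    rw [← Real.exp_add, ← Real.exp_add]
    exact Real.exp_le_exp.mpr h5
  have haρ : 0 < a ^ ρ := Real.rpow_pos_of_pos ha _
  rw [hrw, Real.mul_rpow ha.le (by linarith)]
  calc a ^ ρ * w ^ ρ * Real.exp u ≤ a ^ ρ * ((2 * p) ^ p * Real.exp (|u| / 2)) * Real.exp u := by
        gcongr; exact h1.trans h3
    _ = a ^ ρ * (2 * p) ^ p * (Real.exp (|u| / 2) * Real.exp u) := by ring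
    _ ≤ a ^ ρ * (2 * p) ^ p * (Real.exp 1 * Real.exp (u / 2)) := by gcongr
    _ = _ := by ring

theorem exists_exp_neg_mul_le {ε : ℝ} (hε : 0 < ε) (r : ℝ) : ∃ C : ℝ, 0 < C ∧ ∀ n : ℝ, 1 ≤ n →
    Real.exp (-ε * n) ≤ C * n ^ (-r) := by
  set p : ℝ := |r| + 1 with hp
  have hr0 := abs_nonneg r
  have hp0 : 0 < p := by linarith
  refine ⟨(p / ε) ^ p, by positivity, fun n hn => ?_⟩
  have hn0 : 0 < n := by linarith
  have h1 : n ≤ p / ε * Real.exp (ε * n / p) := by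
    have h2 := Real.add_one_le_exp (ε * n / p)
    have h3 : p / ε * (ε * n / p) = n := by field_simp
    have h4 : 0 < p / ε := by positivity
    nlinarith
  have h2 : n ^ r ≤ (p / ε) ^ p * Real.exp (ε * n) := by
    calc n ^ r ≤ n ^ p := Real.rpow_le_rpow_of_exponent_le hn (by linarith [le_abs_self r])
      _ ≤ (p / ε * Real.exp (ε * n / p)) ^ p := Real.rpow_le_rpow hn0.le h1 hp0.le
      _ = _ := by
          rw [Real.mul_rpow (by positivity) (Real.exp_pos _).le, ← Real.exp_mul]
          congr 2
          field_simp
  rw [Real.rpow_neg hn0.le, ← div_eq_mul_inv, le_div_iff₀ (Real.rpow_pos_of_pos hn0 _),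
    neg_mul, Real.exp_neg, inv_mul_le_iff₀ (Real.exp_pos _)]
  linarith

theorem rpow_le_add_rpow {ε M r : ℝ} (hε : 0 < ε) (h1 : ε ≤ r) (h2 : r ≤ M) (ρ : ℝ) :
    r ^ ρ ≤ ε ^ ρ + M ^ ρ := by
  have hr : 0 < r := by linarith
  have hM : 0 < M := by linarith
  rcases le_total 0 ρ with h | h
  · have := Real.rpow_le_rpow hr.le h2 h
    have := Real.rpow_pos_of_pos hε ρ
    linarith
  · have := Real.rpow_le_rpow_of_nonpos hε h1 h
    have := Real.rpow_pos_of_pos hM ρ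
    linarith

/-- Two rectangles push the parts of the segment above and below the Hankel contour to Re s = -ε.
What is left are differences of integrands near the origin and pieces with Re s ≤ -ε, which carry
e^(-εn). -/
theorem contour_decomposition {ε : ℝ} (hε0 : 0 < ε) {Y g : ℂ → ℂ} {n : ℕ} (hn : 1 ≤ n) {K η : ℝ}
    (hη : 0 ≤ η) (hK : 0 ≤ K)
    (hY : ∀ s ∈ contourRegion ε, DifferentiableAt ℂ Y s)
    (hper : ∀ s, Y (s + 2 * Real.pi * Complex.I) = Y s)
    (hg : ContinuousOn g Complex.slitPlane)
    (hgb : ∀ s ∈ Complex.slitPlane, ‖g s‖ ≤ K * ‖s‖ ^ (-η))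
    (f h : ℂ → ℂ) (hf : f = fun s => Y s * Complex.exp (s * (n : ℝ)))
    (hh : h = fun s => g s * Complex.exp (s * (n : ℝ))) (a : ℝ) (ha : a = (n : ℝ)⁻¹) :
    Complex.I * (∫ y in (-Real.pi)..Real.pi, f (a + y * Complex.I)) - hankel a h =
      Complex.I * (∫ y in (-a)..a, (f (a + y * Complex.I) - h (a + y * Complex.I))) +
      (∫ x in (-ε)..a, (f (x + ((-a : ℝ) : ℂ) * Complex.I) -
        h (x + ((-a : ℝ) : ℂ) * Complex.I))) -
      (∫ x in (-ε)..a, (f (x + (a : ℂ) * Complex.I) - h (x + (a : ℂ) * Complex.I))) +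
      Complex.I * (∫ y in a..Real.pi, f (((-ε : ℝ) : ℂ) + y * Complex.I)) +
      Complex.I * (∫ y in (-Real.pi)..(-a), f (((-ε : ℝ) : ℂ) + y * Complex.I)) -
      ∫ x in Set.Iic (-ε), (h (x + ((-a : ℝ) : ℂ) * Complex.I) - h (x + (a : ℂ) * Complex.I)) := by
  have hn1 : (1 : ℝ) ≤ n := by exact_mod_cast hn
  have ha0 : 0 < a := by rw [ha]; positivity
  have ha1 : a ≤ 1 := by rw [ha]; exact inv_le_one_of_one_le₀ hn1
  have hapi : a ≤ Real.pi := by linarith [Real.pi_gt_three]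
  have hmem : ∀ s : ℂ, -ε ≤ s.re → s.re ≤ a → |s.im| ≤ Real.pi → (s.im ≠ 0 ∨ 0 < s.re) →
      s ∈ contourRegion ε := fun s h1 h2 h3 h4 => ⟨h1, h2.trans ha1, h3, h4.symm⟩
  have hfd : ∀ s ∈ contourRegion ε, DifferentiableAt ℂ f s := by
    intro s hs
    rw [hf]
    exact (hY s hs).mul (by fun_prop)
  have hfper : ∀ s, f (s + 2 * Real.pi * Complex.I) = f s := by
    intro s
    simp only [hf]
    rw [hper]
    congr 1
    have : (s + 2 * Real.pi * Complex.I) * (n : ℝ) =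
        s * (n : ℝ) + n * (2 * Real.pi * Complex.I) := by push_cast; ring
    rw [this, Complex.exp_add, Complex.exp_nat_mul_two_pi_mul_I, mul_one]
  have R1 := rect_integral_eq_zero (f := f) (x₀ := -ε) (x₁ := a) (y₀ := a) (y₁ := Real.pi)
    (by linarith) hapi (fun s h1 h2 h3 h4 => hfd s (hmem s h1 h2
      (abs_le.mpr ⟨by linarith, h4⟩) (Or.inl (by linarith))))
  have R2 := rect_integral_eq_zero (f := f) (x₀ := -ε) (x₁ := a) (y₀ := -Real.pi) (y₁ := -a)
    (by linarith) (by linarith) (fun s h1 h2 h3 h4 => hfd s (hmem s h1 h2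
      (abs_le.mpr ⟨h3, by linarith⟩) (Or.inl (by linarith))))
  -- The edges at heights π and -π cancel: the symbol is 2πi-periodic and so is e^(ns), as n is an
  -- integer.
  have hedge : (∫ x : ℝ in (-ε)..a, f (x + ((-Real.pi : ℝ) : ℂ) * Complex.I)) =
      ∫ x : ℝ in (-ε)..a, f (x + (Real.pi : ℂ) * Complex.I) := by
    congr 1
    funext x
    rw [← hfper]
    congr 1
    push_cast
    ring
  have hfv : ∀ p q : ℝ, -Real.pi ≤ p → p ≤ q → q ≤ Real.pi →
      IntervalIntegrable (fun y : ℝ => f (a + y * Complex.I)) volume p q := by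
    intro p q hp hpq hq
    apply ContinuousOn.intervalIntegrable
    rw [Set.uIcc_of_le hpq]
    intro y hy
    have h1 : ContinuousAt f (a + y * Complex.I) := (hfd _ (hmem _
      (by rw [ofReal_add_mul_I_re]; linarith) (by rw [ofReal_add_mul_I_re])
      (by rw [ofReal_add_mul_I_im]; exact abs_le.mpr ⟨by linarith [hy.1], by linarith [hy.2]⟩)
      (Or.inr (by rw [ofReal_add_mul_I_re]; exact ha0)))).continuousAt
    exact (ContinuousAt.comp (f := fun y : ℝ => (a : ℂ) + y * Complex.I) h1
      (by fun_prop)).continuousWithinAt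
  have hfh : ∀ b : ℝ, |b| = a →
      IntervalIntegrable (fun x : ℝ => f (x + b * Complex.I)) volume (-ε) a := by
    intro b hb
    apply ContinuousOn.intervalIntegrable
    rw [Set.uIcc_of_le (by linarith)]
    intro x hx
    have h1 : ContinuousAt f (x + b * Complex.I) := (hfd _ (hmem _
      (by rw [ofReal_add_mul_I_re]; exact hx.1) (by rw [ofReal_add_mul_I_re]; exact hx.2)
      (by rw [ofReal_add_mul_I_im]; linarith)
      (Or.inl (by rw [ofReal_add_mul_I_im]; intro h0; rw [h0, abs_zero] at hb; linarith)))
      ).continuousAt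
    exact (ContinuousAt.comp (f := fun x : ℝ => (x : ℂ) + b * Complex.I) h1
      (by fun_prop)).continuousWithinAt
  have hH : HankelIntegrable a h := by
    rw [hh]
    refine hankelIntegrable_mul_exp hg ha0 (K := K * a ^ (-η)) (fun s hs hn => ?_) (by linarith)
    have := Real.rpow_le_rpow_of_nonpos ha0 hn (by linarith : -η ≤ 0)
    exact (hgb s hs).trans (by gcongr)
  have hHI : ∀ b : ℝ, IntegrableOn (fun x : ℝ => h (x + b * Complex.I)) (Set.Iic a) →
      IntervalIntegrable (fun x : ℝ => h (x + b * Complex.I)) volume (-ε) a := fun b hb =>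
    (intervalIntegrable_iff_integrableOn_Ioc_of_le (by linarith)).mpr
      (hb.mono_set Set.Ioc_subset_Iic_self)
  have hsplit : (∫ y in (-Real.pi)..Real.pi, f (a + y * Complex.I)) =
      (∫ y in (-Real.pi)..(-a), f (a + y * Complex.I)) + (∫ y in (-a)..a, f (a + y * Complex.I)) +
        ∫ y in a..Real.pi, f (a + y * Complex.I) := by
    rw [intervalIntegral.integral_add_adjacent_intervals (hfv _ _ le_rfl (by linarith)
      (by linarith)) (hfv _ _ (by linarith) (by linarith) (by linarith)),
      intervalIntegral.integral_add_adjacent_intervals (hfv _ _ le_rfl (by linarith)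
      (by linarith)) (hfv _ _ (by linarith) (by linarith) le_rfl)]
  have hHint := hH.2.1.sub hH.2.2
  have hIic := intervalIntegral.integral_Iic_sub_Iic
    (hHint.mono_set (Set.Iic_subset_Iic.mpr (by linarith : -ε ≤ a))) hHint
  simp only [Pi.sub_apply] at hIic
  rw [intervalIntegral.integral_sub (hHI _ hH.2.1) (hHI _ hH.2.2)] at hIic
  have hIic' : (∫ x : ℝ in Set.Iic a, (h (x + ((-a : ℝ) : ℂ) * Complex.I) -
      h (x + (a : ℂ) * Complex.I))) =
      (∫ x : ℝ in Set.Iic (-ε), (h (x + ((-a : ℝ) : ℂ) * Complex.I) -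
        h (x + (a : ℂ) * Complex.I))) + ((∫ x : ℝ in (-ε)..a, h (x + ((-a : ℝ) : ℂ) * Complex.I)) -
        ∫ x : ℝ in (-ε)..a, h (x + (a : ℂ) * Complex.I)) := by
    rw [← hIic]
    ring
  rw [intervalIntegral.integral_sub (hfv _ _ (by linarith) (by linarith) (by linarith)) hH.1,
    intervalIntegral.integral_sub (hfh _ (by rw [abs_neg, abs_of_pos ha0])) (hHI _ hH.2.1),
    intervalIntegral.integral_sub (hfh _ (abs_of_pos ha0)) (hHI _ hH.2.2), hsplit]
  unfold hankel
  rw [hIic']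
  rw [hedge] at R2
  linear_combination R1 + R2

/-- The constant depends neither on the symbols nor on `B` or n, so the bound is uniform in the
spectral parameter. A contour of scale a = 1/n turns |s|^ρ into a^ρ · a. -/
theorem exists_contour_comparison {ε : ℝ} (hε0 : 0 < ε) (hε1 : ε < 1) (ρ₁ ρ₂ : ℝ) {η : ℝ}
    (hη : 0 ≤ η) : ∃ C : ℝ, 0 < C ∧ ∀ (Y g : ℂ → ℂ) (B : ℝ) (n : ℕ), 0 ≤ B → 1 ≤ n →
    (∀ s ∈ contourRegion ε, DifferentiableAt ℂ Y s) →
    (∀ s, Y (s + 2 * Real.pi * Complex.I) = Y s) →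
    ContinuousOn g Complex.slitPlane →
    (∀ s ∈ Complex.slitPlane, ‖g s‖ ≤ B * ‖s‖ ^ (-η)) →
    (∀ s ∈ contourRegion ε, ‖Y s - g s‖ ≤ B * (‖s‖ ^ ρ₁ + ‖s‖ ^ ρ₂)) →
    ‖Complex.I * (∫ y in (-Real.pi)..Real.pi, Y ((((n : ℝ)⁻¹ : ℝ) : ℂ) + y * Complex.I) *
        Complex.exp (((((n : ℝ)⁻¹ : ℝ) : ℂ) + y * Complex.I) * (n : ℝ))) -
      hankel ((n : ℝ)⁻¹) (fun s => g s * Complex.exp (s * (n : ℝ)))‖ ≤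
      C * B * ((n : ℝ) ^ (-ρ₁ - 1) + (n : ℝ) ^ (-ρ₂ - 1)) := by
  obtain ⟨K₁, hK₁, hp1⟩ := exists_rpow_mul_exp_le ρ₁
  obtain ⟨K₂, hK₂, hp2⟩ := exists_rpow_mul_exp_le ρ₂
  obtain ⟨C₀, hC₀, hexp⟩ := exists_exp_neg_mul_le hε0 (ρ₁ + 1)
  set M : ℝ := ε ^ ρ₁ + 5 ^ ρ₁ + (ε ^ ρ₂ + 5 ^ ρ₂) + ε ^ (-η) with hM
  have hMpos : 0 < M := by positivity
  -- Three pieces near the origin contribute 2 e^(1/2) each; the two sides at Re s = -ε contribute 4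
  -- each and the tail 2.
  refine ⟨6 * Real.exp (1 / 2) * (K₁ + K₂) + 10 * M * C₀, by positivity, ?_⟩
  intro Y g B n hB hn hY hper hg hgb hD
  have hn1 : (1 : ℝ) ≤ n := by exact_mod_cast hn
  have hn0 : (0 : ℝ) < n := by linarith
  set f : ℂ → ℂ := fun s => Y s * Complex.exp (s * (n : ℝ)) with hf
  set h : ℂ → ℂ := fun s => g s * Complex.exp (s * (n : ℝ)) with hh
  obtain ⟨a, ha⟩ : ∃ a : ℝ, a = (n : ℝ)⁻¹ := ⟨_, rfl⟩
  have key := contour_decomposition hε0 hn hη hB hY hper hg hgb f h hf hh a ha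
  have e0 : (∫ y in (-Real.pi)..Real.pi, Y ((((n : ℝ)⁻¹ : ℝ) : ℂ) + y * Complex.I) *
        Complex.exp (((((n : ℝ)⁻¹ : ℝ) : ℂ) + y * Complex.I) * (n : ℝ))) =
      ∫ y in (-Real.pi)..Real.pi, f (a + y * Complex.I) := by rw [ha]
  rw [e0, ← ha, key]
  have ha0 : 0 < a := by rw [ha]; positivity
  have ha1 : a ≤ 1 := by rw [ha]; exact inv_le_one_of_one_le₀ hn1
  have han : a * n = 1 := by rw [ha]; field_simp
  have hapi : a ≤ Real.pi := by linarith [Real.pi_gt_three]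
  have hpow : ∀ ρ : ℝ, a ^ ρ * a = (n : ℝ) ^ (-ρ - 1) := by
    intro ρ
    rw [ha, Real.inv_rpow hn0.le, ← Real.rpow_neg hn0.le, Real.rpow_sub_one hn0.ne']
    rfl
  set A₁ : ℝ := (n : ℝ) ^ (-ρ₁ - 1) with hA₁
  set A₂ : ℝ := (n : ℝ) ^ (-ρ₂ - 1) with hA₂
  have hA₁0 : 0 < A₁ := Real.rpow_pos_of_pos hn0 _
  have hA₂0 : 0 < A₂ := Real.rpow_pos_of_pos hn0 _
  set L : ℝ := B * (K₁ * a ^ ρ₁ + K₂ * a ^ ρ₂) with hL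
  have hL0 : 0 ≤ L := by positivity
  have hLa : L * a ≤ B * (K₁ + K₂) * (A₁ + A₂) := by
    have : L * a = B * (K₁ * A₁ + K₂ * A₂) := by rw [hL, hA₁, hA₂, ← hpow, ← hpow]; ring
    rw [this]
    have : 0 ≤ B * (K₁ * A₂ + K₂ * A₁) := by positivity
    linarith
  have hDE : ∀ x y : ℝ, -ε ≤ x → x ≤ a → |y| ≤ a → (x = a ∨ |y| = a) →
      ‖f (x + y * Complex.I) - h (x + y * Complex.I)‖ ≤ L * Real.exp (n / 2 * x) := by
    intro x y h1 h2 h3 h4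
    have hxn : |x * n| = |x| * n := by rw [abs_mul, abs_of_pos hn0]
    have hlow : a ≤ ‖(x : ℂ) + y * Complex.I‖ := by
      rcases h4 with h4 | h4
      · have := abs_le_norm_ofReal_add_mul_I' x y
        rw [h4, abs_of_pos ha0] at this
        rwa [h4]
      · have := abs_le_norm_ofReal_add_mul_I x y
        rwa [h4] at this
    have hupp : ‖(x : ℂ) + y * Complex.I‖ ≤ a * (1 + |x * n|) := by
      have := Complex.norm_le_abs_re_add_abs_im ((x : ℂ) + y * Complex.I)
      rw [ofReal_add_mul_I_re, ofReal_add_mul_I_im] at this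
      rw [hxn, mul_add, mul_one, mul_left_comm, han, mul_one]
      linarith
    have hu : x * n ≤ 1 := by rw [← han]; gcongr
    have hmem : (x : ℂ) + y * Complex.I ∈ contourRegion ε := by
      refine ⟨by rw [ofReal_add_mul_I_re]; exact h1, by rw [ofReal_add_mul_I_re]; linarith,
        by rw [ofReal_add_mul_I_im]; linarith, ?_⟩
      rcases h4 with h4 | h4
      · exact mem_slitPlane_of_re (by linarith)
      · exact mem_slitPlane_of_im fun h0 => by rw [h0, abs_zero] at h4; linarith
    have hd := hD _ hmem
    have q1 := hp1 a _ (x * n) ha0 hlow hupp hu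
    have q2 := hp2 a _ (x * n) ha0 hlow hupp hu
    simp only [hf, hh]
    rw [← sub_mul, norm_mul, norm_cexp_mul_ofReal, ofReal_add_mul_I_re]
    calc _ ≤ B * (‖(x : ℂ) + y * Complex.I‖ ^ ρ₁ + ‖(x : ℂ) + y * Complex.I‖ ^ ρ₂) *
          Real.exp (x * n) := by gcongr
      _ = B * (‖(x : ℂ) + y * Complex.I‖ ^ ρ₁ * Real.exp (x * n) +
          ‖(x : ℂ) + y * Complex.I‖ ^ ρ₂ * Real.exp (x * n)) := by ring
      _ ≤ B * (K₁ * a ^ ρ₁ * Real.exp (x * n / 2) + K₂ * a ^ ρ₂ * Real.exp (x * n / 2)) := by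
          gcongr
      _ = _ := by rw [hL, show (n : ℝ) / 2 * x = x * n / 2 by ring]; ring
  have b1 : ‖∫ y in (-a)..a, (f (a + y * Complex.I) - h (a + y * Complex.I))‖ ≤
      2 * Real.exp (1 / 2) * (L * a) := by
    refine (intervalIntegral.norm_integral_le_of_norm_le_const
      (C := L * Real.exp (1 / 2)) fun y hy => ?_).trans (le_of_eq ?_)
    · rw [Set.uIoc_of_le (by linarith)] at hy
      have := hDE a y (by linarith) le_rfl (abs_le.mpr ⟨hy.1.le, hy.2⟩) (Or.inl rfl)
      rwa [show (n : ℝ) / 2 * a = 1 / 2 by linarith] at this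
    · rw [abs_of_nonneg (by linarith)]; ring
  have b2 : ∀ b : ℝ, |b| = a →
      ‖∫ x in (-ε)..a, (f (x + b * Complex.I) - h (x + b * Complex.I))‖ ≤
      2 * Real.exp (1 / 2) * (L * a) := by
    intro b hb
    refine (intervalIntegral.norm_integral_le_of_norm_le (by linarith)
      (g := fun x => L * Real.exp (n / 2 * x)) (Eventually.of_forall fun x hx => ?_)
      (Continuous.intervalIntegrable (by fun_prop) _ _)).trans ?_
    · exact hDE x b (by linarith [hx.1]) hx.2 hb.le (Or.inr hb)
    -- Integrating e^(nx/2) supplies the factor 2/n = 2a, although the length of the interval does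
    -- not shrink with n.
    · rw [intervalIntegral.integral_const_mul, intervalIntegral.integral_comp_mul_left
        (fun x => Real.exp x) (by positivity), integral_exp,
        show (n : ℝ) / 2 * a = 1 / 2 by linarith, smul_eq_mul,
        show ((n : ℝ) / 2)⁻¹ = 2 * a by rw [ha]; field_simp]
      have := Real.exp_pos ((n : ℝ) / 2 * -ε)
      calc _ ≤ L * (2 * a * Real.exp (1 / 2)) := by gcongr; linarith
        _ = _ := by ring
  -- The exponentially small pieces are hidden in the first of the two powers of n.
  have hEn : Real.exp (-ε * n) ≤ C₀ * A₁ := by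
    have := hexp n hn1
    rwa [show -(ρ₁ + 1) = -ρ₁ - 1 by ring] at this
  have hMη : ε ^ (-η) ≤ M := by
    rw [hM]
    have : 0 < ε ^ ρ₁ + 5 ^ ρ₁ + (ε ^ ρ₂ + 5 ^ ρ₂) := by positivity
    linarith
  have hgM : ∀ s ∈ Complex.slitPlane, ε ≤ ‖s‖ → ‖g s‖ ≤ B * M := fun s hs hsε =>
    (hgb s hs).trans (by
      have := Real.rpow_le_rpow_of_nonpos hε0 hsε (by linarith : -η ≤ 0)
      gcongr
      linarith)
  have b3 : ∀ p q : ℝ, p ≤ q → -Real.pi ≤ p → q ≤ Real.pi → (0 < p ∨ q < 0) →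
      ‖∫ y in p..q, f (((-ε : ℝ) : ℂ) + y * Complex.I)‖ ≤ 4 * B * M * (C₀ * A₁) := by
    intro p q hpq hp hq h0
    refine (intervalIntegral.norm_integral_le_of_norm_le_const
      (C := B * M * (C₀ * A₁)) fun y hy => ?_).trans ?_
    · rw [Set.uIoc_of_le hpq] at hy
      have hy0 : y ≠ 0 := fun h1 => by
        rcases h0 with h | h <;> linarith [hy.1, hy.2]
      have hmem : ((-ε : ℝ) : ℂ) + y * Complex.I ∈ contourRegion ε :=
        ⟨by rw [ofReal_add_mul_I_re], by rw [ofReal_add_mul_I_re]; linarith,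
          by rw [ofReal_add_mul_I_im]; exact abs_le.mpr ⟨by linarith [hy.1], by linarith [hy.2]⟩,
          mem_slitPlane_of_im hy0⟩
      have hnε : ε ≤ ‖((-ε : ℝ) : ℂ) + y * Complex.I‖ := by
        have := abs_le_norm_ofReal_add_mul_I' (-ε) y
        rwa [abs_neg, abs_of_pos hε0] at this
      have hn5 := norm_le_five_of_mem_contourRegion hε1 hmem
      have r1 := rpow_le_add_rpow hε0 hnε hn5 ρ₁
      have r2 := rpow_le_add_rpow hε0 hnε hn5 ρ₂
      have r3 := Real.rpow_le_rpow_of_nonpos hε0 hnε (by linarith : -η ≤ 0)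
      have r4 := hD _ hmem
      have r5 := hgb _ hmem.2.2.2
      have r6 : ‖Y (((-ε : ℝ) : ℂ) + y * Complex.I)‖ ≤ B * M := by
        have r7 := norm_add_le (Y (((-ε : ℝ) : ℂ) + y * Complex.I) -
          g (((-ε : ℝ) : ℂ) + y * Complex.I)) (g (((-ε : ℝ) : ℂ) + y * Complex.I))
        rw [sub_add_cancel] at r7
        calc _ ≤ _ := r7
          _ ≤ _ := add_le_add r4 r5
          _ ≤ B * ((ε ^ ρ₁ + 5 ^ ρ₁) + (ε ^ ρ₂ + 5 ^ ρ₂)) + B * ε ^ (-η) := by gcongr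
          _ = _ := by rw [hM]; ring
      simp only [hf]
      rw [norm_mul, norm_cexp_mul_ofReal, ofReal_add_mul_I_re]
      gcongr
    · rw [abs_of_nonneg (by linarith)]
      have : q - p ≤ 4 := by
        rcases h0 with h | h <;> linarith [Real.pi_lt_four]
      calc _ ≤ B * M * (C₀ * A₁) * 4 := by gcongr
        _ = _ := by ring
  have b4 : ‖∫ x in Set.Iic (-ε), (h (x + ((-a : ℝ) : ℂ) * Complex.I) -
      h (x + (a : ℂ) * Complex.I))‖ ≤ 2 * B * M * (C₀ * A₁) := by
    have hhb : ∀ x b : ℝ, x ≤ -ε → b ≠ 0 → ‖h (x + b * Complex.I)‖ ≤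
        B * M * Real.exp (n * x) := by
      intro x b hx hb
      have hnε : ε ≤ ‖(x : ℂ) + b * Complex.I‖ := by
        have := abs_le_norm_ofReal_add_mul_I' x b
        rw [abs_of_neg (by linarith)] at this
        linarith
      simp only [hh]
      rw [norm_mul, norm_cexp_mul_ofReal, ofReal_add_mul_I_re, mul_comm x]
      gcongr
      exact hgM _ (mem_slitPlane_of_im hb) hnε
    refine (norm_integral_le_of_norm_le (g := fun x => 2 * B * M * Real.exp (n * x))
      ((integrableOn_exp_mul_Iic hn0 _).const_mul _)
      ((ae_restrict_iff' measurableSet_Iic).mpr (Eventually.of_forall fun x hx => ?_))).trans ?_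
    · have h1 := hhb x (-a) hx (neg_ne_zero.mpr ha0.ne')
      have h2 := hhb x a hx ha0.ne'
      refine (norm_sub_le _ _).trans ?_
      linarith
    · rw [integral_const_mul, integral_exp_mul_Iic hn0]
      have h1 : Real.exp (n * -ε) / n ≤ C₀ * A₁ := by
        rw [show (n : ℝ) * -ε = -ε * n by ring]
        exact (div_le_self (Real.exp_pos _).le hn1).trans hEn
      gcongr
  have hfin := b2 (-a) (by rw [abs_neg, abs_of_pos ha0])
  have hfin' := b2 a (abs_of_pos ha0)
  have b3a := b3 a Real.pi hapi (by linarith) le_rfl (Or.inl ha0)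
  have b3b := b3 (-Real.pi) (-a) (by linarith) le_rfl (by linarith) (Or.inr (by linarith))
  have tri : ∀ A B C D E F : ℂ, ‖A + B - C + D + E - F‖ ≤
      ‖A‖ + ‖B‖ + ‖C‖ + ‖D‖ + ‖E‖ + ‖F‖ := by
    intro A B C D E F
    linarith [norm_sub_le (A + B - C + D + E) F, norm_add_le (A + B - C + D) E,
      norm_add_le (A + B - C) D, norm_sub_le (A + B) C, norm_add_le A B]
  refine (tri _ _ _ _ _ _).trans ?_
  simp only [norm_mul Complex.I, Complex.norm_I, one_mul]
  have hE : 0 < Real.exp (1 / 2) := Real.exp_pos _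
  have z1 : 6 * Real.exp (1 / 2) * (L * a) ≤
      6 * Real.exp (1 / 2) * (B * (K₁ + K₂) * (A₁ + A₂)) := by gcongr
  have z2 : 0 ≤ 10 * B * M * C₀ * A₂ := by positivity
  linarith

end Subdiffusion

namespace Subdiffusion

/-! ### Error of the scalar scheme -/

theorem mem_latticeStrip_of_abs_le {s : ℂ} (hs : |s.im| ≤ Real.pi) : s ∈ latticeStrip := by
  have := Real.pi_pos
  change |s.im| < 3 / 2 * Real.pi
  linarith

/-- Telescoping: each factor s replaced by y costs the relative error |s|^k. -/
theorem norm_pow_sub_pow_le_of_approx {C : ℝ} (hC : 0 < C) (k m : ℕ) {y s : ℂ}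
    (h1 : ‖y‖ ≤ C * ‖s‖) (h2 : ‖y - s‖ ≤ C * ‖s‖ ^ (k + 1)) :
    ‖y ^ m - s ^ m‖ ≤ m * (C + 1) ^ m * ‖s‖ ^ (m + k) := by
  induction m with
  | zero => simp
  | succ m ih =>
    have h3 : y ^ (m + 1) - s ^ (m + 1) = y * (y ^ m - s ^ m) + (y - s) * s ^ m := by ring
    rw [h3]
    have hC1 : 1 ≤ (C + 1) ^ m := one_le_pow₀ (by linarith)
    calc _ ≤ ‖y‖ * ‖y ^ m - s ^ m‖ + ‖y - s‖ * ‖s‖ ^ m := by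
          refine (norm_add_le _ _).trans ?_
          rw [norm_mul, norm_mul, norm_pow]
      _ ≤ C * ‖s‖ * (m * (C + 1) ^ m * ‖s‖ ^ (m + k)) + C * ‖s‖ ^ (k + 1) * ‖s‖ ^ m := by
          gcongr
      _ = (C * (m * (C + 1) ^ m) + C * 1) * ‖s‖ ^ (m + 1 + k) := by ring
      _ ≤ ((C + 1) * (m * (C + 1) ^ m) + (C + 1) * (C + 1) ^ m) * ‖s‖ ^ (m + 1 + k) := by
          gcongr <;> linarith
      _ = _ := by push_cast; ring

/-- The error is split into those of the m-th power, of the fractional power in the denominator, and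
the regular part `L` of the lattice sum. -/
theorem symbol_difference {m γ α x : ℝ} {M : ℕ} (hM : m = M) {y s L : ℂ} (hs : s ≠ 0)
    (hys : y ^ (α : ℂ) + x ≠ 0) (hss : s ^ (α : ℂ) + x ≠ 0) :
    y ^ M / (y ^ (α : ℂ) + x) * (s ^ ((-(γ + 1) : ℝ) : ℂ) + L) - mlSymbol α (α + γ + 1 - m) x s =
      (y ^ (α : ℂ) + x)⁻¹ * (((y ^ M - s ^ M) + s ^ M * (s ^ (α : ℂ) - y ^ (α : ℂ)) *
        (s ^ (α : ℂ) + x)⁻¹) * s ^ ((-(γ + 1) : ℝ) : ℂ) + y ^ M * L) := by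
  have h1 : s ^ ((α - (α + γ + 1 - m) : ℝ) : ℂ) = s ^ M * s ^ ((-(γ + 1) : ℝ) : ℂ) := by
    rw [← Complex.cpow_natCast s M, ← Complex.cpow_add _ _ hs]
    congr 1
    rw [hM]
    push_cast
    ring
  unfold mlSymbol
  rw [h1]
  field_simp
  ring

/-- The symbols of the scheme and of the differential equation. -/
theorem exists_norm_schemeSymbol_sub_le {k m : ℕ} {α γ : ℝ} (hk1 : 1 ≤ k) (hk6 : k ≤ 6)
    (hα0 : 0 < α) (hα1 : α < 1) (hγ : 0 < γ) : ∃ ε C : ℝ, 0 < ε ∧ ε < 1 ∧ 0 < C ∧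
    ∀ x : ℝ, 0 ≤ x → ∀ s ∈ contourRegion ε,
      DifferentiableAt ℂ (schemeSymbol k m α γ x) s ∧
      ‖schemeSymbol k m α γ x s - mlSymbol α (α + γ + 1 - m) x s‖ ≤
        C / (‖s‖ ^ α + x) * (‖s‖ ^ (m + k - γ - 1) + ‖s‖ ^ m * ‖latticeTail γ s‖) := by
  obtain ⟨ε, c, C, hε0, hε1, hc, hC, hb⟩ := exists_bdfSymbol_bounds hk1 hk6 hα0 hα1
  obtain ⟨c₁, hc₁, hlow⟩ := norm_cpow_add_ge hα0 hα1
  set c₂ : ℝ := c₁ * min (c ^ α) 1 with hc₂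
  have hcα : 0 < c ^ α := Real.rpow_pos_of_pos hc _
  have hc₂0 : 0 < c₂ := by positivity
  set C₁ : ℝ := m * (C + 1) ^ m + C / c₁ + C ^ m with hC₁
  have hC₁0 : 0 < C₁ := by positivity
  refine ⟨ε, C₁ / c₂, hε0, hε1, by positivity, fun x hx s hs => ?_⟩
  obtain ⟨hy, hcy, hCy, hys, hyα⟩ := hb s hs
  have hs0 : s ≠ 0 := Complex.slitPlane_ne_zero hs.2.2.2
  have hsn : 0 < ‖s‖ := norm_pos_iff.mpr hs0
  have hstrip := mem_latticeStrip_of_abs_le hs.2.2.1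
  have hy0 : bdfSymbol k s ≠ 0 := Complex.slitPlane_ne_zero hy
  have hyx := cpow_add_ofReal_ne_zero hα0 hα1 hx hy0
  have hsx := cpow_add_ofReal_ne_zero hα0 hα1 hx hs0
  have hsα : 0 < ‖s‖ ^ α := Real.rpow_pos_of_pos hsn _
  constructor
  · have hd := (differentiable_bdfSymbol k).differentiableAt (x := s)
    unfold schemeSymbol
    refine ((hd.pow m).div ((hd.cpow_const hy).add_const _) hyx).mul ?_
    exact (differentiableOn_latticeSum hγ).differentiableAt
      ((isOpen_latticeStrip.inter Complex.isOpen_slitPlane).mem_nhds ⟨hstrip, hs.2.2.2⟩)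
  · unfold schemeSymbol
    rw [latticeSum_eq hγ hstrip, symbol_difference rfl hs0 hyx hsx, norm_mul]
    set y := bdfSymbol k s
    set L := latticeTail γ s
    have e1 : ‖(y ^ (α : ℂ) + x)⁻¹‖ ≤ (c₂ * (‖s‖ ^ α + x))⁻¹ := by
      rw [norm_inv]
      apply inv_anti₀ (by positivity)
      refine le_trans ?_ (hlow y x hx)
      have h1 : (c * ‖s‖) ^ α ≤ ‖y‖ ^ α := Real.rpow_le_rpow (by positivity) hcy hα0.le
      rw [Real.mul_rpow hc.le hsn.le] at h1
      have h2 : min (c ^ α) 1 * ‖s‖ ^ α ≤ c ^ α * ‖s‖ ^ α := by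
        gcongr; exact min_le_left _ _
      have h3 : min (c ^ α) 1 * x ≤ 1 * x := by
        gcongr; exact min_le_right _ _
      rw [hc₂, mul_assoc]
      gcongr
      linarith
    have e2 := norm_pow_sub_pow_le_of_approx hC k m hCy hys
    have e3 : ‖s ^ m * (s ^ (α : ℂ) - y ^ (α : ℂ)) * (s ^ (α : ℂ) + x)⁻¹‖ ≤
        C / c₁ * ‖s‖ ^ (m + k) := by
      have h1 : ‖(s ^ (α : ℂ) + x)⁻¹‖ ≤ (c₁ * ‖s‖ ^ α)⁻¹ := by
        rw [norm_inv]
        apply inv_anti₀ (by positivity)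
        refine le_trans ?_ (hlow s x hx)
        gcongr
        linarith
      rw [norm_mul, norm_mul, norm_pow, norm_sub_rev]
      calc _ ≤ ‖s‖ ^ m * (C * ‖s‖ ^ (α + k)) * (c₁ * ‖s‖ ^ α)⁻¹ := by gcongr
        _ = _ := by
          rw [Real.rpow_add hsn, Real.rpow_natCast, pow_add]
          field_simp
    have e4 : ‖y ^ m * L‖ ≤ C ^ m * (‖s‖ ^ m * ‖L‖) := by
      rw [norm_mul, norm_pow, ← mul_assoc, ← mul_pow]
      gcongr
    have e5 : ‖s ^ ((-(γ + 1) : ℝ) : ℂ)‖ = ‖s‖ ^ (-(γ + 1)) := Complex.norm_cpow_real _ _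
    have e6 : ‖s‖ ^ (m + k) * ‖s‖ ^ (-(γ + 1)) = ‖s‖ ^ ((m : ℝ) + k - γ - 1) := by
      rw [← Real.rpow_natCast, ← Real.rpow_add hsn]
      congr 1
      push_cast
      ring
    have hP : 0 < ‖s‖ ^ ((m : ℝ) + k - γ - 1) := Real.rpow_pos_of_pos hsn _
    have e7 : ‖((y ^ m - s ^ m) + s ^ m * (s ^ (α : ℂ) - y ^ (α : ℂ)) * (s ^ (α : ℂ) + x)⁻¹) *
        s ^ ((-(γ + 1) : ℝ) : ℂ) + y ^ m * L‖ ≤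
        C₁ * (‖s‖ ^ ((m : ℝ) + k - γ - 1) + ‖s‖ ^ m * ‖L‖) := by
      refine (norm_add_le _ _).trans ?_
      rw [norm_mul _ (s ^ ((-(γ + 1) : ℝ) : ℂ)), e5]
      calc _ ≤ (m * (C + 1) ^ m * ‖s‖ ^ (m + k) + C / c₁ * ‖s‖ ^ (m + k)) * ‖s‖ ^ (-(γ + 1)) +
            C ^ m * (‖s‖ ^ m * ‖L‖) := by
            gcongr
            exact (norm_add_le _ _).trans (add_le_add e2 e3)
        _ = (m * (C + 1) ^ m + C / c₁) * ‖s‖ ^ ((m : ℝ) + k - γ - 1) +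
            C ^ m * (‖s‖ ^ m * ‖L‖) := by rw [← e6]; ring
        _ ≤ _ := by
            have h1 : 0 ≤ C ^ m * ‖s‖ ^ ((m : ℝ) + k - γ - 1) := by positivity
            have h2 : 0 ≤ (m * (C + 1) ^ m + C / c₁) * (‖s‖ ^ m * ‖L‖) := by positivity
            rw [hC₁]
            linarith
    calc _ ≤ (c₂ * (‖s‖ ^ α + x))⁻¹ *
          (C₁ * (‖s‖ ^ ((m : ℝ) + k - γ - 1) + ‖s‖ ^ m * ‖L‖)) := by gcongr
      _ = _ := by rw [mul_inv]; ring

/-- The weight `w` is 1 for the source and x for the initial data, so that one comparison of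
contours serves both. -/
theorem norm_mul_schemeCoeff_sub_mlKernel {k m : ℕ} {α γ x : ℝ} (hk1 : 1 ≤ k) (hk6 : k ≤ 6)
    (hα0 : 0 < α) (hα1 : α < 1) (hγ : 0 < γ) (hβ : 0 < α + γ + 1 - m) (hx : 0 ≤ x) {n : ℕ}
    (hn : 1 ≤ n) {w : ℝ} (hw : 0 ≤ w) :
    ‖Complex.I * (∫ y in (-Real.pi)..Real.pi, (w : ℂ) * schemeSymbol k m α γ x
        ((((n : ℝ)⁻¹ : ℝ) : ℂ) + y * Complex.I) *
        Complex.exp (((((n : ℝ)⁻¹ : ℝ) : ℂ) + y * Complex.I) * (n : ℝ))) -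
      hankel ((n : ℝ)⁻¹) (fun s => (w : ℂ) * mlSymbol α (α + γ + 1 - m) x s *
        Complex.exp (s * (n : ℝ)))‖ =
      2 * Real.pi * (w * ‖schemeCoeff k m α γ x n -
        mlKernel α (α + γ + 1 - m) (n : ℝ) (-(x : ℂ))‖) := by
  have hn0 : (0 : ℝ) < n := by exact_mod_cast hn
  have h1 := schemeCoeff_eq_integral (m := m) hk1 hk6 hα0 hα1 hγ hx (inv_pos.mpr hn0) n
  have h2 := hankel_mlSymbol hα0 hα1 hβ hx (inv_pos.mpr hn0) hn0
  have h3 : hankel ((n : ℝ)⁻¹) (fun s => (w : ℂ) * mlSymbol α (α + γ + 1 - m) x s *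
      Complex.exp (s * (n : ℝ))) = w * hankel ((n : ℝ)⁻¹) (fun s =>
        mlSymbol α (α + γ + 1 - m) x s * Complex.exp (s * (n : ℝ))) := by
    have hi := hankelIntegrable_mlSymbol hα0 hα1 hβ.le hx (inv_pos.mpr hn0) hn0
    have h4 := hankel_add_const_mul hi hi (w : ℂ) 0
    rw [zero_mul, add_zero] at h4
    rw [← h4]
    congr 1
    funext s
    ring
  simp only [mul_assoc (w : ℂ)]
  rw [intervalIntegral.integral_const_mul]
  simp only [mul_assoc (w : ℂ)] at h3
  simp only [Complex.ofReal_natCast] at h1 h2 h3 ⊢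
  rw [h3, h2, ← h1]
  have h5 : Complex.I * ((w : ℂ) * (2 * Real.pi * schemeCoeff k m α γ x n)) -
      w * (2 * Real.pi * Complex.I * mlKernel α (α + γ + 1 - m) (n : ℝ) (-(x : ℂ))) =
      Complex.I * ((2 * Real.pi * w : ℝ) : ℂ) *
        (schemeCoeff k m α γ x n - mlKernel α (α + γ + 1 - m) (n : ℝ) (-(x : ℂ))) := by
    push_cast
    ring
  rw [h5, norm_mul, norm_mul, Complex.norm_I, one_mul, Complex.norm_real,
    Real.norm_of_nonneg (by positivity)]
  ring

/-- Error of the scalar scheme for the source `t^μ`. -/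
theorem exists_norm_schemeCoeff_sub_le {k m : ℕ} {α μ : ℝ} (hk1 : 1 ≤ k) (hk6 : k ≤ 6)
    (hα0 : 0 < α) (hα1 : α < 1) (hm : 1 ≤ m) (hμ : -1 < μ) : ∃ C : ℝ, 0 < C ∧
    ∀ x : ℝ, 0 ≤ x → ∀ n : ℕ, 1 ≤ n →
      ‖schemeCoeff k m α (μ + m) x n - mlKernel α (α + μ + 1) (n : ℝ) (-(x : ℂ))‖ ≤
        C * ((n : ℝ) ^ (α - m - 1) + (n : ℝ) ^ (α + μ - k)) := by
  have hm1 : (1 : ℝ) ≤ m := by exact_mod_cast hm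
  have hγ : 0 < μ + m := by linarith
  obtain ⟨ε, C, hε0, hε1, hC, hsym⟩ :=
    exists_norm_schemeSymbol_sub_le (m := m) hk1 hk6 hα0 hα1 hγ
  have hβ : α + (μ + m) + 1 - m = α + μ + 1 := by ring
  have hβ0 : 0 < α + μ + 1 := by linarith
  rw [hβ] at hsym
  obtain ⟨K, hK, hml⟩ := exists_norm_mlSymbol_le hα0 hα1 (α + μ + 1)
  -- The exponents k - μ - 1 and m of the symbol error are lowered by α through 1/(|s|^α + x) ≤
  -- |s|^(-α).
  obtain ⟨C₁, hC₁, hcomp⟩ := exists_contour_comparison hε0 hε1 (k - μ - 1 - α) (m - α) hβ0.le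
  set S : ℝ := ∑' j : ℤ, |(j : ℝ)| ^ (-(μ + m + 1)) with hS
  have hS0 : 0 ≤ S := tsum_nonneg fun j => by positivity
  set B : ℝ := C * (1 + S) + K with hB
  have hB0 : 0 < B := by positivity
  refine ⟨C₁ * B, by positivity, fun x hx n hn => ?_⟩
  have hn0 : (0 : ℝ) < n := by exact_mod_cast hn
  have h1 := hcomp (fun s => ((1 : ℝ) : ℂ) * schemeSymbol k m α (μ + m) x s)
    (fun s => ((1 : ℝ) : ℂ) * mlSymbol α (α + (μ + m) + 1 - m) x s) B n hB0.le hn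
    (fun s hs => (hsym x hx s hs).1.const_mul _)
    (fun s => by rw [schemeSymbol_add_two_pi])
    (continuousOn_const.mul (differentiableOn_mlSymbol hα0 hα1 _ hx).continuousOn)
    (fun s hs => by
      rw [hβ, Complex.ofReal_one, one_mul]
      refine (hml x hx s (Complex.slitPlane_ne_zero hs)).trans ?_
      gcongr
      rw [hB]
      have : 0 ≤ C * (1 + S) := by positivity
      linarith) ?_
  · rw [norm_mul_schemeCoeff_sub_mlKernel hk1 hk6 hα0 hα1 hγ (by rw [hβ]; exact hβ0) hx hn
      zero_le_one, hβ, one_mul] at h1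
    have h2 : ((n : ℝ) ^ (-((k : ℝ) - μ - 1 - α) - 1) + (n : ℝ) ^ (-((m : ℝ) - α) - 1)) =
        (n : ℝ) ^ (α - m - 1) + (n : ℝ) ^ (α + μ - k) := by
      rw [add_comm]
      congr 2 <;> ring
    rw [h2] at h1
    refine le_trans ?_ h1
    have h3 : (1 : ℝ) ≤ 2 * Real.pi := by linarith [Real.pi_gt_three]
    exact le_mul_of_one_le_left (norm_nonneg _) h3
  · intro s hs
    have hs0 : 0 < ‖s‖ := norm_pos_iff.mpr (Complex.slitPlane_ne_zero hs.2.2.2)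
    have hsα : 0 < ‖s‖ ^ α := Real.rpow_pos_of_pos hs0 _
    simp only [Complex.ofReal_one, one_mul, hβ]
    refine (hsym x hx s hs).2.trans ?_
    have hL : ‖latticeTail (μ + m) s‖ ≤ S :=
      norm_latticeTail_le hγ (mem_latticeStrip_of_abs_le hs.2.2.1)
    have e1 : ‖s‖ ^ ((m : ℝ) + k - (μ + m) - 1) = ‖s‖ ^ α * ‖s‖ ^ ((k : ℝ) - μ - 1 - α) := by
      rw [← Real.rpow_add hs0]; congr 1; ring
    have e2 : ‖s‖ ^ m = ‖s‖ ^ α * ‖s‖ ^ ((m : ℝ) - α) := by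
      rw [← Real.rpow_add hs0, ← Real.rpow_natCast]; congr 1; ring
    have p1 : 0 < ‖s‖ ^ ((k : ℝ) - μ - 1 - α) := Real.rpow_pos_of_pos hs0 _
    have p2 : 0 < ‖s‖ ^ ((m : ℝ) - α) := Real.rpow_pos_of_pos hs0 _
    rw [e1, e2]
    calc _ ≤ C / (‖s‖ ^ α) * (‖s‖ ^ α * ‖s‖ ^ ((k : ℝ) - μ - 1 - α) +
          ‖s‖ ^ α * ‖s‖ ^ ((m : ℝ) - α) * S) := by
          gcongr
          linarith
      _ = C * (1 * ‖s‖ ^ ((k : ℝ) - μ - 1 - α) + S * ‖s‖ ^ ((m : ℝ) - α)) := by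
          field_simp
      _ ≤ C * ((1 + S) * ‖s‖ ^ ((k : ℝ) - μ - 1 - α) + (1 + S) * ‖s‖ ^ ((m : ℝ) - α)) := by
          gcongr <;> linarith
      _ = C * (1 + S) * (‖s‖ ^ ((k : ℝ) - μ - 1 - α) + ‖s‖ ^ ((m : ℝ) - α)) := by ring
      _ ≤ _ := by
          gcongr
          rw [hB]
          linarith

/-- For odd m the tail is bounded, for even m it is O(|s|); this decides between the orders m + 1
and m + 2. -/
theorem exists_pow_mul_norm_latticeTail_le {m : ℕ} (hm : 1 ≤ m) : ∃ C : ℝ, 0 < C ∧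
    ∀ s : ℂ, |s.re| ≤ 1 → |s.im| ≤ Real.pi →
      ‖s‖ ^ m * ‖latticeTail m s‖ ≤ C * ‖s‖ ^ (initialOrder m - 1) := by
  have hm0 : (0 : ℝ) < m := by exact_mod_cast hm
  unfold initialOrder
  split_ifs with h
  · refine ⟨1 + ∑' j : ℤ, |(j : ℝ)| ^ (-((m : ℝ) + 1)), ?_, fun s _ hs => ?_⟩
    · have : 0 ≤ ∑' j : ℤ, |(j : ℝ)| ^ (-((m : ℝ) + 1)) := tsum_nonneg fun j => by positivity
      linarith
    · have := norm_latticeTail_le hm0 (mem_latticeStrip_of_abs_le hs)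
      rw [Nat.add_sub_cancel, mul_comm]
      gcongr
      linarith
  · obtain ⟨C, hC, hb⟩ := norm_latticeTail_le_mul_of_even hm (Nat.not_odd_iff_even.mp h)
    refine ⟨C, hC, fun s h1 h2 => ?_⟩
    calc _ ≤ ‖s‖ ^ m * (C * ‖s‖) := by gcongr; exact hb s h1 h2
      _ = _ := by rw [show m + 2 - 1 = m + 1 by omega]; ring

/-- Error of the scalar scheme for the initial data. -/
theorem exists_mul_norm_schemeCoeff_sub_le {k m : ℕ} {α : ℝ} (hk1 : 1 ≤ k) (hk6 : k ≤ 6)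
    (hα0 : 0 < α) (hα1 : α < 1) (hm : 1 ≤ m) : ∃ C : ℝ, 0 < C ∧
    ∀ x : ℝ, 0 ≤ x → ∀ n : ℕ, 1 ≤ n →
      x * ‖schemeCoeff k m α m x n - mlKernel α (α + 1) (n : ℝ) (-(x : ℂ))‖ ≤
        C * ((n : ℝ) ^ (-(initialOrder m : ℝ)) + (n : ℝ) ^ (-(k : ℝ))) := by
  have hm1 : (1 : ℝ) ≤ m := by exact_mod_cast hm
  have hγ : (0 : ℝ) < m := by linarith
  obtain ⟨ε, C, hε0, hε1, hC, hsym⟩ :=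
    exists_norm_schemeSymbol_sub_le (m := m) hk1 hk6 hα0 hα1 hγ
  have hβ : α + (m : ℝ) + 1 - m = α + 1 := by ring
  have hβ0 : 0 < α + 1 := by linarith
  rw [hβ] at hsym
  obtain ⟨c, hc, hlow⟩ := norm_cpow_add_ge hα0 hα1
  obtain ⟨S, hS, htail⟩ := exists_pow_mul_norm_latticeTail_le hm
  have hp1 : 1 ≤ initialOrder m := by unfold initialOrder; split_ifs <;> omega
  -- The weight x is absorbed by x/(|s|^α + x) ≤ 1, without loss of α; the weighted exact symbol is
  -- then O(|s|⁻¹).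
  obtain ⟨C₁, hC₁, hcomp⟩ := exists_contour_comparison hε0 hε1 (k - 1)
    ((initialOrder m : ℝ) - 1) zero_le_one
  set B : ℝ := C * (1 + S) + c⁻¹ with hB
  have hB0 : 0 < B := by positivity
  refine ⟨C₁ * B, by positivity, fun x hx n hn => ?_⟩
  have hn0 : (0 : ℝ) < n := by exact_mod_cast hn
  have h1 := hcomp (fun s => (x : ℂ) * schemeSymbol k m α m x s)
    (fun s => (x : ℂ) * mlSymbol α (α + m + 1 - m) x s) B n hB0.le hn
    (fun s hs => (hsym x hx s hs).1.const_mul _)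
    (fun s => by rw [schemeSymbol_add_two_pi])
    (continuousOn_const.mul (differentiableOn_mlSymbol hα0 hα1 _ hx).continuousOn)
    (fun s hs => ?_) ?_
  · rw [norm_mul_schemeCoeff_sub_mlKernel hk1 hk6 hα0 hα1 hγ (by rw [hβ]; exact hβ0) hx hn
      hx, hβ] at h1
    have h2 : ((n : ℝ) ^ (-((k : ℝ) - 1) - 1) + (n : ℝ) ^ (-((initialOrder m : ℝ) - 1) - 1)) =
        (n : ℝ) ^ (-(initialOrder m : ℝ)) + (n : ℝ) ^ (-(k : ℝ)) := by
      rw [add_comm]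
      congr 2 <;> ring
    rw [h2] at h1
    refine le_trans ?_ h1
    have h3 : (1 : ℝ) ≤ 2 * Real.pi := by linarith [Real.pi_gt_three]
    exact le_mul_of_one_le_left (mul_nonneg hx (norm_nonneg _)) h3
  · have hs0 : 0 < ‖s‖ := norm_pos_iff.mpr (Complex.slitPlane_ne_zero hs)
    have hsα : 0 < ‖s‖ ^ α := Real.rpow_pos_of_pos hs0 _
    have hz := cpow_add_ofReal_ne_zero hα0 hα1 hx (Complex.slitPlane_ne_zero hs)
    have hzn : 0 < ‖s ^ (α : ℂ) + x‖ := norm_pos_iff.mpr hz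
    rw [hβ]
    unfold mlSymbol
    rw [norm_mul, norm_div, Complex.norm_cpow_real, Complex.norm_real, Real.norm_of_nonneg hx,
      show α - (α + 1) = -1 by ring]
    have h3 : x ≤ c⁻¹ * ‖s ^ (α : ℂ) + x‖ := by
      rw [← div_eq_inv_mul, le_div_iff₀ hc, mul_comm]
      refine le_trans ?_ (hlow s x hx)
      gcongr
      linarith
    have h4 : c⁻¹ ≤ B := by
      rw [hB]
      have : 0 ≤ C * (1 + S) := by positivity
      linarith
    calc x * (‖s‖ ^ (-1 : ℝ) / ‖s ^ (α : ℂ) + x‖) ≤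
        c⁻¹ * ‖s ^ (α : ℂ) + x‖ * (‖s‖ ^ (-1 : ℝ) / ‖s ^ (α : ℂ) + x‖) := by gcongr
      _ = c⁻¹ * ‖s‖ ^ (-1 : ℝ) := by field_simp
      _ ≤ _ := by gcongr
  · intro s hs
    have hs0 : 0 < ‖s‖ := norm_pos_iff.mpr (Complex.slitPlane_ne_zero hs.2.2.2)
    have hsα : 0 < ‖s‖ ^ α := Real.rpow_pos_of_pos hs0 _
    have ht := htail s (abs_le.mpr ⟨by linarith [hs.1], hs.2.1⟩) hs.2.2.1
    rw [← mul_sub, norm_mul, Complex.norm_real, Real.norm_of_nonneg hx, hβ]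
    have e1 : ‖s‖ ^ ((m : ℝ) + k - m - 1) = ‖s‖ ^ ((k : ℝ) - 1) := by congr 1; ring
    have e2 : ‖s‖ ^ (initialOrder m - 1) = ‖s‖ ^ ((initialOrder m : ℝ) - 1) := by
      rw [← Real.rpow_natCast, Nat.cast_sub hp1, Nat.cast_one]
    have h5 := (hsym x hx s hs).2
    rw [e1] at h5
    rw [e2] at ht
    have p1 : 0 < ‖s‖ ^ ((k : ℝ) - 1) := Real.rpow_pos_of_pos hs0 _
    have p2 : 0 < ‖s‖ ^ ((initialOrder m : ℝ) - 1) := Real.rpow_pos_of_pos hs0 _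
    have h6 : x * (C / (‖s‖ ^ α + x)) ≤ C := by
      rw [mul_div_assoc', div_le_iff₀ (by positivity), mul_comm]
      gcongr
      linarith
    calc _ ≤ x * (C / (‖s‖ ^ α + x) * (‖s‖ ^ ((k : ℝ) - 1) + ‖s‖ ^ m * ‖latticeTail m s‖)) := by
          gcongr
      _ = x * (C / (‖s‖ ^ α + x)) * (‖s‖ ^ ((k : ℝ) - 1) + ‖s‖ ^ m * ‖latticeTail m s‖) := by ring
      _ ≤ C * (1 * ‖s‖ ^ ((k : ℝ) - 1) + S * ‖s‖ ^ ((initialOrder m : ℝ) - 1)) := by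
          rw [one_mul]; gcongr
      _ ≤ C * ((1 + S) * ‖s‖ ^ ((k : ℝ) - 1) + (1 + S) * ‖s‖ ^ ((initialOrder m : ℝ) - 1)) := by
          gcongr <;> linarith
      _ = C * (1 + S) * (‖s‖ ^ ((k : ℝ) - 1) + ‖s‖ ^ ((initialOrder m : ℝ) - 1)) := by ring
      _ ≤ _ := by
          gcongr
          rw [hB]
          have := inv_pos.mpr hc
          linarith

end Subdiffusion

namespace Subdiffusion

/-! ### The inverse of `1 - A` -/

section Resolvent

variable {d : ℕ} {Ω : Set (EuclideanSpace ℝ (Fin d))}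

theorem IsConvexPolyhedralDomain.isOpen (hΩ : IsConvexPolyhedralDomain Ω) : IsOpen Ω := by
  obtain ⟨_, s, _, rfl⟩ := hΩ
  exact isOpen_interior

theorem IsTestFunction.partialDeriv {φ : EuclideanSpace ℝ (Fin d) → ℂ} (hφ : IsTestFunction Ω φ)
    (i : Fin d) : IsTestFunction Ω (partialDeriv i φ) := by
  refine ⟨?_, hφ.2.1.fderiv_apply (𝕜 := ℝ) _, (tsupport_fderiv_apply_subset ℝ _).trans hφ.2.2⟩
  have h : ContDiff ℝ (⊤ : ℕ∞) (fderiv ℝ φ) := hφ.1.fderiv_right (by simp)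
  exact h.clm_apply contDiff_const

theorem IsTestFunction.conj {φ : EuclideanSpace ℝ (Fin d) → ℂ} (hφ : IsTestFunction Ω φ) :
    IsTestFunction Ω (fun x => (starRingEnd ℂ) (φ x)) := by
  have hs : Function.support (fun x => (starRingEnd ℂ) (φ x)) = Function.support φ := by
    ext x; simp
  have ht : tsupport (fun x => (starRingEnd ℂ) (φ x)) = tsupport φ := by
    unfold tsupport; rw [hs]
  refine ⟨Complex.conjCLE.contDiff.comp hφ.1, ?_, by rw [ht]; exact hφ.2.2⟩
  unfold HasCompactSupport
  rw [ht]
  exact hφ.2.1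

theorem partialDeriv_conj {φ : EuclideanSpace ℝ (Fin d) → ℂ} (hφ : IsTestFunction Ω φ)
    (i : Fin d) (x : EuclideanSpace ℝ (Fin d)) :
    partialDeriv i (fun x => (starRingEnd ℂ) (φ x)) x = (starRingEnd ℂ) (partialDeriv i φ x) := by
  have h1 : DifferentiableAt ℝ φ x := (hφ.1.differentiable (by simp)).differentiableAt
  have h2 : HasFDerivAt (fun x => (starRingEnd ℂ) (φ x))
      ((Complex.conjCLE : ℂ →L[ℝ] ℂ).comp (fderiv ℝ φ x)) x :=
    (Complex.conjCLE : ℂ →L[ℝ] ℂ).hasFDerivAt.comp x h1.hasFDerivAt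
  unfold partialDeriv
  rw [h2.fderiv]
  rfl

theorem IsTestFunction.memLp {φ : EuclideanSpace ℝ (Fin d) → ℂ} (hφ : IsTestFunction Ω φ) :
    MemLp φ 2 (volume.restrict Ω) :=
  (hφ.1.continuous.memLp_of_hasCompactSupport hφ.2.1).restrict Ω

/-- The first-order jet of a test function. -/
noncomputable def testJet {φ : EuclideanSpace ℝ (Fin d) → ℂ} (hφ : IsTestFunction Ω φ) :
    PiLp 2 (fun _ : Option (Fin d) => L2 Ω) :=
  WithLp.toLp 2 (fun o => o.elim hφ.memLp.toLp (fun i => (hφ.partialDeriv i).memLp.toLp))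

/-- The space `H¹₀(Ω)`, as a space of first-order jets. -/
noncomputable def jetSpace (Ω : Set (EuclideanSpace ℝ (Fin d))) :
    Submodule ℂ (PiLp 2 (fun _ : Option (Fin d) => L2 Ω)) :=
  (Submodule.span ℂ {z | ∃ (φ : EuclideanSpace ℝ (Fin d) → ℂ) (hφ : IsTestFunction Ω φ),
    z = testJet hφ}).topologicalClosure

instance : CompleteSpace (jetSpace Ω) :=
  (Submodule.isClosed_topologicalClosure _).completeSpace_coe

theorem testJet_mem {φ : EuclideanSpace ℝ (Fin d) → ℂ} (hφ : IsTestFunction Ω φ) :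
    testJet hφ ∈ jetSpace Ω :=
  Submodule.le_topologicalClosure _ (Submodule.subset_span ⟨φ, hφ, rfl⟩)

theorem mem_jetSpace_of_approx {u : L2 Ω} {w : Fin d → L2 Ω}
    (h : ∀ ε : ℝ, 0 < ε → ∃ φ : EuclideanSpace ℝ (Fin d) → ℂ, IsTestFunction Ω φ ∧
      eLpNorm (fun x => u x - φ x) 2 (volume.restrict Ω) < ENNReal.ofReal ε ∧
      ∀ i, eLpNorm (fun x => w i x - partialDeriv i φ x) 2 (volume.restrict Ω) <
        ENNReal.ofReal ε) :
    WithLp.toLp 2 (fun o : Option (Fin d) => o.elim u w) ∈ jetSpace Ω := by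
  have hpos : ∀ n : ℕ, (0 : ℝ) < 1 / ((n : ℝ) + 1) := fun n => by positivity
  choose φ hφ hφu hφw using fun n : ℕ => h _ (hpos n)
  have hdist : ∀ (n : ℕ) (a : L2 Ω) (f : EuclideanSpace ℝ (Fin d) → ℂ)
      (hf : MemLp f 2 (volume.restrict Ω)),
      eLpNorm (fun x => a x - f x) 2 (volume.restrict Ω) < ENNReal.ofReal (1 / ((n : ℝ) + 1)) →
      dist (hf.toLp) a ≤ 1 / ((n : ℝ) + 1) := by
    intro n a f hf hlt
    have e1 : edist a hf.toLp < ENNReal.ofReal (1 / ((n : ℝ) + 1)) := by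
      have := Lp.edist_toLp_toLp (a : EuclideanSpace ℝ (Fin d) → ℂ) f (Lp.memLp a) hf
      rw [Lp.toLp_coeFn] at this
      rw [this]
      exact hlt
    rw [dist_comm, dist_edist]
    exact ENNReal.toReal_le_of_le_ofReal (hpos n).le e1.le
  have hlim : Tendsto (fun n => testJet (hφ n)) atTop
      (𝓝 (WithLp.toLp 2 (fun o : Option (Fin d) => o.elim u w))) := by
    refine ((PiLp.continuous_toLp 2 (fun _ : Option (Fin d) => L2 Ω)).tendsto _).comp ?_
    rw [tendsto_pi_nhds]
    intro o
    rw [tendsto_iff_dist_tendsto_zero]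
    refine squeeze_zero (fun _ => dist_nonneg) (fun n => ?_)
      (tendsto_one_div_add_atTop_nhds_zero_nat (𝕜 := ℝ))
    cases o with
    | none => exact hdist n u _ (hφ n).memLp (hφu n)
    | some i => exact hdist n (w i) _ ((hφ n).partialDeriv i).memLp (hφw n i)
  exact (Submodule.isClosed_topologicalClosure _).mem_of_tendsto hlim
    (Eventually.of_forall fun n => testJet_mem (hφ n))

theorem inner_toLp_testFunction (a : L2 Ω) {φ : EuclideanSpace ℝ (Fin d) → ℂ}
    (hφ : IsTestFunction Ω φ) :
    inner ℂ a hφ.memLp.toLp =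
      (starRingEnd ℂ) (∫ x in Ω, a x * (starRingEnd ℂ) (φ x)) := by
  rw [L2.inner_def, ← integral_conj]
  apply integral_congr_ae
  filter_upwards [hφ.memLp.coeFn_toLp] with x hx
  rw [hx, RCLike.inner_apply, map_mul, Complex.conj_conj, mul_comm]

theorem inner_testJet (u : L2 Ω) (w : Fin d → L2 Ω) {φ : EuclideanSpace ℝ (Fin d) → ℂ}
    (hφ : IsTestFunction Ω φ) :
    inner ℂ (WithLp.toLp 2 (fun o : Option (Fin d) => o.elim u w) :
      PiLp 2 (fun _ : Option (Fin d) => L2 Ω)) (testJet hφ) =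
      inner ℂ u hφ.memLp.toLp + ∑ i, inner ℂ (w i) (hφ.partialDeriv i).memLp.toLp := by
  rw [PiLp.inner_apply, Fintype.sum_option]
  rfl

/-- The embedding of `H¹₀(Ω)` into `L²(Ω)`. -/
noncomputable def jetToL2 (Ω : Set (EuclideanSpace ℝ (Fin d))) : jetSpace Ω →L[ℂ] L2 Ω :=
  (PiLp.proj 2 (fun _ : Option (Fin d) => L2 Ω) none : _ →L[ℂ] L2 Ω).comp (jetSpace Ω).subtypeL

/-- The operator `(1 - A)⁻¹`. -/
noncomputable def dirichletResolvent (Ω : Set (EuclideanSpace ℝ (Fin d))) : L2 Ω →L[ℂ] L2 Ω :=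
  (jetToL2 Ω).comp (ContinuousLinearMap.adjoint (jetToL2 Ω))

/-- By density of the test jets it suffices to check the weak form of u - f: the pairing of u and
its gradient with a test jet equals that of u - f with the test function, after an integration by
parts. -/
theorem dirichletResolvent_apply {u f : L2 Ω} (h : HasDirichletLaplacian Ω u f) :
    dirichletResolvent Ω (u - f) = u := by
  obtain ⟨⟨w', hw', happ⟩, w, h2, hw, hh, rfl⟩ := h
  have hmem := mem_jetSpace_of_approx happ
  set z : jetSpace Ω := ⟨_, hmem⟩ with hz
  suffices hsuff : ContinuousLinearMap.adjoint (jetToL2 Ω) (u - ∑ i, h2 i i) = z by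
    change jetToL2 Ω (ContinuousLinearMap.adjoint (jetToL2 Ω) (u - ∑ i, h2 i i)) = u
    rw [hsuff]
    rfl
  refine ext_inner_right ℂ fun κ => ?_
  rw [ContinuousLinearMap.adjoint_inner_left]
  obtain ⟨κ, hκ⟩ := κ
  change inner ℂ (u - ∑ i, h2 i i) (κ none) = inner ℂ (WithLp.toLp 2
    (fun o : Option (Fin d) => o.elim u w') : PiLp 2 (fun _ : Option (Fin d) => L2 Ω)) κ
  have hcl : IsClosed {κ : PiLp 2 (fun _ : Option (Fin d) => L2 Ω) |
      inner ℂ (u - ∑ i, h2 i i) (κ none) = inner ℂ (WithLp.toLp 2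
        (fun o : Option (Fin d) => o.elim u w') : PiLp 2 (fun _ : Option (Fin d) => L2 Ω)) κ} := by
    apply isClosed_eq
    · exact continuous_const.inner (PiLp.continuous_apply 2 _ none)
    · exact continuous_const.inner continuous_id
  refine closure_minimal ?_ hcl hκ
  intro κ hκ
  induction hκ using Submodule.span_induction with
  | mem κ hκ =>
    obtain ⟨φ, hφ, rfl⟩ := hκ
    change inner ℂ (u - ∑ i, h2 i i) hφ.memLp.toLp = _
    rw [inner_testJet, inner_sub_left, sum_inner, sub_eq_add_neg, ← Finset.sum_neg_distrib]
    congr 1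
    apply Finset.sum_congr rfl
    intro i _
    rw [inner_toLp_testFunction _ hφ, inner_toLp_testFunction _ (hφ.partialDeriv i), ← map_neg]
    congr 1
    -- The gradients in the H¹₀ and the H² part of the hypothesis are given separately. They agree
    -- when tested against a derivative of a test function, which is all that is needed.
    have e1 : ∫ x in Ω, w' i x * (starRingEnd ℂ) (partialDeriv i φ x) =
        ∫ x in Ω, w i x * (starRingEnd ℂ) (partialDeriv i φ x) := by
      have a1 := hw' i _ (hφ.partialDeriv i).conj
      have a2 := hw i _ (hφ.partialDeriv i).conj
      exact neg_injective (a1.symm.trans a2)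
    have e2 := hh i i _ hφ.conj
    simp only [partialDeriv_conj hφ] at e2
    rw [e1, e2]
  | zero =>
    change inner ℂ (u - ∑ i, h2 i i) (0 : L2 Ω) = inner ℂ _ 0
    rw [inner_zero_right, inner_zero_right]
  | add a b _ _ ha hb =>
    change inner ℂ (u - ∑ i, h2 i i) (a none + b none) = inner ℂ _ (a + b)
    rw [inner_add_right, inner_add_right]
    exact congrArg₂ (· + ·) ha hb
  | smul c a _ ha =>
    change inner ℂ (u - ∑ i, h2 i i) (c • a none) = inner ℂ _ (c • a)
    rw [inner_smul_right, inner_smul_right]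
    exact congrArg (c * ·) ha

theorem isPositive_dirichletResolvent : (dirichletResolvent Ω).IsPositive :=
  ContinuousLinearMap.isPositive_self_comp_adjoint _

theorem norm_jetToL2_apply_le (z : jetSpace Ω) : ‖jetToL2 Ω z‖ ≤ ‖z‖ :=
  PiLp.norm_apply_le (z : PiLp 2 (fun _ : Option (Fin d) => L2 Ω)) none

theorem norm_dirichletResolvent_le : ‖dirichletResolvent Ω‖ ≤ 1 := by
  have h1 : ‖jetToL2 Ω‖ ≤ 1 := ContinuousLinearMap.opNorm_le_bound _ zero_le_one
    (fun z => by rw [one_mul]; exact norm_jetToL2_apply_le z)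
  refine (ContinuousLinearMap.opNorm_comp_le _ _).trans ?_
  rw [LinearIsometryEquiv.norm_map]
  nlinarith [norm_nonneg (jetToL2 Ω)]

/-- From j j* x = 0 follows j* x = 0, so x is orthogonal to all test functions and vanishes by the
fundamental lemma of the calculus of variations. -/
theorem eq_zero_of_dirichletResolvent (hΩ : IsOpen Ω) {x : L2 Ω}
    (hx : dirichletResolvent Ω x = 0) : x = 0 := by
  have h1 : ContinuousLinearMap.adjoint (jetToL2 Ω) x = 0 := by
    rw [← inner_self_eq_zero (𝕜 := ℂ), ContinuousLinearMap.adjoint_inner_left]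
    change inner ℂ x (dirichletResolvent Ω x) = 0
    rw [hx, inner_zero_right]
  have h2 : ∀ φ : EuclideanSpace ℝ (Fin d) → ℂ, ∀ hφ : IsTestFunction Ω φ,
      ∫ y in Ω, x y * (starRingEnd ℂ) (φ y) = 0 := by
    intro φ hφ
    have h3 : inner ℂ x hφ.memLp.toLp = 0 := by
      have h4 := ContinuousLinearMap.adjoint_inner_left (jetToL2 Ω) ⟨_, testJet_mem hφ⟩ x
      rw [h1, inner_zero_left] at h4
      exact h4.symm
    rw [inner_toLp_testFunction x hφ] at h3
    simpa using h3
  have hloc : LocallyIntegrableOn x Ω volume :=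
    locallyIntegrableOn_of_locallyIntegrable_restrict
      ((Lp.memLp x).locallyIntegrable one_le_two)
  have h5 := hΩ.ae_eq_zero_of_integral_contDiff_smul_eq_zero hloc (fun g hg hgc hgs => ?_)
  · rw [Lp.eq_zero_iff_ae_eq_zero]
    exact (ae_restrict_iff' hΩ.measurableSet).mpr h5
  · have hφ : IsTestFunction Ω (fun y => (g y : ℂ)) := by
      have hs : Function.support (fun y => (g y : ℂ)) = Function.support g := by ext y; simp
      have ht : tsupport (fun y => (g y : ℂ)) = tsupport g := by unfold tsupport; rw [hs]
      refine ⟨Complex.ofRealCLM.contDiff.comp hg, ?_, by rw [ht]; exact hgs⟩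
      unfold HasCompactSupport
      rw [ht]
      exact hgc
    have h6 := h2 _ hφ
    rw [← h6, ← setIntegral_eq_integral_of_forall_compl_eq_zero (s := Ω)]
    · congr 1
      funext y
      rw [Complex.conj_ofReal, Complex.real_smul, mul_comm]
    · intro y hy
      have : g y = 0 := by
        by_contra h0
        exact hy (hgs (subset_tsupport g h0))
      rw [this, zero_smul]

/-- The orthogonal complement of the range of a symmetric operator is its kernel. -/
theorem dense_range_dirichletResolvent (hΩ : IsOpen Ω) : DenseRange (dirichletResolvent Ω) := by
  have h1 : (LinearMap.range (dirichletResolvent Ω).toLinearMap)ᗮ = ⊥ := by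
    rw [Submodule.eq_bot_iff]
    intro x hx
    apply eq_zero_of_dirichletResolvent hΩ
    refine ext_inner_right ℂ fun y => ?_
    rw [inner_zero_left]
    refine (isPositive_dirichletResolvent.isSymmetric x y).trans ?_
    exact (Submodule.mem_orthogonal' _ _).mp hx _ ⟨y, rfl⟩
  have h2 := (Submodule.topologicalClosure_eq_top_iff
    (K := LinearMap.range (dirichletResolvent Ω).toLinearMap)).mpr h1
  exact Submodule.dense_iff_topologicalClosure_eq_top.mpr h2

end Resolvent

end Subdiffusion

namespace Subdiffusion

/-! ### Fractional integrals and representation of the solution -/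

section FracIntegral

variable {F G : Type*} [NormedAddCommGroup F] [NormedSpace ℝ F] [NormedAddCommGroup G]
  [NormedSpace ℝ G]

theorem fracIntegral_congr {β t : ℝ} (ht : 0 ≤ t) {f g : ℝ → F}
    (h : ∀ s ∈ Set.Ioc 0 t, f s = g s) : fracIntegral β f t = fracIntegral β g t := by
  unfold fracIntegral
  congr 1
  apply intervalIntegral.integral_congr_ae
  refine Eventually.of_forall fun s hs => ?_
  rw [Set.uIoc_of_le ht] at hs
  simp only [h s hs]

theorem fracIntegral_sub {β t : ℝ} {f g : ℝ → F}
    (hf : IntervalIntegrable (fun s => (t - s) ^ (β - 1) • f s) volume 0 t)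
    (hg : IntervalIntegrable (fun s => (t - s) ^ (β - 1) • g s) volume 0 t) :
    fracIntegral β (fun s => f s - g s) t = fracIntegral β f t - fracIntegral β g t := by
  unfold fracIntegral
  simp only [smul_sub]
  rw [intervalIntegral.integral_sub hf hg, smul_sub]

theorem fracIntegral_one (f : ℝ → F) (t : ℝ) :
    fracIntegral 1 f t = ∫ s in (0 : ℝ)..t, f s := by
  unfold fracIntegral
  simp

theorem intervalIntegrable_clm {β t : ℝ} (L : F →L[ℝ] G) {f : ℝ → F}
    (hf : IntervalIntegrable (fun s => (t - s) ^ (β - 1) • f s) volume 0 t) :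
    IntervalIntegrable (fun s => (t - s) ^ (β - 1) • L (f s)) volume 0 t := by
  have : (fun s => (t - s) ^ (β - 1) • L (f s)) = fun s => L ((t - s) ^ (β - 1) • f s) := by
    funext s; rw [map_smul]
  rw [this]
  exact ⟨L.integrable_comp hf.1, L.integrable_comp hf.2⟩

/-- Uniqueness for linear Volterra equations with a weakly singular kernel. -/
theorem eq_zero_of_eq_fracIntegral {α T : ℝ} (hα0 : 0 < α) (B : F →L[ℝ] F) {D : ℝ → F}
    (hcont : ContinuousOn D (Set.Icc 0 T))
    (hD : ∀ t ∈ Set.Ioc 0 T, D t = B (fracIntegral α D t)) : ∀ t ∈ Set.Ioc 0 T, D t = 0 := by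
  intro t₀ ht₀
  obtain ⟨M, hM⟩ := isCompact_Icc.exists_bound_of_continuousOn hcont
  have hM0 : 0 ≤ M := (norm_nonneg _).trans (hM t₀ ⟨ht₀.1.le, ht₀.2⟩)
  -- Iterating the equation j times bounds the solution by a term of a Mittag-Leffler series, and
  -- these tend to zero.
  have key : ∀ j : ℕ, ∀ t ∈ Set.Ioc 0 T,
      ‖D t‖ ≤ M * (‖B‖ ^ j * (t ^ (α * j) / Real.Gamma (α * j + 1))) := by
    intro j
    induction j with
    | zero =>
      intro t ht
      simpa using hM t ⟨ht.1.le, ht.2⟩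
    | succ j ih =>
      intro t ht
      have hj : 0 < α * j + 1 := by positivity
      have hΓ := Real.Gamma_pos_of_pos hj
      have hΓα := Real.Gamma_pos_of_pos hα0
      have hi := intervalIntegrable_sub_rpow_mul_rpow hα0 hj ht.1
      have h1 : ‖∫ s in (0 : ℝ)..t, (t - s) ^ (α - 1) • D s‖ ≤
          ∫ s in (0 : ℝ)..t, M * ‖B‖ ^ j / Real.Gamma (α * j + 1) *
            ((t - s) ^ (α - 1) * s ^ (α * j + 1 - 1)) := by
        refine intervalIntegral.norm_integral_le_of_norm_le ht.1.le
          (Eventually.of_forall fun s hs => ?_) (hi.const_mul _)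
        have h2 := ih s ⟨hs.1, hs.2.trans ht.2⟩
        have h3 : 0 ≤ (t - s) ^ (α - 1) := Real.rpow_nonneg (by linarith [hs.2]) _
        rw [norm_smul, Real.norm_of_nonneg h3, add_sub_cancel_right]
        calc _ ≤ (t - s) ^ (α - 1) *
              (M * (‖B‖ ^ j * (s ^ (α * j) / Real.Gamma (α * j + 1)))) := by gcongr
          _ = _ := by ring
      rw [intervalIntegral.integral_const_mul, integral_sub_rpow_mul_rpow hα0 hj ht.1] at h1
      rw [hD t ht]
      unfold fracIntegral
      calc _ ≤ ‖B‖ * ‖(Real.Gamma α)⁻¹ • ∫ s in (0 : ℝ)..t, (t - s) ^ (α - 1) • D s‖ :=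
            B.le_opNorm _
        _ = ‖B‖ * ((Real.Gamma α)⁻¹ * ‖∫ s in (0 : ℝ)..t, (t - s) ^ (α - 1) • D s‖) := by
            rw [norm_smul, Real.norm_of_nonneg (inv_pos.mpr hΓα).le]
        _ ≤ ‖B‖ * ((Real.Gamma α)⁻¹ * (M * ‖B‖ ^ j / Real.Gamma (α * j + 1) *
            (Real.Gamma α * Real.Gamma (α * j + 1) / Real.Gamma (α * j + 1 + α) *
              t ^ (α * j + 1 + α - 1)))) := by gcongr
        _ = _ := by
            rw [show α * ((j + 1 : ℕ) : ℝ) + 1 = α * j + 1 + α by push_cast; ring,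
              show α * ((j + 1 : ℕ) : ℝ) = α * j + 1 + α - 1 by push_cast; ring, pow_succ]
            field_simp
  have hsum := (hasSum_mlKernel hα0 one_pos ht₀.1 ‖B‖).summable.tendsto_atTop_zero
  have h0 : Tendsto (fun j : ℕ => M * (‖B‖ ^ j * (t₀ ^ (α * j) / Real.Gamma (α * j + 1))))
      atTop (𝓝 0) := by
    have := hsum.const_mul M
    rw [mul_zero] at this
    refine this.congr fun j => ?_
    rw [add_sub_cancel_right, smul_eq_mul]
    ring
  have := ge_of_tendsto' h0 (fun j => key j t₀ ht₀)
  exact norm_le_zero_iff.mp this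

variable [CompleteSpace F] [CompleteSpace G]

theorem fracIntegral_clm {β t : ℝ} (L : F →L[ℝ] G) {f : ℝ → F}
    (hf : IntervalIntegrable (fun s => (t - s) ^ (β - 1) • f s) volume 0 t) :
    fracIntegral β (fun s => L (f s)) t = L (fracIntegral β f t) := by
  unfold fracIntegral
  rw [map_smul, ← L.intervalIntegral_comp_comm hf]
  simp only [map_smul]

/-- The kernel of the composition of two fractional integrals. -/
noncomputable def fracKernel (α t s r : ℝ) : ℝ :=
  if r < s then (t - s) ^ (α - 1) * (s - r) ^ (1 - α - 1) else 0

theorem measurable_fracKernel (α t : ℝ) :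
    Measurable (fun z : ℝ × ℝ => fracKernel α t z.1 z.2) := by
  unfold fracKernel
  refine Measurable.ite (measurableSet_lt measurable_snd measurable_fst) ?_ measurable_const
  exact ((measurable_const.sub measurable_fst).pow_const _).mul
    ((measurable_fst.sub measurable_snd).pow_const _)

/-- A Beta integral whose exponents α and 1 - α add up to one, so the value does not depend on r or
t. -/
theorem integral_fracKernel {α t r : ℝ} (hα0 : 0 < α) (hα1 : α < 1) (hr : r ∈ Set.Ioo 0 t) :
    IntegrableOn (fun s => fracKernel α t s r) (Set.Ioc 0 t) ∧
      ∫ s in Set.Ioc 0 t, fracKernel α t s r = Real.Gamma α * Real.Gamma (1 - α) := by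
  have htr : 0 < t - r := by linarith [hr.2]
  have h1 : (fun s => fracKernel α t s r) =
      (Set.Ioi r).indicator (fun s => (t - s) ^ (α - 1) * (s - r) ^ (1 - α - 1)) := by
    funext s
    simp only [fracKernel, Set.indicator, Set.mem_Ioi]
  have h2 : Set.Ioc 0 t ∩ Set.Ioi r = Set.Ioc r t := by
    ext s
    simp only [Set.mem_inter_iff, Set.mem_Ioc, Set.mem_Ioi]
    constructor
    · rintro ⟨⟨_, h⟩, h'⟩; exact ⟨h', h⟩
    · rintro ⟨h, h'⟩; exact ⟨⟨hr.1.trans h, h'⟩, h⟩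
  have h3 : ∀ s : ℝ, (t - s) ^ (α - 1) * (s - r) ^ (1 - α - 1) =
      (fun y => (t - r - y) ^ (α - 1) * y ^ (1 - α - 1)) (s - r) := by
    intro s
    simp only [sub_sub_sub_cancel_right]
  have h4 : IntervalIntegrable (fun s => (t - s) ^ (α - 1) * (s - r) ^ (1 - α - 1))
      volume r t := by
    simp only [h3]
    have h5 := intervalIntegrable_sub_rpow_mul_rpow hα0 (by linarith : 0 < 1 - α) htr
    have h6 := h5.comp_sub_right r
    simpa using h6
  constructor
  · rw [h1, IntegrableOn, integrable_indicator_iff measurableSet_Ioi, IntegrableOn,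
      Measure.restrict_restrict measurableSet_Ioi, Set.inter_comm, h2]
    exact (intervalIntegrable_iff_integrableOn_Ioc_of_le hr.2.le).mp h4
  · rw [h1, setIntegral_indicator measurableSet_Ioi, h2,
      ← intervalIntegral.integral_of_le hr.2.le]
    simp only [h3]
    rw [intervalIntegral.integral_comp_sub_right
      (fun y => (t - r - y) ^ (α - 1) * y ^ (1 - α - 1)), sub_self,
      integral_sub_rpow_mul_rpow hα0 (by linarith : 0 < 1 - α) htr]
    rw [show 1 - α + α = 1 by ring, Real.Gamma_one, sub_self, Real.rpow_zero]
    ring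

theorem fracKernel_nonneg {α t s : ℝ} (r : ℝ) (hs : s ≤ t) : 0 ≤ fracKernel α t s r := by
  unfold fracKernel
  split_ifs with h
  · exact mul_nonneg (Real.rpow_nonneg (by linarith) _) (Real.rpow_nonneg (by linarith) _)
  · exact le_rfl

/-- The semigroup property of fractional integrals. -/
theorem fracIntegral_fracIntegral {α t : ℝ} (hα0 : 0 < α) (hα1 : α < 1) (ht : 0 < t)
    {V : ℝ → F} (hV : IntervalIntegrable V volume 0 t) :
    fracIntegral α (fracIntegral (1 - α) V) t = ∫ s in (0 : ℝ)..t, V s := by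
  set ν : Measure ℝ := volume.restrict (Set.Ioc 0 t) with hν
  have hVν : Integrable V ν := (intervalIntegrable_iff_integrableOn_Ioc_of_le ht.le).mp hV
  set f : ℝ → ℝ → F := fun s r => fracKernel α t s r • V r with hf
  have hmeas : AEStronglyMeasurable (Function.uncurry f) (ν.prod ν) :=
    (measurable_fracKernel α t).aestronglyMeasurable.smul hVν.aestronglyMeasurable.comp_snd
  have hae : ∀ᵐ r ∂ν, r ∈ Set.Ioo 0 t := by
    rw [hν, ← Measure.restrict_congr_set Ioo_ae_eq_Ioc]
    exact ae_restrict_mem measurableSet_Ioo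
  -- Fubini's theorem is justified in the order where the kernel is integrated first, since its
  -- integral is constant.
  have hint : Integrable (Function.uncurry f) (ν.prod ν) := by
    rw [integrable_prod_iff' hmeas]
    constructor
    · filter_upwards [hae] with r hr
      exact (integral_fracKernel hα0 hα1 hr).1.smul_const (V r)
    · refine (hVν.norm.const_mul (Real.Gamma α * Real.Gamma (1 - α))).congr ?_
      filter_upwards [hae] with r hr
      rw [← (integral_fracKernel hα0 hα1 hr).2, ← integral_mul_const]
      apply setIntegral_congr_fun measurableSet_Ioc
      intro s hs
      simp only [Function.uncurry, hf, norm_smul]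
      rw [Real.norm_of_nonneg (fracKernel_nonneg r hs.2)]
  have hswap := integral_integral_swap hint
  have hR : ∫ r, ∫ s, f s r ∂ν ∂ν =
      (Real.Gamma α * Real.Gamma (1 - α)) • ∫ s in (0 : ℝ)..t, V s := by
    rw [intervalIntegral.integral_of_le ht.le, ← integral_smul]
    apply integral_congr_ae
    filter_upwards [hae] with r hr
    simp only [hf]
    rw [integral_smul_const, (integral_fracKernel hα0 hα1 hr).2]
  have hL : ∫ s, ∫ r, f s r ∂ν ∂ν =
      ∫ s in (0 : ℝ)..t, (t - s) ^ (α - 1) • ∫ r in (0 : ℝ)..s, (s - r) ^ (1 - α - 1) • V r := by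
    rw [intervalIntegral.integral_of_le ht.le]
    apply setIntegral_congr_fun measurableSet_Ioc
    intro s hs
    have h1 : (fun r => f s r) = (Set.Iio s).indicator
        (fun r => (t - s) ^ (α - 1) • (s - r) ^ (1 - α - 1) • V r) := by
      funext r
      simp only [hf, fracKernel, Set.indicator, Set.mem_Iio]
      split_ifs
      · rw [mul_smul]
      · rw [zero_smul]
    have h2 : Set.Ioc 0 t ∩ Set.Iio s = Set.Ioo 0 s := by
      ext r
      simp only [Set.mem_inter_iff, Set.mem_Ioc, Set.mem_Iio, Set.mem_Ioo]
      constructor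
      · rintro ⟨⟨h, _⟩, h'⟩; exact ⟨h, h'⟩
      · rintro ⟨h, h'⟩; exact ⟨⟨h, h'.le.trans hs.2⟩, h'⟩
    change ∫ r, f s r ∂ν = _
    rw [h1, hν, setIntegral_indicator measurableSet_Iio, h2, integral_smul]
    simp only [intervalIntegral.integral_of_le hs.1.le, integral_Ioc_eq_integral_Ioo]
  rw [hL, hR] at hswap
  unfold fracIntegral
  simp only [smul_comm _ (Real.Gamma (1 - α))⁻¹]
  rw [intervalIntegral.integral_smul, hswap, smul_smul, smul_smul]
  have g1 := (Real.Gamma_pos_of_pos hα0).ne'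
  have g2 := (Real.Gamma_pos_of_pos (by linarith : 0 < 1 - α)).ne'
  rw [show (Real.Gamma α)⁻¹ * (Real.Gamma (1 - α))⁻¹ * (Real.Gamma α * Real.Gamma (1 - α)) = 1 by
    field_simp, one_smul]

end FracIntegral

end Subdiffusion

namespace Subdiffusion

/-! ### Mittag-Leffler representation of the solution -/

section Representation

variable {𝔸 F : Type*} [NormedRing 𝔸] [NormedAlgebra ℝ 𝔸] [CompleteSpace 𝔸]
  [NormedAddCommGroup F] [NormedSpace ℝ F]

/-- The solution of the fractional equation with a bounded operator `-b`. -/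
noncomputable def mlSolution (act : 𝔸 →L[ℝ] F →L[ℝ] F) (α μ : ℝ) (b : 𝔸) (v q : F) (t : ℝ) : F :=
  Real.Gamma (μ + 1) • act (mlKernel α (α + μ + 1) t (-b)) q -
    act b (act (mlKernel α (α + 1) t (-b)) v)

variable {act : 𝔸 →L[ℝ] F →L[ℝ] F}

theorem continuousOn_mlSolution {α μ : ℝ} (hα : 0 < α) (hμ : -1 < μ) (b : 𝔸) (v q : F) :
    ContinuousOn (mlSolution act α μ b v q) (Set.Ioi 0) := by
  unfold mlSolution
  have h1 := continuousOn_mlKernel hα (by linarith : 0 < α + μ + 1) (-b)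
  have h2 := continuousOn_mlKernel hα (by linarith : 0 < α + 1) (-b)
  refine ContinuousOn.sub (ContinuousOn.const_smul ?_ _) ?_
  · exact (act.flip q).continuous.comp_continuousOn h1
  · exact (act b).continuous.comp_continuousOn ((act.flip v).continuous.comp_continuousOn h2)

theorem intervalIntegrable_of_sub_rpow_smul {α T : ℝ} (hα : 0 < α) (hT : 0 < T) {V : ℝ → F}
    (h : IntervalIntegrable (fun s => (T - s) ^ (-α) • V s) volume 0 T) :
    IntervalIntegrable V volume 0 T := by
  have hc : Continuous fun s : ℝ => (T - s) ^ α :=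
    (continuous_const.sub continuous_id).rpow_const fun _ => Or.inr hα.le
  have h1 := h.continuousOn_smul hc.continuousOn
  rw [intervalIntegrable_iff_integrableOn_Ioo_of_le hT.le] at h1 ⊢
  refine h1.congr_fun (fun s hs => ?_) measurableSet_Ioo
  have : 0 < T - s := by linarith [hs.2]
  simp only
  rw [smul_smul, ← Real.rpow_add this, add_neg_cancel, Real.rpow_zero, one_smul]

variable [CompleteSpace F]

theorem fracIntegral_mlKernel_apply {α β γ t : ℝ} (hα : 0 < α) (hβ : 0 < β) (hγ : 0 < γ)
    (ht : 0 < t) (L : 𝔸 →L[ℝ] F) (b : 𝔸) :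
    IntervalIntegrable (fun s => (t - s) ^ (γ - 1) • L (mlKernel α β s b)) volume 0 t ∧
      fracIntegral γ (fun s => L (mlKernel α β s b)) t = L (mlKernel α (β + γ) t b) := by
  obtain ⟨h1, h2⟩ := fracIntegral_mlKernel hα hβ hγ ht b
  exact ⟨intervalIntegrable_clm L h1, by rw [fracIntegral_clm L h1, h2]⟩

theorem fracIntegral_mlSolution {α μ γ t : ℝ} (hα : 0 < α) (hμ : -1 < μ) (hγ : 0 < γ) (ht : 0 < t)
    (b : 𝔸) (v q : F) :
    IntervalIntegrable (fun s => (t - s) ^ (γ - 1) • mlSolution act α μ b v q s) volume 0 t ∧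
      fracIntegral γ (mlSolution act α μ b v q) t =
        Real.Gamma (μ + 1) • act (mlKernel α (α + μ + 1 + γ) t (-b)) q -
          act b (act (mlKernel α (α + 1 + γ) t (-b)) v) := by
  obtain ⟨h1, h2⟩ := fracIntegral_mlKernel_apply hα (by linarith : 0 < α + μ + 1) hγ ht
    (act.flip q) (-b)
  obtain ⟨h3, h4⟩ := fracIntegral_mlKernel_apply hα (by linarith : 0 < α + 1) hγ ht
    (act.flip v) (-b)
  have h5 := intervalIntegrable_clm (Real.Gamma (μ + 1) • ContinuousLinearMap.id ℝ F) h1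
  have h6 := intervalIntegrable_clm (act b) h3
  constructor
  · have := h5.sub h6
    simp only [← smul_sub] at this
    exact this
  · have h7 := fracIntegral_sub h5 h6
    rw [fracIntegral_clm _ h1, fracIntegral_clm _ h3, h2, h4] at h7
    exact h7

/-- Both fractional integrals of the solution that enter the integrated equation. -/
theorem fracIntegral_mlSolution_eq {α μ t : ℝ} (hα : 0 < α) (hα1 : α < 1) (hμ : -1 < μ)
    (ht : 0 < t) (hone : ∀ x, act 1 x = x) (hmul : ∀ a c x, act (a * c) x = act a (act c x))
    (b : 𝔸) (v q : F) :
    fracIntegral (1 - α) (mlSolution act α μ b v q) t =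
      -act b (∫ s in (0 : ℝ)..t, mlSolution act α μ b v q s) - t • act b v +
        (t ^ (μ + 1) / (μ + 1)) • q := by
  have h1 := (fracIntegral_mlSolution (act := act) hα hμ (by linarith : 0 < 1 - α) ht b v q).2
  have h2 := (fracIntegral_mlSolution (act := act) hα hμ one_pos ht b v q).2
  rw [fracIntegral_one] at h2
  rw [h1, h2]
  -- Applying J^(1-α) and J¹ to the kernel gives the second parameters μ + 2 and μ + 2 + α, which
  -- the recursion of the series connects.
  have e1 : mlKernel α (α + μ + 1 + (1 - α)) t (-b) = (t ^ (μ + 1) / Real.Gamma (μ + 2)) • 1 +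
      -b * mlKernel α (α + μ + 1 + 1) t (-b) := by
    have := mlKernel_eq_add hα (by linarith : 0 < μ + 2) ht (-b)
    rw [show α + μ + 1 + (1 - α) = μ + 2 by ring, this, show μ + 2 - 1 = μ + 1 by ring,
      show μ + 2 + α = α + μ + 1 + 1 by ring]
  have e2 : mlKernel α (α + 1 + (1 - α)) t (-b) = t • 1 +
      -b * mlKernel α (α + 1 + 1) t (-b) := by
    have := mlKernel_eq_add hα (by linarith : (0 : ℝ) < 2) ht (-b)
    rw [show α + 1 + (1 - α) = 2 by ring, this, show (2 : ℝ) + α = α + 1 + 1 by ring,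
      show (2 : ℝ) - 1 = 1 by norm_num, Real.rpow_one, Real.Gamma_two, div_one]
  have hΓ : Real.Gamma (μ + 1) * (t ^ (μ + 1) / Real.Gamma (μ + 2)) = t ^ (μ + 1) / (μ + 1) := by
    have h3 := (Real.Gamma_pos_of_pos (by linarith : 0 < μ + 1)).ne'
    have h4 : μ + 1 ≠ 0 := by linarith
    rw [show μ + 2 = μ + 1 + 1 by ring, Real.Gamma_add_one h4]
    field_simp
  rw [e1, e2]
  simp only [map_add, map_smul, map_sub, map_neg, hmul, hone, add_apply,
    smul_apply, neg_apply, smul_add, smul_smul, hΓ]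
  module

/-- The difference w of two solutions of the integrated equation satisfies J^(1-α) w = -b ∫ w.
Applying J^α turns this into a Volterra equation for the primitive of w, which must vanish, and w is
its derivative. -/
theorem eq_mlSolution {α μ T : ℝ} (hα0 : 0 < α) (hα1 : α < 1) (hμ : -1 < μ) (hT : 0 < T)
    (hone : ∀ x, act 1 x = x) (hmul : ∀ a c x, act (a * c) x = act a (act c x))
    {b : 𝔸} {v q : F} {V : ℝ → F} (hcont : ContinuousOn V (Set.Ioc 0 T))
    (hint : ∀ t ∈ Set.Ioc 0 T, IntervalIntegrable (fun s => (t - s) ^ (-α) • V s) volume 0 t)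
    (hinit : Tendsto (fracIntegral (1 - α) V) (𝓝[>] 0) (𝓝 0))
    (heq : ∀ t ∈ Set.Ioc 0 T, HasDerivWithinAt (fracIntegral (1 - α) V)
      (-act b (V t + v) + t ^ μ • q) (Set.Ioc 0 T) t) :
    ∀ t ∈ Set.Ioc 0 T, V t = mlSolution act α μ b v q t := by
  set u : ℝ → F := fracIntegral (1 - α) V with hu
  have hVt : ∀ t ∈ Set.Ioc 0 T, IntervalIntegrable V volume 0 t := fun t ht =>
    intervalIntegrable_of_sub_rpow_smul hα0 ht.1 (hint t ht)
  have hu0 : u 0 = 0 := by simp [hu, fracIntegral]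
  have hucont : ∀ t ∈ Set.Ioc 0 T, ContinuousOn u (Set.Icc 0 t) := by
    intro t ht x hx
    rcases hx.1.eq_or_lt with h0 | h0
    · rw [← h0]
      have h1 : ContinuousWithinAt u (Set.Ioi 0) 0 := by
        unfold ContinuousWithinAt
        rw [hu0]
        exact hinit
      exact (continuousWithinAt_Ioi_iff_Ici.mp h1).mono Set.Icc_subset_Ici_self
    · have h1 := (heq x ⟨h0, hx.2.trans ht.2⟩).continuousWithinAt
      refine h1.mono_of_mem_nhdsWithin ?_
      rw [mem_nhdsWithin]
      exact ⟨Set.Ioi 0, isOpen_Ioi, h0, fun y hy => ⟨hy.1, hy.2.2.trans ht.2⟩⟩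
  -- Integration from 0 uses the zero initial value of J^(1-α) V, which makes u continuous up to 0.
  have hstep : ∀ t ∈ Set.Ioc 0 T, u t = -act b (∫ s in (0 : ℝ)..t, V s) - t • act b v +
      (t ^ (μ + 1) / (μ + 1)) • q := by
    intro t ht
    have hi1 : IntervalIntegrable (fun s => act b (V s)) volume 0 t :=
      ⟨(act b).integrable_comp (hVt t ht).1, (act b).integrable_comp (hVt t ht).2⟩
    have hi2 : IntervalIntegrable (fun s : ℝ => s ^ μ • q) volume 0 t :=
      have h := intervalIntegral.intervalIntegrable_rpow' (a := 0) (b := t) hμ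
      ⟨h.1.smul_const q, h.2.smul_const q⟩
    have hi3 : IntervalIntegrable (fun _ : ℝ => act b v) volume 0 t := intervalIntegrable_const
    have hi4 : IntervalIntegrable (fun s => -(act b (V s) + act b v)) volume 0 t :=
      (hi1.add hi3).neg
    have h1 : (fun s => -act b (V s + v) + s ^ μ • q) =
        fun s => -(act b (V s) + act b v) + s ^ μ • q := by
      funext s; rw [map_add]
    have h2 := intervalIntegral.integral_eq_sub_of_hasDerivAt_of_le ht.1.le (hucont t ht)
      (f' := fun s => -act b (V s + v) + s ^ μ • q) (fun s hs => ?_)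
      (by rw [h1]; exact hi4.add hi2)
    · rw [hu0, sub_zero] at h2
      rw [← h2, h1, intervalIntegral.integral_add hi4 hi2,
        intervalIntegral.integral_neg, intervalIntegral.integral_add hi1 hi3,
        (act b).intervalIntegral_comp_comm (hVt t ht), intervalIntegral.integral_const,
        intervalIntegral.integral_smul_const, integral_rpow (Or.inl hμ), sub_zero,
        Real.zero_rpow (by linarith), sub_zero]
      abel
    · have hs' : s ∈ Set.Ioc 0 T := ⟨hs.1, hs.2.le.trans ht.2⟩
      exact (heq s hs').hasDerivAt
        (mem_of_superset (Ioo_mem_nhds hs.1 (hs.2.trans_le ht.2)) Set.Ioo_subset_Ioc_self)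
  set S : ℝ → F := mlSolution act α μ b v q with hS
  have hSint : ∀ t ∈ Set.Ioc 0 T, IntervalIntegrable S volume 0 t := fun t ht => by
    simpa using (fracIntegral_mlSolution (act := act) hα0 hμ one_pos ht.1 b v q).1
  have hScont : ContinuousOn S (Set.Ioc 0 T) :=
    (continuousOn_mlSolution hα0 hμ b v q).mono fun t ht => ht.1
  set w : ℝ → F := fun s => V s - S s with hw
  have hwint : ∀ t ∈ Set.Ioc 0 T, IntervalIntegrable w volume 0 t := fun t ht =>
    (hVt t ht).sub (hSint t ht)
  have hwu : ∀ t ∈ Set.Ioc 0 T, fracIntegral (1 - α) w t = -act b (∫ s in (0 : ℝ)..t, w s) := by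
    intro t ht
    have h1 := hint t ht
    rw [show -α = 1 - α - 1 by ring] at h1
    have h2 := (fracIntegral_mlSolution (act := act) hα0 hμ (by linarith : 0 < 1 - α) ht.1 b v q)
    rw [hw, fracIntegral_sub h1 h2.1, intervalIntegral.integral_sub (hVt t ht) (hSint t ht),
      fracIntegral_mlSolution_eq hα0 hα1 hμ ht.1 hone hmul, ← hu, hstep t ht, map_sub]
    abel
  set D : ℝ → F := fun t => ∫ s in (0 : ℝ)..t, w s with hD
  have hDcont : ContinuousOn D (Set.Icc 0 T) := by
    have h1 := intervalIntegral.continuousOn_primitive_interval'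
      (hwint T ⟨hT, le_rfl⟩) Set.left_mem_uIcc
    rwa [Set.uIcc_of_le hT.le] at h1
  have hD0 : ∀ t ∈ Set.Ioc 0 T, D t = 0 := by
    refine eq_zero_of_eq_fracIntegral hα0 (-act b) hDcont fun t ht => ?_
    have h1 := fracIntegral_fracIntegral hα0 hα1 ht.1 (hwint t ht)
    rw [fracIntegral_congr ht.1.le (g := fun s => (-act b) (D s))
      (fun s hs => hwu s ⟨hs.1, hs.2.trans ht.2⟩), fracIntegral_clm] at h1
    · exact h1.symm
    · have h2 : IntervalIntegrable (fun s : ℝ => (t - s) ^ (α - 1)) volume 0 t := by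
        have := intervalIntegrable_sub_rpow_mul_rpow hα0 one_pos ht.1
        simpa using this
      refine h2.smul_continuousOn ?_
      rw [Set.uIcc_of_le ht.1.le]
      exact hDcont.mono (Set.Icc_subset_Icc_right ht.2)
  intro t ht
  have hwcont : ContinuousOn w (Set.Ioc 0 T) := hcont.sub hScont
  have hnhds : Set.Ioc 0 T ∈ 𝓝[≤] t := by
    rw [mem_nhdsWithin]
    exact ⟨Set.Ioi 0, isOpen_Ioi, ht.1, fun y hy => ⟨hy.1, le_trans hy.2 ht.2⟩⟩
  -- A derivative from the left suffices and also covers t = T.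
  have hder : HasDerivWithinAt D (w t) (Set.Iic t) t := by
    apply intervalIntegral.integral_hasDerivWithinAt_right (hwint t ht)
    · exact ⟨Set.Ioc 0 T, hnhds, hwcont.aestronglyMeasurable measurableSet_Ioc⟩
    · exact (hwcont t ht).mono_of_mem_nhdsWithin hnhds
  have hzero : HasDerivWithinAt D 0 (Set.Iic t) t :=
    (hasDerivWithinAt_const t (Set.Iic t) (0 : F)).congr_of_eventuallyEq
      (mem_of_superset hnhds fun s hs => hD0 s hs) (hD0 t ht)
  have := (uniqueDiffWithinAt_Iic t).eq_deriv _ hder hzero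
  exact sub_eq_zero.mp this

end Representation

end Subdiffusion

namespace Subdiffusion

/-! ### Functional calculus -/

section Cutoff

variable {X : Type*} [TopologicalSpace X]

/-- A real continuous function as a complex one. -/
noncomputable def complexMap (b : C(X, ℝ)) : C(X, ℂ) :=
  ⟨fun x => (b x : ℂ), Complex.continuous_ofReal.comp b.continuous⟩

@[simp]
theorem complexMap_apply (b : C(X, ℝ)) (x : X) : complexMap b x = (b x : ℂ) := rfl

variable {H : Type*} [NormedAddCommGroup H] [InnerProductSpace ℂ H] [CompleteSpace H]

theorem mem_spectrum_of_isPositive {R : H →L[ℂ] H} (hR : R.IsPositive) (hR1 : ‖R‖ ≤ 1) {z : ℂ}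
    (hz : z ∈ spectrum ℂ R) : z = (z.re : ℂ) ∧ 0 ≤ z.re ∧ z.re ≤ 1 := by
  have h1 : z = (z.re : ℂ) := hR.isSelfAdjoint.mem_spectrum_eq_re hz
  have h2 : z.re ∈ spectrum ℝ R := by
    rw [← spectrum.algebraMap_mem_iff ℂ]
    change (z.re : ℂ) ∈ spectrum ℂ R
    rwa [← h1]
  refine ⟨h1, spectrum_nonneg_of_nonneg ((ContinuousLinearMap.nonneg_iff_isPositive R).mpr hR) h2,
    ?_⟩
  have h3 := spectrum.norm_le_norm_mul_of_mem hz
  have h4 : ‖(1 : H →L[ℂ] H)‖ ≤ 1 := ContinuousLinearMap.norm_id_le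
  have h5 : ‖R‖ * ‖(1 : H →L[ℂ] H)‖ ≤ 1 * 1 := by gcongr
  linarith [Complex.re_le_norm z]

/-- Spectral cut-offs that bound `A = 1 - R⁻¹`. -/
theorem exists_spectral_cutoff {R : H →L[ℂ] H} (hR : R.IsPositive) (hR1 : ‖R‖ ≤ 1) {ε : ℝ}
    (hε : 0 < ε) : ∃ (φ : C(spectrum ℂ R, ℂ)) (b : C(spectrum ℂ R, ℝ)),
      (∀ r, 0 ≤ b r) ∧ ‖φ‖ ≤ 1 ∧
      (∀ u f, R (u - f) = u → cfcHom hR.isSelfAdjoint.isStarNormal φ f =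
        -cfcHom hR.isSelfAdjoint.isStarNormal (complexMap b)
          (cfcHom hR.isSelfAdjoint.isStarNormal φ u)) ∧
      ∀ x, ‖cfcHom hR.isSelfAdjoint.isStarNormal φ (R x) - R x‖ ≤ 2 * ε * ‖x‖ := by
  set Φ := cfcHom (R := ℂ) hR.isSelfAdjoint.isStarNormal with hΦ
  have hmax : ∀ r : spectrum ℂ R, 0 < max (r : ℂ).re ε := fun r => lt_max_of_lt_right hε
  -- The cut-off is 0 for r ≤ ε and 1 for r ≥ 2ε. On its support max(r, ε) = r, so `b` represents -A
  -- = R⁻¹ - 1 there, while remaining continuous and nonnegative on the whole spectrum.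
  set f₀ : C(spectrum ℂ R, ℝ) := ⟨fun r => min 1 (max 0 ((r : ℂ).re / ε - 1)), by fun_prop⟩
    with hf₀
  set b : C(spectrum ℂ R, ℝ) := ⟨fun r => (1 - (r : ℂ).re) / max (r : ℂ).re ε, by
    refine Continuous.div (by fun_prop) (by fun_prop) fun r => (hmax r).ne'⟩ with hb
  set ψ₀ : C(spectrum ℂ R, ℝ) := ⟨fun r => f₀ r / max (r : ℂ).re ε, by
    refine Continuous.div (by fun_prop) (by fun_prop) fun r => (hmax r).ne'⟩ with hψ₀
  set ι : C(spectrum ℂ R, ℂ) := (ContinuousMap.id ℂ).restrict (spectrum ℂ R) with hι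
  have hιR : Φ ι = R := cfcHom_id hR.isSelfAdjoint.isStarNormal
  have hsp : ∀ r : spectrum ℂ R, ι r = ((r : ℂ).re : ℂ) := fun r =>
    (mem_spectrum_of_isPositive hR hR1 r.2).1
  have hf₀r : ∀ r, f₀ r = min 1 (max 0 ((r : ℂ).re / ε - 1)) := fun _ => rfl
  have hf₀0 : ∀ r, 0 ≤ f₀ r := fun r => le_min zero_le_one (le_max_left _ _)
  have hf₀1 : ∀ r, f₀ r ≤ 1 := fun r => min_le_left _ _
  have hcase : ∀ r, f₀ r = 0 ∨ max (r : ℂ).re ε = (r : ℂ).re := by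
    intro r
    rcases le_total (r : ℂ).re ε with h | h
    · left
      have : (r : ℂ).re / ε - 1 ≤ 0 := by
        rw [sub_nonpos, div_le_one hε]; exact h
      rw [hf₀r, max_eq_left this, min_eq_right zero_le_one]
    · exact Or.inr (max_eq_left h)
  have e1 : complexMap ψ₀ * ι = complexMap f₀ := by
    ext r
    rw [ContinuousMap.mul_apply, hsp, complexMap_apply, complexMap_apply, ← Complex.ofReal_mul]
    congr 1
    change f₀ r / max (r : ℂ).re ε * (r : ℂ).re = f₀ r
    rcases hcase r with h | h
    · rw [h]; simp
    · have := hmax r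
      rw [h] at this ⊢
      field_simp
  have e2 : complexMap f₀ - complexMap ψ₀ = -(complexMap b * complexMap f₀) := by
    ext r
    rw [ContinuousMap.sub_apply, ContinuousMap.neg_apply, ContinuousMap.mul_apply,
      complexMap_apply, complexMap_apply, complexMap_apply, ← Complex.ofReal_mul,
      ← Complex.ofReal_neg, ← Complex.ofReal_sub]
    congr 1
    change f₀ r - f₀ r / max (r : ℂ).re ε = -((1 - (r : ℂ).re) / max (r : ℂ).re ε * f₀ r)
    rcases hcase r with h | h
    · rw [h]; simp
    · have := hmax r
      rw [h] at this ⊢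
      field_simp
      ring
  refine ⟨complexMap f₀, b, fun r => div_nonneg ?_ (hmax r).le, ?_, fun u f huf => ?_,
    fun x => ?_⟩
  · linarith [(mem_spectrum_of_isPositive hR hR1 r.2).2.2]
  · rw [ContinuousMap.norm_le _ zero_le_one]
    intro r
    rw [complexMap_apply, Complex.norm_real, Real.norm_of_nonneg (hf₀0 r)]
    exact hf₀1 r
  -- Since ψ₀(r) r = f₀(r), the relation R(u - f) = u lets `A` be eliminated without ever inverting
  -- R.
  · have h1 : Φ (complexMap f₀) (u - f) = Φ (complexMap ψ₀) u := by
      rw [← e1, map_mul, hιR]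
      change Φ (complexMap ψ₀) (R (u - f)) = _
      rw [huf]
    have h2 : Φ (complexMap f₀ - complexMap ψ₀) u =
        -Φ (complexMap b) (Φ (complexMap f₀) u) := by
      rw [e2, map_neg, map_mul]
      rfl
    rw [← h2, map_sub]
    change _ = Φ (complexMap f₀) u - Φ (complexMap ψ₀) u
    rw [← h1, map_sub]
    abel
  · have h1 : Φ (complexMap f₀) (R x) - R x = Φ ((complexMap f₀ - 1) * ι) x := by
      rw [map_mul, map_sub, map_one, hιR]
      rfl
    rw [h1]
    refine (ContinuousLinearMap.le_opNorm _ _).trans ?_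
    gcongr
    refine (NonUnitalStarAlgHom.norm_apply_le Φ _).trans ?_
    rw [ContinuousMap.norm_le _ (by positivity)]
    intro r
    have h0 := (mem_spectrum_of_isPositive hR hR1 r.2).2.1
    rw [ContinuousMap.mul_apply, hsp, ContinuousMap.sub_apply, complexMap_apply,
      ContinuousMap.one_apply, ← Complex.ofReal_one, ← Complex.ofReal_sub, ← Complex.ofReal_mul,
      Complex.norm_real, Real.norm_eq_abs, abs_mul, abs_of_nonneg h0,
      abs_of_nonpos (by linarith [hf₀1 r])]
    rcases le_total (r : ℂ).re (2 * ε) with h | h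
    · have := hf₀0 r
      nlinarith
    · have : f₀ r = 1 := by
        rw [hf₀r]
        apply min_eq_left
        apply le_max_of_le_right
        rw [le_sub_iff_add_le, le_div_iff₀ hε]
        linarith
      rw [this]
      simp
      linarith

end Cutoff

/-! ### Representation of the discrete solution -/

theorem bdfWeight_zero_add_ne_zero {k : ℕ} {α x : ℝ} (hk1 : 1 ≤ k) (hk6 : k ≤ 6) (hα0 : 0 < α)
    (hα1 : α < 1) (hx : 0 ≤ x) : bdfWeight k α 0 + x ≠ 0 := by
  have h : bdfPoly k 0 ∈ Complex.slitPlane :=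
    bdfPoly_mem_slitPlane hk1 hk6 (by simp) (by simp)
  have := cpow_add_ofReal_ne_zero hα0 hα1 hx (Complex.slitPlane_ne_zero h)
  simpa [bdfWeight] using this

theorem schemeCoeff_eq {k m : ℕ} {α γ x : ℝ} (hk1 : 1 ≤ k) (hk6 : k ≤ 6) (hα0 : 0 < α)
    (hα1 : α < 1) (hγ : 0 < γ) (hx : 0 ≤ x) (n : ℕ) :
    schemeCoeff k m α γ x n = (schemeRhs k m γ n - ∑ j ∈ Finset.range n,
      bdfWeight k α (j + 1) * schemeCoeff k m α γ x (n - (j + 1))) / (bdfWeight k α 0 + x) := by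
  have h := schemeCoeff_recursion (m := m) hk1 hk6 hα0 hα1 hγ hx n
  rw [Finset.sum_range_succ'] at h
  rw [eq_div_iff (bdfWeight_zero_add_ne_zero hk1 hk6 hα0 hα1 hx), ← h, Nat.sub_zero]
  ring

/-- By the recursion each coefficient is a rational function of x without poles on [0, ∞), so the
continuous functional calculus can be applied to it. -/
theorem continuousOn_schemeCoeff {k m : ℕ} {α γ : ℝ} (hk1 : 1 ≤ k) (hk6 : k ≤ 6) (hα0 : 0 < α)
    (hα1 : α < 1) (hγ : 0 < γ) (n : ℕ) :
    ContinuousOn (fun x => schemeCoeff k m α γ x n) (Set.Ici 0) := by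
  induction n using Nat.strong_induction_on with
  | _ n ih =>
    have h1 : ContinuousOn (fun x : ℝ => (schemeRhs k m γ n - ∑ j ∈ Finset.range n,
        bdfWeight k α (j + 1) * schemeCoeff k m α γ x (n - (j + 1))) /
          (bdfWeight k α 0 + x)) (Set.Ici 0) := by
      refine ContinuousOn.div (continuousOn_const.sub (continuousOn_finsetSum _ fun j hj =>
        continuousOn_const.mul (ih _ ?_))) (by fun_prop)
        (fun x hx => bdfWeight_zero_add_ne_zero hk1 hk6 hα0 hα1 hx)
      have := Finset.mem_range.mp hj
      omega
    exact h1.congr fun x hx => schemeCoeff_eq hk1 hk6 hα0 hα1 hγ hx n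

section Discrete

variable {X H : Type*} [TopologicalSpace X] [AddCommGroup H] [Module ℂ H]

/-- The scheme is implicit only through ω₀ + κ; a left inverse determines each step from the
previous ones. -/
theorem eq_zero_of_discrete_recursion {B : Type*} [Ring B] [Algebra ℂ B] [Module B H]
    [IsScalarTower ℂ B H] {ω : ℕ → ℂ} {κ c : B} (hc : c * (algebraMap ℂ B (ω 0) + κ) = 1) {N : ℕ}
    {E : ℕ → H} (h0 : E 0 = 0) (hE : ∀ n, 1 ≤ n → n ≤ N →
      ∑ j ∈ Finset.range (n + 1), ω j • E (n - j) + κ • E n = 0) :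
    ∀ n ≤ N, E n = 0 := by
  intro n
  induction n using Nat.strong_induction_on with
  | _ n ih =>
    intro hn
    rcases Nat.eq_zero_or_pos n with rfl | hpos
    · exact h0
    · have h1 := hE n hpos hn
      rw [Finset.sum_range_succ', Finset.sum_eq_zero, zero_add, Nat.sub_zero] at h1
      · have h2 : (algebraMap ℂ B (ω 0) + κ) • E n = 0 := by
          rw [add_smul, algebraMap_smul]
          exact h1
        rw [← one_smul B (E n), ← hc, mul_smul, h2, smul_zero]
      · intro j hj
        have := Finset.mem_range.mp hj
        rw [ih (n - (j + 1)) (by omega) (by omega), smul_zero]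

end Discrete

end Subdiffusion

namespace Subdiffusion

/-! ### The smoothed source terms -/

theorem iteratedDeriv_pow_div_factorial (m : ℕ) (t : ℝ) :
    iteratedDeriv m (fun s : ℝ => ((s ^ m / (m.factorial : ℝ) : ℝ) : ℂ)) t = 1 := by
  induction m generalizing t with
  | zero => simp
  | succ m ih =>
    rw [iteratedDeriv_succ']
    rw [← ih t]
    congr 1
    funext s
    have h : HasDerivAt (fun s : ℝ => s ^ (m + 1) / ((m + 1).factorial : ℝ))
        (s ^ m / (m.factorial : ℝ)) s := by
      refine ((hasDerivAt_pow (m + 1) s).div_const _).congr_deriv ?_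
      have h1 : (m.factorial : ℝ) ≠ 0 := by exact_mod_cast m.factorial_ne_zero
      have h2 : ((m + 1 : ℕ) : ℝ) ≠ 0 := by exact_mod_cast m.succ_ne_zero
      rw [Nat.factorial_succ, Nat.add_sub_cancel]
      push_cast at h2 ⊢
      field_simp
    exact h.ofReal_comp.deriv

section Source

variable {d : ℕ} {Ω : Set (EuclideanSpace ℝ (Fin d))}

theorem smoothedSource_eq {m : ℕ} {μ : ℝ} (hm : 1 ≤ m) (hμ : -1 < μ) (q : L2 Ω) {t : ℝ}
    (ht : 0 ≤ t) : smoothedSource m μ q t =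
      (Real.Gamma (μ + 1) * (t ^ (μ + m) / Real.Gamma (μ + m + 1))) • q := by
  have hm0 : (0 : ℝ) < m := by exact_mod_cast hm
  unfold smoothedSource fracIntegral
  rcases ht.eq_or_lt with rfl | ht
  · have hm1 : (1 : ℝ) ≤ m := by exact_mod_cast hm
    rw [intervalIntegral.integral_same, Real.zero_rpow (by linarith)]
    simp
  · simp only [smul_smul]
    rw [intervalIntegral.integral_smul_const, smul_smul]
    congr 1
    have h := integral_sub_rpow_mul_rpow hm0 (by linarith : 0 < μ + 1) ht
    rw [add_sub_cancel_right] at h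
    rw [h, show μ + 1 + (m : ℝ) - 1 = μ + m by ring, show μ + 1 + (m : ℝ) = μ + m + 1 by ring]
    have := (Real.Gamma_pos_of_pos hm0).ne'
    field_simp

theorem iteratedDeriv_rpow_div_Gamma_smul {a : ℝ} (q : L2 Ω) (j : ℕ) (hj : (j : ℝ) < a + 1)
    {t : ℝ} (ht : 0 < t) :
    iteratedDeriv j (fun t : ℝ => (t ^ a / Real.Gamma (a + 1)) • q) t =
      (t ^ (a - j) / Real.Gamma (a - j + 1)) • q := by
  induction j generalizing t with
  | zero => simp
  | succ j ih =>
    push_cast at hj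
    have h1 : iteratedDeriv j (fun t : ℝ => (t ^ a / Real.Gamma (a + 1)) • q) =ᶠ[𝓝 t]
        fun t => (t ^ (a - j) / Real.Gamma (a - j + 1)) • q :=
      mem_of_superset (Ioi_mem_nhds ht) fun s hs => ih (by linarith) hs
    rw [iteratedDeriv_succ, h1.deriv_eq]
    have h2 := ((Real.hasDerivAt_rpow_const (p := a - j) (Or.inl ht.ne')).div_const
      (Real.Gamma (a - j + 1))).smul_const q
    rw [h2.deriv]
    congr 1
    have h3 : 0 < a - j := by linarith
    have h4 := (Real.Gamma_pos_of_pos h3).ne'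
    rw [Real.Gamma_add_one h3.ne', Nat.cast_succ, show a - ((j : ℝ) + 1) + 1 = a - j by ring,
      show a - ((j : ℝ) + 1) = a - j - 1 by ring]
    field_simp

theorem iteratedDeriv_smoothedSource {m : ℕ} {μ : ℝ} (hm : 1 ≤ m) (hμ : -1 < μ) (q : L2 Ω) {t : ℝ}
    (ht : 0 < t) : iteratedDeriv m (smoothedSource m μ q) t = t ^ μ • q := by
  have hΓ := (Real.Gamma_pos_of_pos (by linarith : 0 < μ + 1)).ne'
  have h1 : smoothedSource m μ q =ᶠ[𝓝 t]
      fun t => (t ^ (μ + m) / Real.Gamma (μ + m + 1)) • (Real.Gamma (μ + 1) • q) :=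
    mem_of_superset (Ioi_mem_nhds ht) fun s (hs : 0 < s) => by
      change smoothedSource m μ q s = _
      simp only
      rw [smoothedSource_eq hm hμ q hs.le, smul_smul, mul_comm]
  rw [h1.iteratedDeriv_eq, iteratedDeriv_rpow_div_Gamma_smul _ m (by linarith) ht, smul_smul,
    add_sub_cancel_right]
  congr 1
  field_simp

/-- The powers of τ cancel, so this term is the same for every step size. -/
theorem bdfCQ_pow_div_factorial {τ : ℝ} (hτ : 0 < τ) (k m n : ℕ) :
    bdfCQ τ k (m : ℝ) (fun i : ℕ => ((((i : ℝ) * τ) ^ m / (m.factorial : ℝ) : ℝ) : ℂ)) n =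
      schemeRhs k m m n := by
  unfold bdfCQ schemeRhs
  rw [Finset.smul_sum]
  apply Finset.sum_congr rfl
  intro j _
  have h : (τ ^ (-(m : ℝ)) : ℝ) * ((((n - j : ℕ) : ℝ) * τ) ^ m / (m.factorial : ℝ)) =
      ((n - j : ℕ) : ℝ) ^ (m : ℝ) / Real.Gamma (m + 1) := by
    rw [Real.Gamma_nat_eq_factorial, Real.rpow_neg hτ.le, Real.rpow_natCast, Real.rpow_natCast,
      mul_pow]
    field_simp
  rw [← h]
  simp only [smul_eq_mul]
  push_cast
  ring

theorem bdfCQ_smoothedSource {τ μ : ℝ} {k m : ℕ} (hτ : 0 < τ) (hm : 1 ≤ m) (hμ : -1 < μ)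
    (q : L2 Ω) (n : ℕ) :
    bdfCQ τ k (m : ℝ) (fun i : ℕ => smoothedSource m μ q ((i : ℝ) * τ)) n =
      (schemeRhs k m (μ + m) n * ((τ ^ μ * Real.Gamma (μ + 1) : ℝ) : ℂ)) • q := by
  unfold bdfCQ schemeRhs
  rw [Finset.smul_sum, Finset.sum_mul, Finset.sum_smul]
  apply Finset.sum_congr rfl
  intro j _
  have h0 : (0 : ℝ) ≤ (n - j : ℕ) := Nat.cast_nonneg _
  simp only
  rw [smoothedSource_eq hm hμ q (by positivity), Real.mul_rpow h0 hτ.le,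
    RCLike.real_smul_eq_coe_smul (K := ℂ), smul_smul, smul_smul]
  congr 1
  have h1 : τ ^ (-(m : ℝ)) * τ ^ (μ + m) = τ ^ μ := by
    rw [← Real.rpow_add hτ]; congr 1; ring
  rw [← h1]
  simp only [Complex.coe_algebraMap, RCLike.ofReal_mul, RCLike.ofReal_div, Complex.ofReal_mul,
    Complex.ofReal_div]
  ring

end Source

/-! ### The functional calculus and the scalar problems -/

/-- Applied to point evaluations, this identifies the kernel in the algebra of continuous functions
with the pointwise scalar one. -/
theorem map_mlKernel {𝔸 𝔹 : Type*} [NormedRing 𝔸] [NormedAlgebra ℝ 𝔸] [CompleteSpace 𝔸]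
    [NormedRing 𝔹] [NormedAlgebra ℝ 𝔹] [CompleteSpace 𝔹] (f : 𝔸 →ₐ[ℝ] 𝔹) (hf : Continuous f)
    {α β t : ℝ} (hα : 0 < α) (hβ : 0 < β) (ht : 0 < t) (b : 𝔸) :
    f (mlKernel α β t b) = mlKernel α β t (f b) := by
  have h1 := (hasSum_mlKernel hα hβ ht b).map f hf
  have h2 := hasSum_mlKernel hα hβ ht (f b)
  refine h1.unique ?_
  convert h2 using 2
  simp

section Calculus

variable {X : Type*} [TopologicalSpace X]

theorem exists_schemeMap {k m : ℕ} {α γ : ℝ} (hk1 : 1 ≤ k) (hk6 : k ≤ 6) (hα0 : 0 < α)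
    (hα1 : α < 1) (hγ : 0 < γ) (κ : C(X, ℝ)) (hκ : ∀ x, 0 ≤ κ x) :
    ∃ a : ℕ → C(X, ℂ), (∀ n x, a n x = schemeCoeff k m α γ (κ x) n) ∧
      ∀ n, ∑ j ∈ Finset.range (n + 1), bdfWeight k α j • a (n - j) + complexMap κ * a n =
        schemeRhs k m γ n • 1 := by
  refine ⟨fun n => ⟨fun x => schemeCoeff k m α γ (κ x) n,
    (continuousOn_schemeCoeff hk1 hk6 hα0 hα1 hγ n).comp_continuous κ.continuous hκ⟩,
    fun n x => rfl, fun n => ?_⟩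
  ext x
  have := schemeCoeff_recursion (m := m) hk1 hk6 hα0 hα1 hγ (hκ x) n
  simpa [ContinuousMap.sum_apply] using this

variable {H : Type*} [NormedAddCommGroup H] [InnerProductSpace ℂ H] [CompleteSpace H]

/-- Representation of the solution of the scheme. -/
theorem discrete_representation {k m : ℕ} {α γ₁ γ₂ : ℝ} (hk1 : 1 ≤ k) (hk6 : k ≤ 6) (hα0 : 0 < α)
    (hα1 : α < 1) (hγ₁ : 0 < γ₁) (hγ₂ : 0 < γ₂) (Φ : C(X, ℂ) →⋆ₐ[ℂ] (H →L[ℂ] H))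
    (κ : C(X, ℝ)) (hκ : ∀ x, 0 ≤ κ x) {a₁ a₂ : ℕ → C(X, ℂ)}
    (h1 : ∀ n x, a₁ n x = schemeCoeff k m α γ₁ (κ x) n)
    (h1r : ∀ n, ∑ j ∈ Finset.range (n + 1), bdfWeight k α j • a₁ (n - j) +
      complexMap κ * a₁ n = schemeRhs k m γ₁ n • 1)
    (h2 : ∀ n x, a₂ n x = schemeCoeff k m α γ₂ (κ x) n)
    (h2r : ∀ n, ∑ j ∈ Finset.range (n + 1), bdfWeight k α j • a₂ (n - j) +
      complexMap κ * a₂ n = schemeRhs k m γ₂ n • 1) {y z : H} {N : ℕ} {W : ℕ → H}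
    (hW0 : W 0 = 0) (hW : ∀ n, 1 ≤ n → n ≤ N →
      ∑ j ∈ Finset.range (n + 1), bdfWeight k α j • W (n - j) + Φ (complexMap κ) (W n) =
        schemeRhs k m γ₁ n • y + schemeRhs k m γ₂ n • z) :
    ∀ n ≤ N, W n = Φ (a₁ n) y + Φ (a₂ n) z := by
  have hrec : ∀ (a : ℕ → C(X, ℂ)) (ρ : ℕ → ℂ), (∀ n, ∑ j ∈ Finset.range (n + 1),
      bdfWeight k α j • a (n - j) + complexMap κ * a n = ρ n • 1) → ∀ (n : ℕ) (x : H),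
      ∑ j ∈ Finset.range (n + 1), bdfWeight k α j • Φ (a (n - j)) x +
        Φ (complexMap κ) (Φ (a n) x) = ρ n • x := by
    intro a ρ ha n x
    have h3 := congrArg (fun c => Φ c x) (ha n)
    simp only [map_add, map_sum, map_smul, map_mul, map_one] at h3
    simpa using h3
  have hzero : ∀ (γ : ℝ), 0 < γ → ∀ a : ℕ → C(X, ℂ),
      (∀ n x, a n x = schemeCoeff k m α γ (κ x) n) → a 0 = 0 := by
    intro γ hγ a ha
    ext x
    rw [ha, schemeCoeff_eq hk1 hk6 hα0 hα1 hγ (hκ x)]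
    simp [schemeRhs, Real.zero_rpow hγ.ne']
  set c : C(X, ℂ) := ⟨fun x => (bdfWeight k α 0 + κ x)⁻¹, by
    refine Continuous.inv₀ (by fun_prop) fun x => ?_
    exact bdfWeight_zero_add_ne_zero hk1 hk6 hα0 hα1 (hκ x)⟩ with hc
  have hc1 : c * (algebraMap ℂ C(X, ℂ) (bdfWeight k α 0) + complexMap κ) = 1 := by
    ext x
    exact inv_mul_cancel₀ (bdfWeight_zero_add_ne_zero hk1 hk6 hα0 hα1 (hκ x))
  have hc2 : Φ c * (algebraMap ℂ (H →L[ℂ] H) (bdfWeight k α 0) + Φ (complexMap κ)) = 1 := by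
    rw [← map_one Φ, ← hc1, map_mul, map_add, AlgHomClass.commutes]
  have : IsScalarTower ℂ (H →L[ℂ] H) H := ⟨fun _ _ _ => rfl⟩
  have hE := eq_zero_of_discrete_recursion (ω := bdfWeight k α) hc2 (N := N)
    (E := fun n => W n - (Φ (a₁ n) y + Φ (a₂ n) z)) ?_ ?_
  · intro n hn
    exact sub_eq_zero.mp (hE n hn)
  · simp only [hW0, hzero γ₁ hγ₁ a₁ h1, hzero γ₂ hγ₂ a₂ h2, map_zero]
    simp
  · intro n hn1 hn
    have e1 := hW n hn1 hn
    have e2 := hrec a₁ _ h1r n y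
    have e3 := hrec a₂ _ h2r n z
    simp only [ContinuousLinearMap.smul_def, smul_sub, smul_add,
      Finset.sum_sub_distrib, Finset.sum_add_distrib]
    rw [← sub_eq_zero] at e1
    rw [← e1, ← e2, ← e3]
    abel

variable [CompactSpace X]

theorem mlKernel_apply {α β t : ℝ} (hα : 0 < α) (hβ : 0 < β) (ht : 0 < t) (b : C(X, ℂ)) (x : X) :
    mlKernel α β t b x = mlKernel α β t (b x) :=
  map_mlKernel (ContinuousMap.evalAlgHom ℝ ℂ x) (continuous_eval_const x) hα hβ ht b

theorem norm_calculus_apply_le (Φ : C(X, ℂ) →⋆ₐ[ℂ] (H →L[ℂ] H)) {a : C(X, ℂ)} {M : ℝ}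
    (hM : 0 ≤ M) (ha : ∀ x, ‖a x‖ ≤ M) (x : H) : ‖Φ a x‖ ≤ M * ‖x‖ := by
  refine ((Φ a).le_opNorm x).trans ?_
  gcongr
  exact (NonUnitalStarAlgHom.norm_apply_le Φ a).trans ((ContinuousMap.norm_le _ hM).mpr ha)

variable [NormedSpace ℝ H] [IsScalarTower ℝ ℂ H]

/-- The action on vectors of a functional calculus, as a real bilinear map. -/
noncomputable def calculusAction (Φ : C(X, ℂ) →⋆ₐ[ℂ] (H →L[ℂ] H)) :
    C(X, ℂ) →L[ℝ] H →L[ℝ] H :=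
  LinearMap.mkContinuous₂ (LinearMap.mk₂ ℝ (fun a x => Φ a x)
    (fun a c x => by rw [map_add]; rfl)
    (fun r a x => by
      have : r • a = (r : ℂ) • a := by ext y; simp
      rw [this, map_smul]
      change (r : ℂ) • Φ a x = r • Φ a x
      rw [RCLike.real_smul_eq_coe_smul (K := ℂ)]
      rfl)
    (fun a x y => map_add _ _ _)
    (fun r a x => map_real_smul (Φ a) (Φ a).continuous r x)) 1
    (fun a x => by
      rw [one_mul]
      refine ((Φ a).le_opNorm x).trans ?_
      gcongr
      exact NonUnitalStarAlgHom.norm_apply_le Φ a)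

@[simp]
theorem calculusAction_apply (Φ : C(X, ℂ) →⋆ₐ[ℂ] (H →L[ℂ] H)) (a : C(X, ℂ)) (x : H) :
    calculusAction Φ a x = Φ a x := rfl

end Calculus

end Subdiffusion

namespace Subdiffusion

/-! ### The error estimate -/

section Error

variable {d : ℕ} {Ω : Set (EuclideanSpace ℝ (Fin d))} {X : Type*} [TopologicalSpace X]

/-- The cut-off replaces `A` by a bounded operator, and multiplication by τ^α gives the scheme of
step size one with the spectral parameter τ^α b. The data v enters through -A v, which is why the
scalar error is weighted with x. -/
theorem IsDiscreteSolution.calculus_recursion {α τ μ : ℝ} {N m k : ℕ} {v q : L2 Ω} {W : ℕ → L2 Ω}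
    (hW : IsDiscreteSolution Ω α τ N m k μ v q W) (hτ : 0 < τ) (hm : 1 ≤ m) (hμ : -1 < μ)
    (Φ : C(X, ℂ) →⋆ₐ[ℂ] (L2 Ω →L[ℂ] L2 Ω)) {φ : C(X, ℂ)} {b : C(X, ℝ)}
    (hcut : ∀ u f, HasDirichletLaplacian Ω u f → Φ φ f = -Φ (complexMap b) (Φ φ u)) (n : ℕ)
    (hn1 : 1 ≤ n) (hn : n ≤ N) :
    ∑ j ∈ Finset.range (n + 1), bdfWeight k α j • Φ φ (W (n - j)) +
      Φ (complexMap (τ ^ α • b)) (Φ φ (W n)) =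
        schemeRhs k m m n • (-Φ (complexMap (τ ^ α • b)) (Φ φ v)) +
        schemeRhs k m (μ + m) n • (((τ ^ (α + μ) * Real.Gamma (μ + 1) : ℝ) : ℂ) • Φ φ q) := by
  have h := hcut _ _ (hW.equation n hn1 hn)
  rw [bdfCQ_pow_div_factorial hτ, bdfCQ_smoothedSource hτ hm hμ] at h
  unfold bdfCQ at h
  rw [map_sub, map_smul, map_smul, map_sum, map_add, map_add, map_smul, map_smul] at h
  simp only [map_smul] at h
  have hκ : ∀ x, Φ (complexMap (τ ^ α • b)) x = ((τ ^ α : ℝ) : ℂ) • Φ (complexMap b) x := by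
    intro x
    have : complexMap (τ ^ α • b) = ((τ ^ α : ℝ) : ℂ) • complexMap b := by
      ext y; simp
    rw [this, map_smul]
    rfl
  have hτα : ((τ ^ α : ℝ) : ℂ) * ((τ ^ (-α) : ℝ) : ℂ) = 1 := by
    rw [← Complex.ofReal_mul, ← Real.rpow_add hτ, add_neg_cancel, Real.rpow_zero,
      Complex.ofReal_one]
  have hταμ : ((τ ^ (α + μ) * Real.Gamma (μ + 1) : ℝ) : ℂ) =
      ((τ ^ α : ℝ) : ℂ) * ((τ ^ μ * Real.Gamma (μ + 1) : ℝ) : ℂ) := by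
    rw [Real.rpow_add hτ]; push_cast; ring
  rw [hκ, hκ, hταμ]
  have h' := congrArg (fun y => ((τ ^ α : ℝ) : ℂ) • y) h
  simp only [smul_sub, smul_smul, hτα, one_smul, smul_neg, smul_add] at h'
  rw [sub_eq_iff_eq_add] at h'
  rw [h']
  simp only [smul_smul, smul_neg]
  module

variable [CompactSpace X]

/-- The truncated solution solves an equation with a bounded operator, to which the uniqueness
theorem applies. -/
theorem IsSolution.calculus_eq {α T μ : ℝ} {m : ℕ} {v q : L2 Ω} {V : ℝ → L2 Ω}
    (hV : IsSolution Ω α T m μ v q V) (hα0 : 0 < α) (hα1 : α < 1) (hm : 1 ≤ m) (hμ : -1 < μ)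
    (hT : 0 < T) (Φ : C(X, ℂ) →⋆ₐ[ℂ] (L2 Ω →L[ℂ] L2 Ω)) {φ b : C(X, ℂ)}
    (hcut : ∀ u f, HasDirichletLaplacian Ω u f → Φ φ f = -Φ b (Φ φ u)) :
    ∀ t ∈ Set.Ioc 0 T,
      Φ φ (V t) = mlSolution (calculusAction Φ) α μ b (Φ φ v) (Φ φ q) t := by
  set L : L2 Ω →L[ℝ] L2 Ω := calculusAction Φ φ with hL
  have hu : ∀ t ∈ Set.Ioc 0 T,
      fracIntegral (1 - α) (fun s => L (V s)) t = L (fracIntegral (1 - α) V t) := by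
    intro t ht
    apply fracIntegral_clm
    have := hV.integrable t ht
    rwa [show -α = 1 - α - 1 by ring] at this
  refine eq_mlSolution (V := fun s => L (V s)) hα0 hα1 hμ hT (fun x => ?_) (fun a c x => ?_)
    (L.continuous.comp_continuousOn hV.continuousOn) (fun t ht => ?_) ?_ (fun t ht => ?_)
  · rw [calculusAction_apply, map_one]; rfl
  · rw [calculusAction_apply, map_mul]; rfl
  · have := hV.integrable t ht
    rw [show -α = 1 - α - 1 by ring] at this ⊢
    exact intervalIntegrable_clm L this
  · have h1 : Tendsto (fun t => L (fracIntegral (1 - α) V t)) (𝓝[>] 0) (𝓝 0) := by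
      have := (L.continuous.tendsto 0).comp hV.initial
      rwa [map_zero] at this
    refine h1.congr' ?_
    filter_upwards [Ioc_mem_nhdsGT hT] with t ht
    exact (hu t ht).symm
  · obtain ⟨f, hf, hder⟩ := hV.equation t ht
    rw [iteratedDeriv_pow_div_factorial, one_smul] at hf
    rw [iteratedDeriv_smoothedSource hm hμ q ht.1] at hder
    have h1 : HasDerivWithinAt (fun t => L (fracIntegral (1 - α) V t)) (L (f + t ^ μ • q))
        (Set.Ioc 0 T) t := L.hasFDerivAt.comp_hasDerivWithinAt t hder
    have h2 : L (f + t ^ μ • q) =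
        -calculusAction Φ b (L (V t) + Φ φ v) + t ^ μ • Φ φ q := by
      rw [map_add, map_smul]
      change Φ φ f + t ^ μ • Φ φ q = -Φ b (Φ φ (V t) + Φ φ v) + t ^ μ • Φ φ q
      rw [hcut _ _ hf, map_add (Φ φ)]
    rw [h2] at h1
    exact h1.congr (fun s hs => hu s hs) (hu t ht)

/-- The scalar estimates imply the error estimate for spectrally truncated solutions. -/
theorem norm_calculus_sub_le {α T μ τ : ℝ} {m k N n : ℕ} {v q : L2 Ω} {V : ℝ → L2 Ω}
    {W : ℕ → L2 Ω} (hk1 : 1 ≤ k) (hk6 : k ≤ 6) (hα0 : 0 < α) (hα1 : α < 1) (hm : 1 ≤ m)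
    (hμ : -1 < μ) (hT : 0 < T) (hτ : 0 < τ) (hV : IsSolution Ω α T m μ v q V)
    (hW : IsDiscreteSolution Ω α τ N m k μ v q W) (hn1 : 1 ≤ n) (hn : n ≤ N)
    (hnT : (n : ℝ) * τ ≤ T) {M₁ M₂ : ℝ}
    (h1 : ∀ x : ℝ, 0 ≤ x →
      x * ‖schemeCoeff k m α m x n - mlKernel α (α + 1) (n : ℝ) (-(x : ℂ))‖ ≤ M₁)
    (h2 : ∀ x : ℝ, 0 ≤ x →
      ‖schemeCoeff k m α (μ + m) x n - mlKernel α (α + μ + 1) (n : ℝ) (-(x : ℂ))‖ ≤ M₂)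
    (Φ : C(X, ℂ) →⋆ₐ[ℂ] (L2 Ω →L[ℂ] L2 Ω)) {φ : C(X, ℂ)} {b : C(X, ℝ)} (hb : ∀ r, 0 ≤ b r)
    (hcut : ∀ u f, HasDirichletLaplacian Ω u f → Φ φ f = -Φ (complexMap b) (Φ φ u)) :
    ‖Φ φ (W n - V (n * τ))‖ ≤
      M₁ * ‖Φ φ v‖ + τ ^ (α + μ) * Real.Gamma (μ + 1) * M₂ * ‖Φ φ q‖ := by
  have hm1 : (1 : ℝ) ≤ m := by exact_mod_cast hm
  have hn0 : (0 : ℝ) < n := by exact_mod_cast hn1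
  have ht : 0 < (n : ℝ) * τ := by positivity
  have hτα : 0 < τ ^ α := Real.rpow_pos_of_pos hτ _
  have hΓ := Real.Gamma_pos_of_pos (by linarith : 0 < μ + 1)
  have hκ : ∀ r, 0 ≤ (τ ^ α • b) r := fun r => mul_nonneg hτα.le (hb r)
  obtain ⟨a₁, ha₁, hr₁⟩ := exists_schemeMap (m := m) (γ := m) hk1 hk6 hα0 hα1 (by linarith)
    (τ ^ α • b) hκ
  obtain ⟨a₂, ha₂, hr₂⟩ := exists_schemeMap (m := m) (γ := μ + m) hk1 hk6 hα0 hα1 (by linarith)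
    (τ ^ α • b) hκ
  have eW := discrete_representation (m := m) (γ₁ := m) (γ₂ := μ + m) hk1 hk6 hα0 hα1 (by linarith)
    (by linarith) Φ (τ ^ α • b) hκ ha₁ hr₁ ha₂ hr₂ (W := fun n => Φ φ (W n))
    (by simp only [hW.initial, map_zero])
    (fun n hn1 hn => hW.calculus_recursion hτ hm hμ Φ hcut n hn1 hn) n hn
  have eV := hV.calculus_eq hα0 hα1 hm hμ hT Φ hcut _ ⟨ht, hnT⟩
  have hscale : ∀ β : ℝ, 0 < β → ∀ r, mlKernel α β ((n : ℝ) * τ) (-complexMap b) r =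
      ((τ ^ (β - 1) : ℝ) : ℂ) * mlKernel α β (n : ℝ) (-(((τ ^ α • b) r : ℝ) : ℂ)) := by
    intro β hβ r
    rw [mlKernel_apply hα0 hβ ht, mlKernel_mul hτ.le hn0.le, Complex.real_smul]
    congr 2
    rw [ContinuousMap.neg_apply, complexMap_apply, Complex.real_smul, ContinuousMap.smul_apply,
      smul_eq_mul]
    push_cast
    ring
  -- The values of `A` and `B` at r are the scalar errors at x = τ^α b(r), the former weighted with
  -- -x and the latter with τ^(α+μ) Γ(μ+1).
  set A : C(X, ℂ) := complexMap b * mlKernel α (α + 1) ((n : ℝ) * τ) (-complexMap b) -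
    complexMap (τ ^ α • b) * a₁ n with hA
  set B : C(X, ℂ) := ((τ ^ (α + μ) * Real.Gamma (μ + 1) : ℝ) : ℂ) • a₂ n -
    ((Real.Gamma (μ + 1) : ℝ) : ℂ) • mlKernel α (α + μ + 1) ((n : ℝ) * τ) (-complexMap b) with hB
  have hdiff : Φ φ (W n - V (n * τ)) = Φ A (Φ φ v) + Φ B (Φ φ q) := by
    rw [map_sub, eV, eW, hA, hB]
    have hmulΦ : ∀ (a c : C(X, ℂ)) x, Φ (a * c) x = Φ a (Φ c x) := fun a c x => by
      rw [map_mul]; rfl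
    have hcomm : Φ (a₁ n) (Φ (complexMap (τ ^ α • b)) (Φ φ v)) =
        Φ (complexMap (τ ^ α • b)) (Φ (a₁ n) (Φ φ v)) := by
      rw [← hmulΦ (a₁ n) (complexMap (τ ^ α • b)), mul_comm, hmulΦ]
    unfold mlSolution
    simp only [calculusAction_apply, map_sub Φ, map_smul, sub_apply, map_neg (Φ (a₁ n)), hmulΦ,
      smul_apply, RCLike.real_smul_eq_coe_smul (K := ℂ) (Real.Gamma (μ + 1)), hcomm,
      Complex.coe_algebraMap]
    abel
  have hAb : ∀ r, ‖A r‖ ≤ M₁ := by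
    intro r
    have e : A r = -((((τ ^ α • b) r : ℝ) : ℂ) * (schemeCoeff k m α m ((τ ^ α • b) r) n -
        mlKernel α (α + 1) (n : ℝ) (-(((τ ^ α • b) r : ℝ) : ℂ)))) := by
      rw [hA, ContinuousMap.sub_apply, ContinuousMap.mul_apply, ContinuousMap.mul_apply,
        hscale _ (by linarith), ha₁, complexMap_apply, complexMap_apply, add_sub_cancel_right]
      have : (((τ ^ α • b) r : ℝ) : ℂ) = ((τ ^ α : ℝ) : ℂ) * (b r : ℂ) := by
        rw [ContinuousMap.smul_apply, smul_eq_mul, Complex.ofReal_mul]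
      rw [this]
      ring
    rw [e, norm_neg, norm_mul, Complex.norm_real, Real.norm_of_nonneg (hκ r)]
    exact h1 _ (hκ r)
  have hBb : ∀ r, ‖B r‖ ≤ τ ^ (α + μ) * Real.Gamma (μ + 1) * M₂ := by
    intro r
    have e : B r = ((τ ^ (α + μ) * Real.Gamma (μ + 1) : ℝ) : ℂ) *
        (schemeCoeff k m α (μ + m) ((τ ^ α • b) r) n -
          mlKernel α (α + μ + 1) (n : ℝ) (-(((τ ^ α • b) r : ℝ) : ℂ))) := by
      rw [hB, ContinuousMap.sub_apply, ContinuousMap.smul_apply, ContinuousMap.smul_apply,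
        hscale _ (by linarith), ha₂, add_sub_cancel_right]
      simp only [smul_eq_mul]
      push_cast
      ring
    have hτ' : 0 < τ ^ (α + μ) := Real.rpow_pos_of_pos hτ _
    rw [e, norm_mul, Complex.norm_real, Real.norm_of_nonneg (by positivity)]
    gcongr
    exact h2 _ (hκ r)
  have hM₁ : 0 ≤ M₁ := by
    have := h1 0 le_rfl
    rwa [zero_mul] at this
  have hM₂ : 0 ≤ M₂ := (norm_nonneg _).trans (h2 0 le_rfl)
  have hτ' : 0 < τ ^ (α + μ) := Real.rpow_pos_of_pos hτ _
  rw [hdiff]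
  exact (norm_add_le _ _).trans (add_le_add (norm_calculus_apply_le Φ hM₁ hAb _)
    (norm_calculus_apply_le Φ (by positivity) hBb _))

end Error

/-- The truncated bound does not depend on the cut-off. On the dense range of R the cut-offs
converge to the identity, and being contractions they do so on the error itself. -/
theorem exists_error_bound {d : ℕ} {Ω : Set (EuclideanSpace ℝ (Fin d))} (hΩ : IsOpen Ω)
    {α μ : ℝ} {m k : ℕ} (hk1 : 1 ≤ k) (hk6 : k ≤ 6) (hα0 : 0 < α) (hα1 : α < 1) (hm : 1 ≤ m)
    (hμ : -1 < μ) : ∃ C : ℝ, 0 < C ∧ ∀ (T τ : ℝ) (N n : ℕ) (v q : L2 Ω) (V : ℝ → L2 Ω)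
      (W : ℕ → L2 Ω), 0 < T → 0 < τ → IsSolution Ω α T m μ v q V →
      IsDiscreteSolution Ω α τ N m k μ v q W → 1 ≤ n → n ≤ N → (n : ℝ) * τ ≤ T →
      ‖W n - V (n * τ)‖ ≤
        C * ((n : ℝ) ^ (-(initialOrder m : ℝ)) + (n : ℝ) ^ (-(k : ℝ))) * ‖v‖ +
        C * τ ^ (α + μ) * ((n : ℝ) ^ (α - m - 1) + (n : ℝ) ^ (α + μ - k)) * ‖q‖ := by
  obtain ⟨C₁, hC₁, h1⟩ := exists_mul_norm_schemeCoeff_sub_le hk1 hk6 hα0 hα1 hm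
  obtain ⟨C₂, hC₂, h2⟩ := exists_norm_schemeCoeff_sub_le hk1 hk6 hα0 hα1 hm hμ
  have hΓ := Real.Gamma_pos_of_pos (by linarith : 0 < μ + 1)
  refine ⟨C₁ + Real.Gamma (μ + 1) * C₂, by positivity, ?_⟩
  intro T τ N n v q V W hT hτ hV hW hn1 hn hnT
  have hn0 : (0 : ℝ) < n := by exact_mod_cast hn1
  set P₁ : ℝ := (n : ℝ) ^ (-(initialOrder m : ℝ)) + (n : ℝ) ^ (-(k : ℝ)) with hP₁
  set P₂ : ℝ := (n : ℝ) ^ (α - m - 1) + (n : ℝ) ^ (α + μ - k) with hP₂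
  have hP₁0 : 0 < P₁ := by positivity
  have hP₂0 : 0 < P₂ := by positivity
  have hτ' : 0 < τ ^ (α + μ) := Real.rpow_pos_of_pos hτ _
  set K : ℝ := C₁ * P₁ * ‖v‖ + τ ^ (α + μ) * Real.Gamma (μ + 1) * (C₂ * P₂) * ‖q‖ with hK
  have hKle : K ≤ (C₁ + Real.Gamma (μ + 1) * C₂) * P₁ * ‖v‖ +
      (C₁ + Real.Gamma (μ + 1) * C₂) * τ ^ (α + μ) * P₂ * ‖q‖ := by
    have e1 : 0 ≤ Real.Gamma (μ + 1) * C₂ * P₁ * ‖v‖ := by positivity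
    have e2 : 0 ≤ C₁ * τ ^ (α + μ) * P₂ * ‖q‖ := by positivity
    rw [hK]
    linarith
  refine le_trans ?_ hKle
  set R := dirichletResolvent Ω with hR
  have hRp : R.IsPositive := isPositive_dirichletResolvent
  have hR1 : ‖R‖ ≤ 1 := norm_dirichletResolvent_le
  set E : L2 Ω := W n - V (n * τ) with hE
  refine le_of_forall_pos_le_add fun δ hδ => ?_
  -- Budget for δ: approximating the error by R y costs δ/4 twice, and the cut-off on R y costs at
  -- most δ/2.
  obtain ⟨y, hy⟩ := (dense_range_dirichletResolvent hΩ).exists_dist_lt E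
    (by positivity : 0 < δ / 4)
  rw [dist_eq_norm] at hy
  obtain ⟨φ, b, hb, hφ, hcut, happ⟩ := exists_spectral_cutoff hRp hR1
    (by positivity : 0 < δ / (4 * (‖y‖ + 1)))
  set Φ := cfcHom (R := ℂ) hRp.isSelfAdjoint.isStarNormal with hΦ
  have hΦφ : ∀ x, ‖Φ φ x‖ ≤ ‖x‖ := fun x => by
    have := norm_calculus_apply_le Φ zero_le_one
      (fun r => (ContinuousMap.norm_coe_le_norm φ r).trans hφ) x
    rwa [one_mul] at this
  have hmain := norm_calculus_sub_le hk1 hk6 hα0 hα1 hm hμ hT hτ hV hW hn1 hn hnT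
    (fun x hx => h1 x hx n hn1) (fun x hx => h2 x hx n hn1) Φ hb
    (fun u f huf => hcut u f (dirichletResolvent_apply huf))
  have hmainK : ‖Φ φ E‖ ≤ K := by
    refine hmain.trans ?_
    rw [hK]
    gcongr
    · exact hΦφ v
    · exact hΦφ q
  have h3 : ‖Φ φ (R y) - R y‖ ≤ δ / 2 := by
    refine (happ y).trans ?_
    have hy1 : 0 < ‖y‖ + 1 := by positivity
    have : δ / (4 * (‖y‖ + 1)) * (‖y‖ + 1) = δ / 4 := by field_simp
    have : 0 < δ / (4 * (‖y‖ + 1)) := by positivity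
    linarith
  have h4 : E = Φ φ E - Φ φ (E - R y) - (Φ φ (R y) - R y) + (E - R y) := by
    have : Φ φ (E - R y) = Φ φ E - Φ φ (R y) := map_sub _ _ _
    rw [this]
    abel
  have h5 := hΦφ (E - R y)
  calc ‖E‖ = ‖Φ φ E - Φ φ (E - R y) - (Φ φ (R y) - R y) + (E - R y)‖ := by rw [← h4]
    _ ≤ ‖Φ φ E‖ + ‖Φ φ (E - R y)‖ + ‖Φ φ (R y) - R y‖ + ‖E - R y‖ :=
        (norm_add_le _ _).trans (add_le_add ((norm_sub_le _ _).trans (add_le_add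
          (norm_sub_le _ _) le_rfl)) le_rfl)
    _ ≤ K + δ := by linarith

theorem rpow_neg_eq_of_eq_mul {n τ t : ℝ} (hn : 0 < n) (hτ : 0 < τ) (ht : t = n * τ) (c : ℝ) :
    n ^ (-c) = τ ^ c * t ^ (-c) := by
  rw [ht, Real.mul_rpow hn.le hτ.le, mul_left_comm, ← Real.rpow_add hτ, add_neg_cancel,
    Real.rpow_zero, mul_one]

end Subdiffusion
theorem theorem4p1 (d : ℕ) (hd : 1 ≤ d) (Ω : Set (EuclideanSpace ℝ (Fin d)))
    (hΩ : Subdiffusion.IsConvexPolyhedralDomain Ω)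
    (α : ℝ) (hα0 : 0 < α) (hα1 : α < 1)
    (m k : ℕ) (hm : 1 ≤ m) (hmk : m ≤ k) (hk : k ≤ 6)
    (μ : ℝ) (hμ : -1 < μ) :
    ∃ c : ℝ, 0 < c ∧
      ∀ (T : ℝ), 0 < T → ∀ (N : ℕ), 1 ≤ N →
      ∀ (v q : Subdiffusion.L2 Ω) (V : ℝ → Subdiffusion.L2 Ω) (W : ℕ → Subdiffusion.L2 Ω),
        Subdiffusion.IsSolution Ω α T m μ v q V →
        Subdiffusion.IsDiscreteSolution Ω α (T / N) N m k μ v q W →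
        ∀ (n : ℕ), 1 ≤ n → n ≤ N → ∀ (τ t : ℝ), τ = T / N → t = n * τ →
          -- the error estimate
          ‖W n - V t‖ ≤
              c * Subdiffusion.initialBound m k τ t v
              + c * τ ^ (μ + m + 1) * t ^ (α - m - 1) * ‖q‖
              + c * τ ^ (k : ℝ) * t ^ (α + μ - k) * ‖q‖ ∧
          -- order `k` for `m` large enough, in particular for `m = k`
          ((k ≤ Subdiffusion.initialOrder m ∧ (k : ℝ) ≤ μ + m + 1) →
            ‖W n - V t‖ ≤
              c * τ ^ (k : ℝ) * (t ^ (-(k : ℝ)) * ‖v‖ + t ^ (α + μ - k) * ‖q‖)) := by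
  have hk1 : 1 ≤ k := hm.trans hmk
  obtain ⟨C, hC, hbound⟩ := Subdiffusion.exists_error_bound hΩ.isOpen hk1 hk hα0 hα1 hm hμ
  -- The factor 2 is needed for the second claim: there the power of n governed by m is replaced by
  -- the one governed by k, so that equal terms add up.
  refine ⟨2 * C, by positivity, ?_⟩
  intro T hT N hN v q V W hV hW n hn1 hn τ t hτeq hteq
  have hN0 : (0 : ℝ) < N := by exact_mod_cast hN
  have hn0 : (0 : ℝ) < n := by exact_mod_cast hn1
  have hn1' : (1 : ℝ) ≤ n := by exact_mod_cast hn1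
  have hτ : 0 < τ := by rw [hτeq]; positivity
  have ht : 0 < t := by rw [hteq]; positivity
  have hnT : (n : ℝ) * τ ≤ T := by
    have : (n : ℝ) ≤ N := by exact_mod_cast hn
    calc (n : ℝ) * τ ≤ N * τ := by gcongr
      _ = T := by rw [hτeq]; field_simp
  have h := hbound T τ N n v q V W hT hτ hV (by rw [hτeq]; exact hW) hn1 hn hnT
  rw [← hteq] at h
  have hscale : ∀ c : ℝ, (n : ℝ) ^ (-c) = τ ^ c * t ^ (-c) := fun c =>
    Subdiffusion.rpow_neg_eq_of_eq_mul hn0 hτ hteq c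
  have e₁ : τ ^ (α + μ) * (n : ℝ) ^ (α - m - 1) = τ ^ (μ + m + 1) * t ^ (α - m - 1) := by
    have := hscale (m + 1 - α)
    rw [show -((m : ℝ) + 1 - α) = α - m - 1 by ring] at this
    rw [this, ← mul_assoc, ← Real.rpow_add hτ]
    congr 2
    ring
  have e₂ : τ ^ (α + μ) * (n : ℝ) ^ (α + μ - k) = τ ^ (k : ℝ) * t ^ (α + μ - k) := by
    have := hscale (k - α - μ)
    rw [show -((k : ℝ) - α - μ) = α + μ - k by ring] at this
    rw [this, ← mul_assoc, ← Real.rpow_add hτ]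
    congr 2
    ring
  have hτ' : 0 < τ ^ (α + μ) := Real.rpow_pos_of_pos hτ _
  constructor
  · have hnonneg : 0 ≤ C * (τ ^ (Subdiffusion.initialOrder m : ℝ) *
        t ^ (-(Subdiffusion.initialOrder m : ℝ)) * ‖v‖ + τ ^ (k : ℝ) * t ^ (-(k : ℝ)) * ‖v‖) +
        C * (τ ^ (μ + m + 1) * t ^ (α - m - 1) + τ ^ (k : ℝ) * t ^ (α + μ - k)) * ‖q‖ := by
      positivity
    unfold Subdiffusion.initialBound
    calc ‖W n - V t‖ ≤ _ := h
      _ = C * ((n : ℝ) ^ (-(Subdiffusion.initialOrder m : ℝ)) + (n : ℝ) ^ (-(k : ℝ))) * ‖v‖ +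
          C * (τ ^ (α + μ) * (n : ℝ) ^ (α - m - 1) + τ ^ (α + μ) * (n : ℝ) ^ (α + μ - k)) * ‖q‖ := by
          ring
      _ = C * (τ ^ (Subdiffusion.initialOrder m : ℝ) *
          t ^ (-(Subdiffusion.initialOrder m : ℝ)) * ‖v‖ + τ ^ (k : ℝ) * t ^ (-(k : ℝ)) * ‖v‖) +
          C * (τ ^ (μ + m + 1) * t ^ (α - m - 1) + τ ^ (k : ℝ) * t ^ (α + μ - k)) * ‖q‖ := by
          rw [e₁, e₂, hscale, hscale]
          ring
      _ ≤ _ := by linarith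
  · rintro ⟨hp, hkμ⟩
    have h₁ : (n : ℝ) ^ (-(Subdiffusion.initialOrder m : ℝ)) ≤ (n : ℝ) ^ (-(k : ℝ)) := by
      apply Real.rpow_le_rpow_of_exponent_le hn1'
      have : (k : ℝ) ≤ Subdiffusion.initialOrder m := by exact_mod_cast hp
      linarith
    have h₂ : (n : ℝ) ^ (α - m - 1) ≤ (n : ℝ) ^ (α + μ - k) :=
      Real.rpow_le_rpow_of_exponent_le hn1' (by linarith)
    calc ‖W n - V t‖ ≤ _ := h
      _ ≤ C * ((n : ℝ) ^ (-(k : ℝ)) + (n : ℝ) ^ (-(k : ℝ))) * ‖v‖ +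
          C * τ ^ (α + μ) * ((n : ℝ) ^ (α + μ - k) + (n : ℝ) ^ (α + μ - k)) * ‖q‖ := by
          gcongr
      _ = 2 * C * (n : ℝ) ^ (-(k : ℝ)) * ‖v‖ +
          2 * C * (τ ^ (α + μ) * (n : ℝ) ^ (α + μ - k)) * ‖q‖ := by ring
      _ = _ := by
          rw [e₂, hscale]
          ring
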